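/- For integers $d,k\ge 1$ let $V_+=\{x\in[0,1]^d : \|x\|_1\le k\}$ and let $B_{\mathsf{count}}=CH(V_+\cup -V_+)$ (convex hull) be the Count ball. More generally let $T_{m,\kappa}=\{x\in[0,1]^m:\|x\|_1\le\kappa\}$, the nonnegative part of the Sum ball $\{x\in\mathbb R^m:\|x\|_\infty\le 1,\ \|x\|_1\le\kappa\}$, and let $R_{m,\kappa}=\{x\in(0,1)^m:\kappa-1<\sum_i x_i\le\kappa\}$. Let $A_{n,i}$ be the number of permutations of $n$ elements with exactly $i$ ascents. Time is the number of steps of a real RAM: additions, subtractions, multiplications, comparisons, memory accesses (integer indices are computed with the same unit-cost operations), assignments and draws of independent uniform random reals from $[0,1]$ each cost one step. (1) For a sign vector $J\in\{-1,1\}^d$ with exactly $j$ positive entries, the part of $B_{\mathsf{count}}$ in the closed orthant $O(J)$ of $J$ has volume $$|B_{\mathsf{count}}\cap O(J)|=\frac{1}{d!}\Big(\sum_{i=1}^{k}A_{j,i-1}\Big)\Big(\sum_{i=1}^{k}A_{d-j,i-1}\Big).$$ (2) There are a constant $C$, a Sum sampler $S$, and a single program (the same for all $d,k$) which, on input $(d,k)$,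 always halts within $C d^2$ steps and returns a uniformly distributed point of $B_{\mathsf{count}}$. Here a Sum sampler is a program that, given $(m,\kappa)$, returns within $C(m+1)^2$ steps a uniform point of $T_{m,\kappa}$ (for $\kappa\ge1$ or $m=0$) or, in a second mode, of the slice $R_{m,\kappa}$ (for $1\le\kappa\le m$). The program calls $S$ exactly twice, and makes the following choices. * It draws $J\in\{-1,1\}^d$ with probability proportional to $|B_{\mathsf{count}}\cap O(J)|$; let $j$ be the number of positive entries of $J$. * It draws the cross-section index $t\sim\mathrm{Beta}(j,d-j+1)$ ($t=0$ if $j=0$), and, independently given $J$, a face index $f\in\{1,\dots,j+1\}$: if $j\le1$ then $f=1$; if $j\ge2$ then each $f\le j$ has weight $\sum_{i=1}^{k-1}A_{j-1,i-1}$, and $f=j+1$ has weight $kA_{j-1,k-1}$ if $k<j$ and $0$ otherwise. * The first call of $S$ returns a uniform point $u$ of $T_{\max(j-1,0),k-1}$ if $f\le j$ or $j=0$, and of $R_{j-1,k}$ if $f=j+1$ and $k<j$; the second call returns a uniform point $v$ of $T_{d-j,k}$. Given $J$ and $f$, the variables $t,u,v$ are independent. * If $j\ge1$, let $p\in\mathbb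 R^j$ be $u$ with a coordinate $1$ inserted at position $f$ (if $f\le j$), or $u$ followed by the last coordinate $k-\sum_i u_i$ (if $f=j+1$). The output has the coordinates of $tp$, in order, at the positive positions of $J$ and those of $-(1-t)v$, in order, at the negative positions. -/

import Mathlib

open MeasureTheory ProbabilityTheory
open scoped ENNReal Pointwise

noncomputable section

namespace CountBall

/-! ### Geometry -/

/-- `V_+`: the points of the unit cube whose `ℓ₁` norm is at most `k`. It is also the part of the
`d`-dimensional Sum ball (the intersection of the `ℓ₁` ball of radius `k` and the unit `ℓ_∞` ball)
that lies in the nonnegative orthant. -/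
def posPart (d k : ℕ) : Set (Fin d → ℝ) :=
  {x | (∀ i, 0 ≤ x i ∧ x i ≤ 1) ∧ ∑ i, |x i| ≤ k}

/-- The Count ball, the convex hull of `V_+ ∪ -V_+`. -/
def countBall (d k : ℕ) : Set (Fin d → ℝ) :=
  convexHull ℝ (posPart d k ∪ -posPart d k)

/-- The slice `k - 1 < ∑ xᵢ ≤ k` of the open unit cube. -/
def slice (d k : ℕ) : Set (Fin d → ℝ) :=
  {x | (∀ i, 0 < x i ∧ x i < 1) ∧ (k : ℝ) - 1 < ∑ i, x i ∧ ∑ i, x i ≤ k}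

/-- The orthant of a sign vector; `J i = true` stands for the sign `+`. -/
def orthant {d : ℕ} (J : Fin d → Bool) : Set (Fin d → ℝ) :=
  {x | ∀ i, if J i then 0 ≤ x i else x i ≤ 0}

/-- The number of positive signs. -/
def numPos {d : ℕ} (J : Fin d → Bool) : ℕ :=
  (Finset.univ.filter fun i => J i = true).card

/-- The Eulerian number: the number of permutations of `n` elements with exactly `j` ascents. -/
def eulerian (n j : ℕ) : ℕ :=
  (Finset.univ.filter fun s : Equiv.Perm (Fin n) =>
    (Finset.univ.filter fun i : Fin n => ∃ h : (i : ℕ) + 1 < n, s i < s ⟨i + 1, h⟩).card = j).card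

/-- `A_{n,0} + ⋯ + A_{n,k-1}`. -/
def eulerianSum (n k : ℕ) : ℕ := ∑ i ∈ Finset.range k, eulerian n i

/-- The weight of an orthant with `j` positive signs. -/
def orthantWeight (d k j : ℕ) : ℕ := eulerianSum j k * eulerianSum (d - j) k

/-! ### The random choices of the sampler -/

/-- The normalised orthant weight. -/
def orthantProb {d : ℕ} (k : ℕ) (J : Fin d → Bool) : ℝ≥0∞ :=
  (orthantWeight d k (numPos J) : ℝ≥0∞) /
    ((∑ J' : Fin d → Bool, orthantWeight d k (numPos J') : ℕ) : ℝ≥0∞)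

/-- The `Beta(j, d-j+1)` law; for `j = 0` this is the point mass at `0`. -/
def crossSectionLaw (d j : ℕ) : Measure ℝ :=
  if j = 0 then Measure.dirac 0 else betaMeasure (j : ℝ) ((d : ℝ) - j + 1)

/-- The outer faces of `posPart j k` are the faces `x_f = 1` (`f = 0, …, j-1`) and, if `k < j`, the
cut face `∑ xᵢ = k`, which gets the index `f = j`. -/
def IsCut (k j f : ℕ) : Prop := f = j ∧ k < j

instance (k j f : ℕ) : Decidable (IsCut k j f) := inferInstanceAs (Decidable (_ ∧ _))

/-- The weight of an outer face. If `j ≤ 1` there is nothing to choose. -/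
def faceWeight (k j f : ℕ) : ℕ :=
  if j ≤ 1 then (if f = 0 then 1 else 0)
  else if f < j then eulerianSum (j - 1) (k - 1)
  else if IsCut k j f then k * eulerian (j - 1) (k - 1)
  else 0

/-- The normalised face weight. -/
def faceProb (k j f : ℕ) : ℝ≥0∞ :=
  (faceWeight k j f : ℝ≥0∞) / ((∑ g ∈ Finset.range (j + 1), faceWeight k j g : ℕ) : ℝ≥0∞)

/-- A point of dimension `m` as a sequence that is `0` from the index `m` on. -/
def pad {m : ℕ} (x : Fin m → ℝ) : ℕ → ℝ := fun r => if h : r < m then x ⟨r, h⟩ else 0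

/-- What the Sum sampler samples from: the nonnegative part of the Sum ball (`mode = 0`), or one
slice of the cube (any other mode). -/
def sumRegion (m κ mode : ℕ) : Set (Fin m → ℝ) :=
  if mode = 0 then posPart m κ else slice m κ

/-- The contribution bound and the mode of the first call of the Sum sampler. -/
def firstBound (k j f : ℕ) : ℕ := if IsCut k j f then k else k - 1

/-- See `firstBound`. -/
def firstMode (k j f : ℕ) : ℕ := if IsCut k j f then 1 else 0

/-- The joint law of the orthant `J`, the cross-section index `t`, the face index `f` and the two
outputs `u`, `v` of the Sum sampler. -/
def choiceLaw (d k : ℕ) : Measure ((Fin d → Bool) × ℝ × ℕ × (ℕ → ℝ) × (ℕ → ℝ)) :=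
  ∑ J : Fin d → Bool, ∑ f ∈ Finset.range (numPos J + 1),
    (orthantProb k J * faceProb k (numPos J) f) •
      (Measure.dirac J).prod ((crossSectionLaw d (numPos J)).prod ((Measure.dirac f).prod
        (((cond volume (sumRegion (numPos J - 1) (firstBound k (numPos J) f)
              (firstMode k (numPos J) f))).map pad).prod
          ((cond volume (sumRegion (d - numPos J) k 0)).map pad))))

/-- The `r`-th coordinate of the point of the outer face `f` of `posPart j k` given by `u`. -/
def facePoint (k j f : ℕ) (u : ℕ → ℝ) (r : ℕ) : ℝ :=
  if IsCut k j f then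
    if r + 1 = j then (k : ℝ) - ∑ q ∈ Finset.range (j - 1), u q else u r
  else if r < f then u r else if r = f then 1 else u (r - 1)

/-- The position of `i` among the coordinates that have the same sign. -/
def rank {d : ℕ} (J : Fin d → Bool) (i : Fin d) : ℕ :=
  (Finset.univ.filter fun i' => i' < i ∧ J i' = J i).card

/-- The point returned for given random choices: `t` times the face point in the positive
coordinates, `-(1 - t)` times the second draw in the negative ones. -/
def assemble {d : ℕ} (k : ℕ) :
    (Fin d → Bool) × ℝ × ℕ × (ℕ → ℝ) × (ℕ → ℝ) → Fin d → ℝ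
  | (J, t, f, u, v), i =>
    if J i then t * facePoint k (numPos J) f u (rank J i) else -(1 - t) * v (rank J i)

/-! ### The machine model: a real RAM with unit-cost ring operations and uniform random reals -/

/-- The memory consists of arrays of naturals (for indices and counters) and arrays of reals;
`pos` is the number of random reals used so far. -/
structure Store where
  N : ℕ → ℕ → ℕ
  R : ℕ → ℕ → ℝ
  pos : ℕ

/-- Integer expressions. The name of an array is fixed in the program, the index is computed. -/
inductive NExpr where
  | lit (n : ℕ)
  | get (a : ℕ) (i : NExpr)
  | add (x y : NExpr)
  | sub (x y : NExpr)
  | mul (x y : NExpr)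

def NExpr.eval (s : Store) : NExpr → ℕ
  | .lit n => n
  | .get a i => s.N a (i.eval s)
  | .add x y => x.eval s + y.eval s
  | .sub x y => x.eval s - y.eval s
  | .mul x y => x.eval s * y.eval s

/-- The number of operations in an expression. -/
def NExpr.cost : NExpr → ℕ
  | .lit _ => 1
  | .get _ i => i.cost + 1
  | .add x y => x.cost + y.cost + 1
  | .sub x y => x.cost + y.cost + 1
  | .mul x y => x.cost + y.cost + 1

/-- Real expressions. The only constants are natural numbers. -/
inductive RExpr where
  | ofNat (x : NExpr)
  | get (a : ℕ) (i : NExpr)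
  | add (x y : RExpr)
  | sub (x y : RExpr)
  | mul (x y : RExpr)

def RExpr.eval (s : Store) : RExpr → ℝ
  | .ofNat x => (x.eval s : ℝ)
  | .get a i => s.R a (i.eval s)
  | .add x y => x.eval s + y.eval s
  | .sub x y => x.eval s - y.eval s
  | .mul x y => x.eval s * y.eval s

/-- The number of operations in an expression. -/
def RExpr.cost : RExpr → ℕ
  | .ofNat x => x.cost + 1
  | .get _ i => i.cost + 1
  | .add x y => x.cost + y.cost + 1
  | .sub x y => x.cost + y.cost + 1
  | .mul x y => x.cost + y.cost + 1

/-- Comparisons. -/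
inductive Test where
  | ltN (x y : NExpr)
  | ltR (x y : RExpr)

def Test.holds (s : Store) : Test → Prop
  | .ltN x y => x.eval s < y.eval s
  | .ltR x y => x.eval s < y.eval s

def Test.cost : Test → ℕ
  | .ltN x y => x.cost + y.cost + 1
  | .ltR x y => x.cost + y.cost + 1

/-- Programs. `draw a i` stores the next uniform random real in cell `i` of the real array `a`. -/
inductive Prog where
  | skip
  | setN (a : ℕ) (i x : NExpr)
  | setR (a : ℕ) (i : NExpr) (x : RExpr)
  | draw (a : ℕ) (i : NExpr)
  | seq (p q : Prog)
  | ite (b : Test) (p q : Prog)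
  | loop (b : Test) (p : Prog)

def Store.setN (s : Store) (a i x : ℕ) : Store :=
  { s with N := Function.update s.N a (Function.update (s.N a) i x) }

def Store.setR (s : Store) (a i : ℕ) (x : ℝ) : Store :=
  { s with R := Function.update s.R a (Function.update (s.R a) i x) }

/-- An infinite supply of random reals. -/
abbrev Tape : Type := ℕ → unitInterval

/-- The random reals are independent and uniform on `[0,1]`. -/
def tapeLaw : Measure Tape := Measure.infinitePi fun _ => (volume : Measure unitInterval)

/-- `Exec ω p s n s'`: with the random reals `ω`, the program `p` started in the store `s` halts in
the store `s'` after exactly `n` steps. Every operation, comparison, memory access, assignment and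
random draw counts. -/
inductive Exec (ω : Tape) : Prog → Store → ℕ → Store → Prop
  | skip (s : Store) : Exec ω .skip s 1 s
  | setN (s : Store) (a : ℕ) (i x : NExpr) :
      Exec ω (.setN a i x) s (i.cost + x.cost + 1) (s.setN a (i.eval s) (x.eval s))
  | setR (s : Store) (a : ℕ) (i : NExpr) (x : RExpr) :
      Exec ω (.setR a i x) s (i.cost + x.cost + 1) (s.setR a (i.eval s) (x.eval s))
  | draw (s : Store) (a : ℕ) (i : NExpr) :
      Exec ω (.draw a i) s (i.cost + 1)
        { s.setR a (i.eval s) (ω s.pos : ℝ) with pos := s.pos + 1 }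
  | seq {p q : Prog} {s s' s'' : Store} {m n : ℕ} :
      Exec ω p s m s' → Exec ω q s' n s'' → Exec ω (.seq p q) s (m + n) s''
  | ite_true {b : Test} {p q : Prog} {s s' : Store} {n : ℕ} :
      b.holds s → Exec ω p s n s' → Exec ω (.ite b p q) s (b.cost + n) s'
  | ite_false {b : Test} {p q : Prog} {s s' : Store} {n : ℕ} :
      ¬ b.holds s → Exec ω q s n s' → Exec ω (.ite b p q) s (b.cost + n) s'
  | loop_true {b : Test} {p : Prog} {s s' s'' : Store} {m n : ℕ} :
      b.holds s → Exec ω p s m s' → Exec ω (.loop b p) s' n s'' →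
        Exec ω (.loop b p) s (b.cost + m + n) s''
  | loop_false {b : Test} {p : Prog} {s : Store} :
      ¬ b.holds s → Exec ω (.loop b p) s b.cost s

/-- The initial store: the input is `(d, k)`, everything else is zero. -/
def initStore (d k : ℕ) : Store where
  N a i := if a = 0 ∧ i = 0 then d else if a = 0 ∧ i = 1 then k else 0
  R _ _ := 0
  pos := 0

/-- The output of dimension `m` in a store. -/
def output (m : ℕ) (s : Store) : Fin m → ℝ := fun i => s.R 0 i

/-- The arguments of a call of the Sum sampler. -/
def HasArgs (s : Store) (m κ mode : ℕ) : Prop :=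
  s.N 0 0 = m ∧ s.N 0 1 = κ ∧ s.N 0 2 = mode

/-- `S` is a Sum sampler with running time `O(m²)`: in dimension `m` with contribution bound `κ`,
whatever the rest of the memory holds, it halts within `C (m + 1)²` steps and returns a uniform
point of the nonnegative part of the Sum ball, or of the `κ`-th slice of the cube. -/
def IsSumSampler (S : Prog) (C : ℕ) : Prop :=
  ∀ (m κ mode : ℕ) (s : Store), HasArgs s m κ mode →
    (if mode = 0 then m = 0 ∨ 1 ≤ κ else 1 ≤ κ ∧ κ ≤ m) →
    ∃ (n : Tape → ℕ) (s' : Tape → Store),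
      (∀ ω, Exec ω S s (n ω) (s' ω) ∧ n ω ≤ C * (m + 1) ^ 2) ∧
      HasLaw (fun ω => output m (s' ω)) (cond volume (sumRegion m κ mode)) tapeLaw

/-- The orthant that is recorded in a store. -/
def orthantOf (d : ℕ) (s : Store) : Fin d → Bool := fun i => decide (s.N 1 i ≠ 0)

/-- The random choices: the orthant, the cross-section index and the face index are recorded in the
store `s₁`, the two outputs of the Sum sampler are those in the stores `s₂` and `s₄`. -/
def choices (d : ℕ) (s₁ s₂ s₄ : Store) : (Fin d → Bool) × ℝ × ℕ × (ℕ → ℝ) × (ℕ → ℝ) :=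
  (orthantOf d s₁, s₁.R 1 0, s₁.N 2 0, pad (output (numPos (orthantOf d s₁) - 1) s₂),
    pad (output (d - numPos (orthantOf d s₁)) s₄))

end CountBall

end

open MeasureTheory ProbabilityTheory
open scoped ENNReal Pointwise

noncomputable section

namespace CountBall

/-! Everything comes from cutting polytopes into cones. Over a base of dimension `n`, Lebesgue
measure on a cone is the height times `t ^ n dt` times the measure of the base
(`setLIntegral_cone`). The constant function gives a volume, and an arbitrary function gives a
sampling procedure.

Geometry of the Count ball. Let `J` have `j` positive signs and write a point of its orthant as `(x,
-y)`. It lies in the Count ball iff `x ∈ a T_{j,k}` and `y ∈ (1 - a) T_{d-j,k}` for some `a ∈ [0,1]`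
(`joinSigns_mem_iff`): entries of the two hull points at positions of the wrong sign can only hurt.
The best `a` is the gauge `t` of `x`. So `x = t p` with `p` on an outer face of `T_{j,k}`, and `y`
runs through `(1 - t) T_{d-j,k}`. The cones from the origin over the outer faces contribute `t ^
(j-1)` and a Jacobian, which is `1` for a face `x_f = 1` and `k` for the cut face. The fibre
contributes `(1 - t) ^ (d-j)`. Hence Lebesgue measure on this piece is a sum over the faces of
products of a multiple of the Beta(`j`, `d-j+1`) law and two Lebesgue measures
(`setLIntegral_orthant_succ`). This yields the volume formula (`volume_countBall_inter_orthant`) and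
the uniformity of the assembled point (`map_assemble_choiceLaw`).

Eulerian numbers. A slice of the cube is a hypersimplex. The cones from one of its vertices over the
facets that avoid the vertex all have height one, and these facets are again hypersimplices. The
resulting recurrence for the volumes is that of the Eulerian numbers (`volume_hslice`, `eul_succ`).
Read as a sampling rule, it says: choose a facet with Eulerian weight, choose the radius as the
greatest of `n + 1` uniform reals, and recurse (`lintegral_sliceVec`). This is the Sum sampler.

Randomness. A weighted choice inverts a distribution function (`volume_pickIdx`). The signs are
drawn one after the other, with ratios of path counts as probabilities (`tapeLaw_randSigns`). The
Beta law is that of an order statistic (`lintegral_orderStat`). Independence always means that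
disjoint stretches of the tape are read (`map_pair_shift`).

Programs. On every tape each program is shown to compute an explicit function of the tape within its
time bound (`runs_sumProg`, `exists_countRun`). The laws then concern these functions only
(`map_sumVec`, `map_choiceFun`). -/

/-! ### Eulerian numbers -/

/-- The sequence `x` with the entry `c` inserted at position `p`. -/
def insSeq {α : Type*} (p : ℕ) (c : α) (x : ℕ → α) (q : ℕ) : α :=
  if q < p then x q else if q = p then c else x (q - 1)

/-- The number of ascents among the first `n` entries of a sequence. -/
def ascents (n : ℕ) (x : ℕ → ℕ) : ℕ :=
  ∑ q ∈ Finset.range (n - 1), if x q < x (q + 1) then 1 else 0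

/-- The values of a permutation as a sequence. -/
def permSeq {n : ℕ} (s : Equiv.Perm (Fin n)) (q : ℕ) : ℕ :=
  if h : q < n then (s ⟨q, h⟩ : ℕ) else 0

lemma permSeq_lt {n : ℕ} (s : Equiv.Perm (Fin n)) {q : ℕ} (hq : q < n) : permSeq s q < n := by
  simp [permSeq, hq]

/-- A new largest value makes an ascent with its left neighbour, if there is one, and never with its
right neighbour. An ascent between the two entries that it separates is lost. -/
lemma ascents_insSeq {n p M : ℕ} (x : ℕ → ℕ) (hp : p ≤ n) (hx : ∀ q < n, x q < M) :
    ascents (n + 1) (insSeq p M x) + (if 1 ≤ p ∧ p < n ∧ x (p - 1) < x p then 1 else 0) =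
      ascents n x + (if 1 ≤ p then 1 else 0) := by
  obtain ⟨r, rfl⟩ := Nat.exists_eq_add_of_le hp
  have e1 : ∀ q, q + 1 < p → (if insSeq p M x q < insSeq p M x (q + 1) then 1 else 0) =
      if x q < x (q + 1) then 1 else 0 := by
    intro q hq
    simp [insSeq, hq, Nat.lt_of_succ_lt hq]
  have e2 : ∀ q, (if insSeq p M x (p + q + 1) < insSeq p M x (p + q + 1 + 1) then 1 else 0) =
      if x (p + q) < x (p + q + 1) then 1 else 0 := by
    intro q
    have h1 : ¬ p + q + 1 < p := by omega
    have h2 : ¬ p + q + 1 = p := by omega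
    have h3 : ¬ p + q + 1 + 1 < p := by omega
    have h4 : ¬ p + q + 1 + 1 = p := by omega
    simp [insSeq, h1, h2, h3, h4]
  have e3 : 0 < r → ¬ (insSeq p M x p < insSeq p M x (p + 1)) := by
    intro hr
    have := hx p (by omega)
    simp [insSeq]
    omega
  unfold ascents
  rcases p with _ | p
  · rcases r with _ | r
    · simp
    · rw [show 0 + (r + 1) + 1 - 1 = r + 1 by omega, show 0 + (r + 1) - 1 = r by omega,
        Finset.sum_range_succ']
      have h := e3 (by omega)
      have h' : ∀ q, (if insSeq 0 M x (q + 1) < insSeq 0 M x (q + 1 + 1) then 1 else 0) =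
        if x q < x (q + 1) then 1 else 0 := by simpa using e2
      simp only [h']
      simpa using h
  · have e4 : insSeq (p + 1) M x p < insSeq (p + 1) M x (p + 1) := by
      have := hx p (by omega)
      simpa [insSeq] using this
    rw [show p + 1 + r + 1 - 1 = p + 1 + r by omega, Finset.sum_range_add, Finset.sum_range_succ,
      Finset.sum_congr rfl (fun q hq => e1 q (by simpa using hq))]
    rcases r with _ | r
    · simp [e4]
    · rw [Finset.sum_range_succ']
      have h := e3 (by omega)
      have h' : ∀ q, (if insSeq (p + 1) M x (p + 1 + (q + 1)) <
          insSeq (p + 1) M x (p + 1 + (q + 1) + 1) then 1 else 0) =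
          if x (p + 1 + q) < x (p + 1 + q + 1) then 1 else 0 := fun q => e2 q
      simp only [h']
      rw [show p + 1 + (r + 1) - 1 = p + (r + 1) by omega, Finset.sum_range_add _ p (r + 1),
        Finset.sum_range_succ' _ r]
      have h5 : ∀ q, (if x (p + (q + 1)) < x (p + (q + 1) + 1) then 1 else 0) =
          if x (p + 1 + q) < x (p + 1 + q + 1) then 1 else 0 := fun q => by
        rw [show p + (q + 1) = p + 1 + q by omega]
      simp only [h5]
      rw [if_pos e4, if_neg (by simpa using h)]
      by_cases hc : x p < x (p + 1) <;> simp [hc] <;> ring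

lemma card_ascents {n : ℕ} (s : Equiv.Perm (Fin n)) :
    (Finset.univ.filter fun i : Fin n => ∃ h : (i : ℕ) + 1 < n, s i < s ⟨i + 1, h⟩).card =
      ascents n (permSeq s) := by
  rw [ascents, ← Finset.card_filter]
  refine Finset.card_bij (fun i _ => (i : ℕ)) ?_ ?_ ?_
  · intro i hi
    obtain ⟨h, hlt⟩ := (Finset.mem_filter.1 hi).2
    refine Finset.mem_filter.2 ⟨Finset.mem_range.2 (by omega), ?_⟩
    simp only [permSeq, h, i.2, dif_pos]
    exact hlt
  · intro i _ i' _ h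
    exact Fin.ext h
  · intro q hq
    simp only [Finset.mem_filter, Finset.mem_range] at hq
    have h1 : q + 1 < n := by omega
    refine ⟨⟨q, by omega⟩, ?_, rfl⟩
    simp only [Finset.mem_filter, Finset.mem_univ, true_and]
    refine ⟨h1, ?_⟩
    have := hq.2
    simp only [permSeq, h1, show q < n by omega, dif_pos] at this
    exact this

lemma eulerian_eq (n j : ℕ) :
    eulerian n j = ∑ s : Equiv.Perm (Fin n), if ascents n (permSeq s) = j then 1 else 0 := by
  rw [eulerian, Finset.card_filter]
  exact Finset.sum_congr rfl fun s _ => by rw [card_ascents]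

/-- Insert a largest value at position `p`. -/
def insertMax {n : ℕ} (p : Fin (n + 1)) (s : Equiv.Perm (Fin n)) : Equiv.Perm (Fin (n + 1)) :=
  (finSuccEquiv' p).trans ((Equiv.optionCongr s).trans (finSuccEquiv' (Fin.last n)).symm)

lemma insertMax_self {n : ℕ} (p : Fin (n + 1)) (s : Equiv.Perm (Fin n)) :
    insertMax p s p = Fin.last n := by
  simp [insertMax]

lemma insertMax_succAbove {n : ℕ} (p : Fin (n + 1)) (s : Equiv.Perm (Fin n)) (i : Fin n) :
    insertMax p s (p.succAbove i) = (s i).castSucc := by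
  simp [insertMax]

/-- The position of the largest value recovers `p` and the other entries recover `s`; surjectivity
follows from `(n + 1) * n! = (n + 1)!`. -/
lemma insertMax_bijective (n : ℕ) :
    Function.Bijective fun x : Fin (n + 1) × Equiv.Perm (Fin n) => insertMax x.1 x.2 := by
  rw [Fintype.bijective_iff_injective_and_card]
  constructor
  · rintro ⟨p, s⟩ ⟨p', s'⟩ h
    have h : insertMax p s = insertMax p' s' := h
    have hp : p = p' := by
      apply (insertMax p' s').injective
      rw [← h, insertMax_self, h, insertMax_self]
    subst hp
    have : s = s' := by
      ext i
      have := congrArg (fun t => t (p.succAbove i)) h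
      simp only [insertMax_succAbove] at this
      exact congrArg Fin.val (Fin.castSucc_injective _ this)
    rw [this]
  · simp [Fintype.card_perm, Nat.factorial_succ]

lemma permSeq_insertMax {n : ℕ} (p : Fin (n + 1)) (s : Equiv.Perm (Fin n)) {q : ℕ}
    (hq : q < n + 1) : permSeq (insertMax p s) q = insSeq (p : ℕ) n (permSeq s) q := by
  rw [permSeq, dif_pos hq, insSeq]
  split_ifs with h1 h2
  · have : (⟨q, hq⟩ : Fin (n + 1)) = p.succAbove ⟨q, by omega⟩ := by
      rw [Fin.succAbove_of_castSucc_lt _ _ (by simpa [Fin.lt_def] using h1)]; rfl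
    rw [this, insertMax_succAbove]
    simp [permSeq, show q < n by omega]
  · have : (⟨q, hq⟩ : Fin (n + 1)) = p := Fin.ext h2
    rw [this, insertMax_self]
    rfl
  · have : (⟨q, hq⟩ : Fin (n + 1)) = p.succAbove ⟨q - 1, by omega⟩ := by
      rw [Fin.succAbove_of_le_castSucc _ _ (by simp [Fin.le_def]; omega)]
      ext; simp; omega
    rw [this, insertMax_succAbove]
    simp [permSeq, show q - 1 < n by omega]

lemma ascents_congr {n : ℕ} {x y : ℕ → ℕ} (h : ∀ q < n, x q = y q) :
    ascents n x = ascents n y := by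
  refine Finset.sum_congr rfl fun q hq => ?_
  have := Finset.mem_range.1 hq
  rw [h q (by omega), h (q + 1) (by omega)]

/-- Of the `n + 1` gaps of a permutation with `a` ascents, the front and the `a` ascents keep the
number of ascents when the largest value is inserted; the other `n - a` gaps raise it by one. -/
lemma sum_gaps {n : ℕ} (s : Equiv.Perm (Fin n)) (j : ℕ) :
    (∑ p : Fin (n + 1), if ascents (n + 1) (permSeq (insertMax p s)) = j then 1 else 0) =
      (if ascents n (permSeq s) = j then j + 1 else 0) +
        (if ascents n (permSeq s) + 1 = j then n + 1 - j else 0) := by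
  set x := permSeq s
  set a := ascents n x with ha
  let I : ℕ → Prop := fun p => p = 0 ∨ (1 ≤ p ∧ p < n ∧ x (p - 1) < x p)
  have key : ∀ p : Fin (n + 1), ascents (n + 1) (permSeq (insertMax p s)) =
      if I p then a else a + 1 := by
    intro p
    have e : ascents (n + 1) (permSeq (insertMax p s)) = ascents (n + 1) (insSeq (p : ℕ) n x) :=
      ascents_congr (fun q hq => permSeq_insertMax p s hq)
    rw [e]
    have := ascents_insSeq (p := p) (M := n) x (by omega) (fun q hq => permSeq_lt s hq)
    rw [← ha] at this
    by_cases h0 : (p : ℕ) = 0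
    · simp only [h0] at this ⊢
      simpa [I] using this
    · by_cases h1 : (1 ≤ (p : ℕ) ∧ (p : ℕ) < n ∧ x (p - 1) < x p)
      · rw [if_pos h1, if_pos h1.1] at this
        rw [if_pos (Or.inr h1)]; omega
      · rw [if_neg h1, if_pos (by omega)] at this
        rw [if_neg (by simp only [I]; tauto)]; omega
  have hcount : (∑ p : Fin (n + 1), if I p then 1 else 0) = a + 1 := by
    rw [Fin.sum_univ_eq_sum_range (fun p => if I p then 1 else 0) (n + 1), Finset.sum_range_succ']
    rw [ha, ascents]
    congr 1
    · rcases n with _ | n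
      · simp
      · rw [Finset.sum_range_succ]
        have : ¬ I (n + 1) := by simp [I]
        simp only [this, if_false, add_zero, Nat.add_sub_cancel]
        refine Finset.sum_congr rfl fun q hq => ?_
        have := Finset.mem_range.1 hq
        simp [I, this]
  have hcount' : (∑ p : Fin (n + 1), if I p then 0 else 1) + (a + 1) = n + 1 := by
    rw [← hcount, ← Finset.sum_add_distrib]
    have : ∀ p : Fin (n + 1), ((if I p then 0 else 1) + if I p then 1 else 0) = 1 := by
      intro p; split_ifs <;> rfl
    simp [this]
  simp only [key]
  by_cases h1 : a = j
  · rw [if_pos h1, if_neg (by omega), add_zero]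
    trans (∑ p : Fin (n + 1), if I p then 1 else 0)
    swap
    · rw [hcount, h1]
    refine Finset.sum_congr rfl fun p _ => ?_
    by_cases h : I p <;> simp [h] <;> omega
  · by_cases h2 : a + 1 = j
    · rw [if_neg h1, if_pos h2, zero_add]
      trans (∑ p : Fin (n + 1), if I p then 0 else 1)
      · refine Finset.sum_congr rfl fun p _ => ?_
        by_cases h : I p <;> simp [h, h1, h2]
      · omega
    · rw [if_neg h1, if_neg h2]
      refine Finset.sum_eq_zero fun p _ => ?_
      by_cases h : I p <;> simp [h, h1, h2]

/-- The Eulerian number `A_{n,b-1}`, and `0` for `b = 0`. -/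
def eul (n b : ℕ) : ℕ := if b = 0 then 0 else eulerian n (b - 1)

@[simp] lemma eul_zero_right (n : ℕ) : eul n 0 = 0 := rfl

lemma eul_zero_left (b : ℕ) : eul 0 b = if b = 1 then 1 else 0 := by
  rcases b with _ | _ | b <;> simp [eul, eulerian_eq, ascents]

/-- Every permutation of `n + 1` elements arises exactly once by inserting the largest value into
one of `n` elements, and `sum_gaps` counts the insertions. -/
lemma eul_succ (n b : ℕ) :
    eul (n + 1) (b + 1) = (b + 1) * eul n (b + 1) + (n + 1 - b) * eul n b := by
  have h : eulerian (n + 1) b = ∑ s : Equiv.Perm (Fin n),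
      ((if ascents n (permSeq s) = b then b + 1 else 0) +
        (if ascents n (permSeq s) + 1 = b then n + 1 - b else 0)) := by
    rw [eulerian_eq, ← (insertMax_bijective n).sum_comp
      (fun s => if ascents (n + 1) (permSeq s) = b then 1 else 0), Fintype.sum_prod_type_right]
    exact Finset.sum_congr rfl fun s _ => sum_gaps s b
  simp only [eul, Nat.succ_ne_zero, if_false, Nat.add_sub_cancel]
  rw [h, Finset.sum_add_distrib]
  congr 1
  · rw [eulerian_eq, Finset.mul_sum]
    exact Finset.sum_congr rfl fun s _ => by split_ifs <;> simp
  · rcases b with _ | b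
    · simp
    · simp only [Nat.succ_ne_zero, if_false, Nat.add_sub_cancel]
      rw [eulerian_eq, Finset.mul_sum]
      exact Finset.sum_congr rfl fun s _ => by
        by_cases h : ascents n (permSeq s) = b <;> simp [h]

/-- Dimension `0` is an exception: `eul 0 1 = 1`. -/
lemma eul_eq_zero {n b : ℕ} (hb : n < b) (hn : 1 ≤ n) : eul n b = 0 := by
  induction n generalizing b with
  | zero => omega
  | succ n ih =>
    obtain ⟨b, rfl⟩ : ∃ b', b = b' + 1 := ⟨b - 1, by omega⟩
    rw [eul_succ]
    rcases Nat.eq_zero_or_pos n with rfl | hn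
    · simp only [eul_zero_left]
      rcases b with _ | _ | b
      · omega
      · simp
      · simp
    · rw [ih (by omega) hn]
      rcases Nat.lt_or_ge n b with h | h
      · rw [ih h hn]; simp
      · omega

lemma eul_one (n : ℕ) : eul n 1 = 1 := by
  induction n with
  | zero => simp [eul_zero_left]
  | succ n ih => rw [show (1 : ℕ) = 0 + 1 from rfl, eul_succ]; simpa using ih

lemma eul_pos {n b : ℕ} (hb : 1 ≤ b) (hn : b ≤ n) : 0 < eul n b := by
  induction n generalizing b with
  | zero => omega
  | succ n ih =>
    obtain ⟨b, rfl⟩ : ∃ b', b = b' + 1 := ⟨b - 1, by omega⟩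
    rcases Nat.eq_zero_or_pos b with rfl | h
    · rw [show 0 + 1 = 1 from rfl, eul_one]; exact one_pos
    · rw [eul_succ]
      have := ih h (by omega)
      have h2 : 0 < n + 1 - b := by omega
      positivity

lemma eulerianSum_eq (n k : ℕ) : eulerianSum n k = ∑ b ∈ Finset.range (k + 1), eul n b := by
  rw [Finset.sum_range_succ', eulerianSum]
  simp [eul]

lemma eulerianSum_pos (n : ℕ) {k : ℕ} (hk : 1 ≤ k) : 0 < eulerianSum n k := by
  rw [eulerianSum_eq]
  refine Finset.sum_pos' (fun _ _ => Nat.zero_le _) ⟨1, by simp; omega, ?_⟩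
  rw [eul_one]; exact one_pos

/-- The terms vanish beyond `max n 1`; the `1` is there for `n = 0`, where the only nonzero term has
index `1`. -/
lemma eulerianSum_of_ge {n k m : ℕ} (hn : n ≤ m) (hm : 1 ≤ m) (hk : m ≤ k) :
    eulerianSum n k = eulerianSum n m := by
  rw [eulerianSum_eq, eulerianSum_eq]
  symm
  refine Finset.sum_subset (by simpa using hk) fun b _ hb => ?_
  have hb : m < b := by simpa using hb
  rcases Nat.eq_zero_or_pos n with rfl | h
  · rw [eul_zero_left, if_neg (by omega)]
  · exact eul_eq_zero (by omega) h

/-- The weight of the faces of a polytope sums to the weight of the polytope. -/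
lemma eulerianSum_succ (n k : ℕ) :
    eulerianSum (n + 1) (k + 1) = (n + 1) * eulerianSum n k + (k + 1) * eul n (k + 1) := by
  induction k with
  | zero =>
    simp [eulerianSum_eq, Finset.sum_range_succ, eul_succ]
  | succ k ih =>
    have h1 : ∀ m j, eulerianSum m (j + 1) = eulerianSum m j + eul m (j + 1) := by
      intro m j; rw [eulerianSum_eq, eulerianSum_eq, Finset.sum_range_succ]
    rw [h1, ih, h1 n k, eul_succ]
    -- For `k ≤ n` the truncated `n + 1 - (k + 1)` is a true difference; for `k > n` it is
    -- multiplied by a vanishing Eulerian number.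
    rcases Nat.lt_or_ge n k with h | h
    · have : eul n (k + 1) = 0 := by
        rcases Nat.eq_zero_or_pos n with rfl | hn
        · rw [eul_zero_left, if_neg (by omega)]
        · exact eul_eq_zero (by omega) hn
      rw [this]; ring
    · obtain ⟨r, rfl⟩ := Nat.exists_eq_add_of_le h
      rw [show k + r + 1 - (k + 1) = r by omega]
      ring
/-! ### Integration over cones -/

/-- The points where `φ i` is the first of the largest values. -/
def firstMax {E : Type*} {N : ℕ} (φ : Fin N → E → ℝ) (i : Fin N) : Set E :=
  {x | ∀ q, φ q x ≤ φ i x ∧ (q < i → φ q x < φ i x)}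

lemma exists_mem_firstMax {E : Type*} {N : ℕ} (hN : 0 < N) (φ : Fin N → E → ℝ) (x : E) :
    ∃ i, x ∈ firstMax φ i := by
  have : Nonempty (Fin N) := ⟨⟨0, hN⟩⟩
  obtain ⟨i₀, -, hi₀⟩ := Finset.exists_max_image Finset.univ (fun i => φ i x) Finset.univ_nonempty
  have hne : (Finset.univ.filter fun i => φ i x = φ i₀ x).Nonempty := ⟨i₀, by simp⟩
  set i := (Finset.univ.filter fun i => φ i x = φ i₀ x).min' hne
  have hi : φ i x = φ i₀ x := (Finset.mem_filter.1 (Finset.min'_mem _ hne)).2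
  refine ⟨i, fun q => ⟨hi ▸ hi₀ q (Finset.mem_univ _), fun hq => ?_⟩⟩
  refine lt_of_le_of_ne (hi ▸ hi₀ q (Finset.mem_univ _)) fun h => ?_
  exact absurd (Finset.min'_le _ q (by simp [h, hi])) (not_le.2 hq)

lemma firstMax_disjoint {E : Type*} {N : ℕ} (φ : Fin N → E → ℝ) :
    Pairwise (Function.onFun Disjoint (firstMax φ)) := by
  intro i j hij
  refine Set.disjoint_left.2 fun x hi hj => ?_
  rcases lt_or_gt_of_ne hij with h | h
  · exact absurd ((hj i).2 h) (not_lt.2 (hi j).1)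
  · exact absurd ((hi j).2 h) (not_lt.2 (hj i).1)

lemma measurableSet_firstMax {E : Type*} [MeasurableSpace E] {N : ℕ} {φ : Fin N → E → ℝ}
    (hφ : ∀ q, Measurable (φ q)) (i : Fin N) : MeasurableSet (firstMax φ i) := by
  have : firstMax φ i = ⋂ q, ({x | φ q x ≤ φ i x} ∩ {x | q < i → φ q x < φ i x}) := by
    ext x; simp [firstMax]
  rw [this]
  refine MeasurableSet.iInter fun q => (measurableSet_le (hφ q) (hφ i)).inter ?_
  by_cases h : q < i
  · simpa [h] using measurableSet_lt (hφ q) (hφ i)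
  · simp [h]

/-- Ties are broken by the smallest index, so the pieces are disjoint exactly and the common
boundaries need no null set argument. -/
lemma setLIntegral_eq_sum_firstMax {E : Type*} [MeasurableSpace E] {μ : Measure E} {N : ℕ}
    (hN : 0 < N) {φ : Fin N → E → ℝ} (hφ : ∀ q, Measurable (φ q)) {P : Set E}
    (hP : MeasurableSet P) (g : E → ℝ≥0∞) :
    ∫⁻ x in P, g x ∂μ = ∑ i, ∫⁻ x in P ∩ firstMax φ i, g x ∂μ := by
  have : P = ⋃ i, P ∩ firstMax φ i := by
    ext x
    simp only [Set.mem_iUnion, Set.mem_inter_iff]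
    exact ⟨fun h => (exists_mem_firstMax hN φ x).imp fun i hi => ⟨h, hi⟩, fun ⟨i, h, _⟩ => h⟩
  conv_lhs => rw [this]
  rw [lintegral_iUnion (fun i => hP.inter (measurableSet_firstMax hφ i))
    (fun i j hij => (firstMax_disjoint φ hij).mono Set.inter_subset_right Set.inter_subset_right),
    tsum_fintype]

lemma measurable_insertNth {n : ℕ} (i : Fin (n + 1)) :
    Measurable fun p : ℝ × (Fin n → ℝ) => (i.insertNth p.1 p.2 : Fin (n + 1) → ℝ) :=
  (MeasurableEquiv.piFinSuccAbove (fun _ : Fin (n + 1) => ℝ) i).symm.measurable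

lemma lintegral_affine {α : ℝ} (hα : α ≠ 0) (b : ℝ) {g : ℝ → ℝ≥0∞} (hg : Measurable g) :
    ∫⁻ r, g r = ENNReal.ofReal |α| * ∫⁻ t, g (α * t + b) := by
  have h1 : ∫⁻ t, g (α * t + b) = ∫⁻ r, g (r + b) ∂(Measure.map (α * ·) volume) := by
    rw [lintegral_map (by fun_prop) (by fun_prop)]
  rw [h1, Real.map_volume_mul_left hα, lintegral_smul_measure, lintegral_add_right_eq_self,
    smul_eq_mul, ← mul_assoc, ← ENNReal.ofReal_mul (abs_nonneg _), ← abs_mul, mul_inv_cancel₀ hα]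
  simp

/-- For fixed `w` this is an affine substitution in one variable. The shift `l w` makes it a shear,
which does not enter the Jacobian. -/
lemma lintegral_insertNth {n : ℕ} (i : Fin (n + 1)) {α : ℝ} (hα : α ≠ 0)
    {l : (Fin n → ℝ) → ℝ} (hl : Measurable l) {g : (Fin (n + 1) → ℝ) → ℝ≥0∞} (hg : Measurable g) :
    ∫⁻ x, g x = ENNReal.ofReal |α| * ∫⁻ t : ℝ, ∫⁻ w, g (i.insertNth (α * t + l w) w) := by
  have hm := measurable_insertNth i
  have h0 := ((volume_preserving_piFinSuccAbove (fun _ : Fin (n + 1) => ℝ) i).symm).lintegral_comp hg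
  rw [← h0, Measure.volume_eq_prod, lintegral_prod_symm _ (by
    exact (hg.comp (MeasurableEquiv.measurable _)).aemeasurable)]
  have hm2 : Measurable fun p : ℝ × (Fin n → ℝ) =>
      g (i.insertNth (α * p.1 + l p.2) p.2) :=
    hg.comp (hm.comp (Measurable.prodMk (by fun_prop) measurable_snd))
  rw [lintegral_lintegral_swap (f := fun (t : ℝ) (w : Fin n → ℝ) =>
    g (i.insertNth (α * t + l w) w)) hm2.aemeasurable, ← lintegral_const_mul _ (by
    exact Measurable.lintegral_prod_left' (f := fun p : ℝ × (Fin n → ℝ) =>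
      g (i.insertNth (α * p.1 + l p.2) p.2)) hm2)]
  refine lintegral_congr fun w => ?_
  exact lintegral_affine hα (l w)
    (g := fun r => g (i.insertNth r w)) (hg.comp (hm.comp (measurable_id.prodMk measurable_const)))

lemma lintegral_scale {n : ℕ} {t : ℝ} (ht : 0 < t) {g : (Fin n → ℝ) → ℝ≥0∞} (hg : Measurable g) :
    ∫⁻ w, g w = ENNReal.ofReal (t ^ n) * ∫⁻ w, g (t • w) := by
  have h1 : ∫⁻ w, g (t • w) = ∫⁻ w, g w ∂(Measure.map (t • ·) volume) := by
    rw [lintegral_map hg (by fun_prop)]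
  rw [h1, Measure.map_addHaar_smul _ ht.ne', lintegral_smul_measure, smul_eq_mul, ← mul_assoc,
    ← ENNReal.ofReal_mul (by positivity), abs_of_pos (by positivity)]
  have : t ^ n * (t ^ Module.finrank ℝ (Fin n → ℝ))⁻¹ = 1 := by
    rw [Module.finrank_fin_fun]; exact mul_inv_cancel₀ (by positivity)
  rw [this]; simp

/-- Integration over a cone with apex `a` over a facet, which is parametrised by
`w ↦ i.insertNth (b + l w) w` for `w ∈ Q`. -/
lemma setLIntegral_cone {n : ℕ} (i : Fin (n + 1)) {α b : ℝ} (hα : α ≠ 0)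
    (l : (Fin n → ℝ) →ₗ[ℝ] ℝ) (a : Fin (n + 1) → ℝ) (hb : b + l (i.removeNth a) - a i = α)
    {U : Set (Fin (n + 1) → ℝ)} (hU : MeasurableSet U) {Q : Set (Fin n → ℝ)}
    (hQ : MeasurableSet Q) {S : Set ℝ} (hS : MeasurableSet S) (hS0 : ∀ t ∈ S, 0 < t)
    (h1 : ∀ t w, a + i.insertNth (α * t + l w) w ∈ U → 0 < t)
    (h2 : ∀ t, 0 < t → ∀ w, (a + t • (i.insertNth (b + l w) w - a) ∈ U ↔ t ∈ S ∧ w ∈ Q))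
    {g : (Fin (n + 1) → ℝ) → ℝ≥0∞} (hg : Measurable g) :
    ∫⁻ x in U, g x = ENNReal.ofReal |α| * ∫⁻ t in S, ENNReal.ofReal (t ^ n) *
      ∫⁻ w in Q, g (a + t • (i.insertNth (b + l w) w - a)) := by
  have hl : Measurable l := (LinearMap.continuous_of_finiteDimensional l).measurable
  have hm := measurable_insertNth i
  have hG : Measurable (U.indicator g) := hg.indicator hU
  -- The apex is moved to the origin, and the coordinate `i` is written as `α * t + l w`; then `t`
  -- is the relative distance from the apex, and the base is at `t = 1`.
  rw [← lintegral_indicator hU, ← lintegral_add_left_eq_self _ a,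
    lintegral_insertNth i hα hl (g := fun x => U.indicator g (a + x))
      (hG.comp (measurable_const_add a)), ← lintegral_indicator hS]
  congr 1
  refine lintegral_congr fun t => ?_
  by_cases ht : 0 < t
  swap
  · rw [Set.indicator_of_notMem (fun h => ht (hS0 t h))]
    rw [lintegral_eq_zero_iff' (by
      refine (Measurable.aemeasurable ?_)
      exact (hG.comp (measurable_const_add a)).comp (hm.comp (Measurable.prodMk
        (hl.const_add _) measurable_id)))]
    refine Filter.Eventually.of_forall fun w => ?_
    exact Set.indicator_of_notMem (fun h => ht (h1 t w h)) _
  · have hmw : Measurable fun w => U.indicator g (a + i.insertNth (α * t + l w) w) :=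
      (hG.comp (measurable_const_add a)).comp (hm.comp (Measurable.prodMk
        (hl.const_add _) measurable_id))
    -- The layer at distance `t` is rescaled by `t`, which produces `t ^ n`, and recentred at the
    -- projection of the apex. By `hb` it then carries the parametrisation of the facet.
    rw [lintegral_scale ht hmw, ← lintegral_add_right_eq_self _ (-(i.removeNth a))]
    have key : ∀ w, a + i.insertNth (α * t + l (t • (w + -(i.removeNth a))))
        (t • (w + -(i.removeNth a))) = a + t • (i.insertNth (b + l w) w - a) := by
      intro w
      ext q
      rcases Fin.eq_self_or_eq_succAbove i q with rfl | ⟨p, rfl⟩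
      · simp only [Pi.add_apply, Fin.insertNth_apply_same, Pi.smul_apply, Pi.sub_apply, smul_eq_mul,
          map_smul, map_add, map_neg, ← hb]
        ring
      · simp [Fin.removeNth]
        ring
    have : ∀ w, U.indicator g (a + t • (i.insertNth (b + l w) w - a)) =
        S.indicator (fun t => Q.indicator
          (fun w => g (a + t • (i.insertNth (b + l w) w - a))) w) t := by
      intro w
      have h := h2 t ht w
      by_cases hs : t ∈ S <;> by_cases hq : w ∈ Q <;> simp [Set.indicator, hs, hq, h]
    simp only [key, this]
    by_cases hs : t ∈ S
    · simp only [Set.indicator_of_mem hs]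
      rw [lintegral_indicator hQ]
    · simp [Set.indicator_of_notMem hs]

/-- The shear `x₀ = t - ∑ w` turns the hyperplane into the single value `t = c`. -/
lemma volume_sum_eq_zero {n : ℕ} (hn : 1 ≤ n) (c : ℝ) :
    volume {w : Fin n → ℝ | ∑ i, w i = c} = 0 := by
  obtain ⟨m, rfl⟩ : ∃ m, n = m + 1 := ⟨n - 1, by omega⟩
  have hs : MeasurableSet {w : Fin (m + 1) → ℝ | ∑ i, w i = c} :=
    measurableSet_eq_fun (by fun_prop) (by fun_prop)
  rw [← lintegral_indicator_one hs, lintegral_insertNth 0 one_ne_zero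
    (l := fun w => - ∑ i, w i) (by fun_prop) (measurable_one.indicator hs)]
  have : ∀ t : ℝ, (∫⁻ w : Fin m → ℝ, {w : Fin (m + 1) → ℝ | ∑ i, w i = c}.indicator 1
      (Fin.insertNth (α := fun _ => ℝ) 0 (1 * t + - ∑ i, w i) w)) =
      ({c} : Set ℝ).indicator (fun _ => ∫⁻ w : Fin m → ℝ, 1) t := by
    intro t
    by_cases h : t = c
    · rw [Set.indicator_of_mem (by simpa using h)]
      refine lintegral_congr fun w => ?_
      rw [Set.indicator_of_mem]; rfl
      simp [Fin.sum_univ_succ, h]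
    · rw [Set.indicator_of_notMem (by simpa using h), lintegral_eq_zero_iff' ?_]
      · refine Filter.Eventually.of_forall fun w => ?_
        exact Set.indicator_of_notMem (by simp [Fin.sum_univ_succ, h]) _
      · refine Measurable.aemeasurable ?_
        exact (measurable_one.indicator hs).comp ((measurable_insertNth 0).comp
          (Measurable.prodMk (by fun_prop) measurable_id))
  simp only [this]
  rw [lintegral_indicator (measurableSet_singleton c)]
  simp

lemma volume_apply_eq_zero {n : ℕ} (q : Fin n) (c : ℝ) : volume {w : Fin n → ℝ | w q = c} = 0 :=
  Measure.pi_hyperplane (fun _ : Fin n => (volume : Measure ℝ)) q c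
/-! ### Slices of the cube -/

/-- The coordinates of `w`, followed by the last coordinate for which the sum is `κ`. -/
def homSeq {n : ℕ} (κ : ℝ) (w : Fin n → ℝ) (q : ℕ) : ℝ :=
  if h : q < n then w ⟨q, h⟩ else κ - ∑ i, w i

/-- The vertex `1, …, 1, 0, …, 0` with `k` ones. -/
def apex (k q : ℕ) : ℝ := if q < k then 1 else 0

/-- The value of the coordinate that is constant on the `i`-th facet away from `apex k`. -/
def facetBit (k i : ℕ) : ℕ := if i < k then 0 else 1

/-- A point of the `i`-th facet. -/
def facetSeq (k i : ℕ) (y : ℕ → ℝ) : ℕ → ℝ := insSeq i (facetBit k i : ℝ) y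

/-- A point of the cone over the `i`-th facet. -/
def coneSeq (k i : ℕ) (t : ℝ) (y : ℕ → ℝ) (q : ℕ) : ℝ :=
  apex k q + t * (facetSeq k i y q - apex k q)

/-- The slice `k - 1 ≤ ∑ wᵢ < k` of the open cube. -/
def hslice (n k : ℕ) : Set (Fin n → ℝ) :=
  {w | (∀ i, 0 < w i ∧ w i < 1) ∧ (k : ℝ) - 1 ≤ ∑ i, w i ∧ ∑ i, w i < k}

/-- The point of the slice on the cone over the `i`-th facet. -/
def slicePt (n k i : ℕ) (t : ℝ) (w : Fin n → ℝ) : Fin (n + 1) → ℝ :=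
  fun q => coneSeq k i t (homSeq ((k - facetBit k i : ℕ) : ℝ) w) q

lemma facetBit_le_one (k i : ℕ) : facetBit k i ≤ 1 := by
  unfold facetBit; split_ifs <;> omega

lemma sum_insSeq {N p : ℕ} (hp : p ≤ N) (c : ℝ) (x : ℕ → ℝ) :
    ∑ q ∈ Finset.range (N + 1), insSeq p c x q = c + ∑ q ∈ Finset.range N, x q := by
  obtain ⟨r, rfl⟩ := Nat.exists_eq_add_of_le hp
  rw [show p + r + 1 = p + (r + 1) by omega, Finset.sum_range_add, Finset.sum_range_succ',
    Finset.sum_range_add]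
  have h1 : ∀ q ∈ Finset.range p, insSeq p c x q = x q := by
    intro q hq
    simp [insSeq, Finset.mem_range.1 hq]
  have h2 : ∀ q ∈ Finset.range r, insSeq p c x (p + (q + 1)) = x (p + q) := by
    intro q _
    simp [insSeq, show ¬ p + (q + 1) < p by omega, show p + (q + 1) - 1 = p + q by omega]
  rw [Finset.sum_congr rfl h1, Finset.sum_congr rfl h2]
  simp [insSeq]
  ring

lemma sum_homSeq {n : ℕ} (κ : ℝ) (w : Fin n → ℝ) :
    ∑ q ∈ Finset.range (n + 1), homSeq κ w q = κ := by
  rw [Finset.sum_range_succ, ← Fin.sum_univ_eq_sum_range]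
  simp [homSeq]

lemma sum_apex {k N : ℕ} (hk : k ≤ N) : ∑ q ∈ Finset.range N, apex k q = k := by
  have : (Finset.range N).filter (· < k) = Finset.range k := by
    ext q; simp; omega
  simp only [apex, Finset.sum_boole, this, Finset.card_range]

lemma sum_facetSeq {n k i : ℕ} (hk : 1 ≤ k) (hi : i ≤ n + 1) (w : Fin n → ℝ) :
    ∑ q ∈ Finset.range (n + 2), facetSeq k i (homSeq ((k - facetBit k i : ℕ) : ℝ) w) q = k := by
  rw [facetSeq, sum_insSeq hi, sum_homSeq, Nat.cast_sub ((facetBit_le_one k i).trans hk)]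
  ring

/-- Only the dependent last coordinate is at stake. The vertex and the facet point both have
coordinate sum `k`, hence so has every point on the line through them. -/
lemma homSeq_slicePt {n k i : ℕ} (hk : 1 ≤ k) (hkn : k ≤ n + 1) (hi : i ≤ n + 1) (t : ℝ)
    (w : Fin n → ℝ) {q : ℕ} (hq : q ≤ n + 1) :
    homSeq (k : ℝ) (slicePt n k i t w) q =
      coneSeq k i t (homSeq ((k - facetBit k i : ℕ) : ℝ) w) q := by
  unfold homSeq
  split_ifs with h
  · rfl
  · obtain rfl : q = n + 1 := by omega
    have h1 := sum_facetSeq hk hi w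
    have h2 := sum_apex (show k ≤ n + 2 by omega)
    rw [Finset.sum_range_succ] at h1 h2
    simp only [slicePt]
    rw [Fin.sum_univ_eq_sum_range (fun q => coneSeq k i t
      (homSeq ((k - facetBit k i : ℕ) : ℝ) w) q) (n + 1)]
    simp only [coneSeq, Finset.sum_add_distrib, ← Finset.mul_sum, Finset.sum_sub_distrib]
    change _ = apex k (n + 1) + t * (facetSeq k i (homSeq _ w) (n + 1) - apex k (n + 1))
    linear_combination -h2 - t * (h1 - h2)

lemma facetSeq_eq_insertNth {n k : ℕ} (i : Fin (n + 1)) (κ : ℝ) (w : Fin n → ℝ) (q : Fin (n + 1)) :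
    facetSeq k i (homSeq κ w) q = i.insertNth (α := fun _ => ℝ) (facetBit k i : ℝ) w q := by
  rcases Fin.eq_self_or_eq_succAbove i q with rfl | ⟨p, rfl⟩
  · simp [facetSeq, insSeq]
  · simp only [Fin.insertNth_apply_succAbove, facetSeq, insSeq]
    by_cases h : p.castSucc < i
    · rw [Fin.succAbove_of_castSucc_lt _ _ h]
      have h' : (p : ℕ) < i := h
      simp [h', homSeq]
    · rw [Fin.succAbove_of_le_castSucc _ _ (not_lt.1 h)]
      have h' : (i : ℕ) ≤ p := not_lt.1 h
      simp [homSeq, show ¬ (p : ℕ) + 1 < i by omega, show ¬ (p : ℕ) + 1 = i by omega]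

/-- The last facet fixes the dependent coordinate. In the free coordinates it is therefore the graph
of an affine function with nonzero linear part, whereas on the other facets a free coordinate is
constant. -/
lemma facetSeq_last_eq_insertNth {n k : ℕ} (κ : ℝ) (w : Fin n → ℝ) (q : Fin (n + 1)) :
    facetSeq k (n + 1) (homSeq κ w) q =
      (Fin.last n).insertNth (α := fun _ => ℝ) (κ + - ∑ i, w i) w q := by
  rcases Fin.eq_self_or_eq_succAbove (Fin.last n) q with rfl | ⟨p, rfl⟩
  · simp [facetSeq, insSeq, homSeq, sub_eq_add_neg]
  · have : (p : ℕ) < n + 1 := by omega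
    simp [facetSeq, insSeq, homSeq, this]

/-- The sign of the `q`-th coordinate relative to the vertex `apex k`. -/
def apexSign (k q : ℕ) : ℝ := if q < k then -1 else 1

/-- The gauge functional of the `q`-th facet away from `apex k`. -/
def facetFun (n k : ℕ) (q : Fin (n + 2)) (x : Fin (n + 1) → ℝ) : ℝ :=
  apexSign k q * (homSeq (k : ℝ) x q - apex k q)

lemma measurable_homSeq {n : ℕ} (κ : ℝ) (q : ℕ) : Measurable fun w : Fin n → ℝ => homSeq κ w q := by
  unfold homSeq
  split_ifs <;> fun_prop

lemma measurable_facetFun (n k : ℕ) (q : Fin (n + 2)) : Measurable (facetFun n k q) :=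
  ((measurable_homSeq _ _).sub_const _).const_mul _

/-- The open hypersimplex, in terms of its first coordinates. -/
def openSlice (n k : ℕ) : Set (Fin n → ℝ) :=
  {w | ∀ q : Fin (n + 1), 0 < homSeq (k : ℝ) w q ∧ homSeq (k : ℝ) w q < 1}

lemma measurableSet_openSlice (n k : ℕ) : MeasurableSet (openSlice n k) := by
  have : openSlice n k = ⋂ q : Fin (n + 1), ({w | 0 < homSeq (k : ℝ) w q} ∩
      {w | homSeq (k : ℝ) w q < 1}) := by
    ext w; simp [openSlice]
  rw [this]
  exact MeasurableSet.iInter fun q => (measurableSet_lt measurable_const (measurable_homSeq _ _)).inter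
    (measurableSet_lt (measurable_homSeq _ _) measurable_const)

lemma ae_homSeq_ne {n : ℕ} (hn : 1 ≤ n) (κ c : ℝ) :
    ∀ᵐ w : Fin n → ℝ, ∀ q, homSeq κ w q ≠ c := by
  rw [ae_all_iff]
  intro q
  by_cases h : q < n
  · simp only [homSeq, h, dif_pos]
    exact measure_eq_zero_iff_ae_notMem.1 (volume_apply_eq_zero ⟨q, h⟩ c)
  · simp only [homSeq, h, dif_neg, not_false_iff]
    filter_upwards [measure_eq_zero_iff_ae_notMem.1 (volume_sum_eq_zero hn (κ - c))] with w hw h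
    exact hw (show ∑ i, w i = κ - c by linarith)

lemma mem_openSlice_iff {n k : ℕ} (w : Fin n → ℝ) : w ∈ openSlice n k ↔
    (∀ i, 0 < w i ∧ w i < 1) ∧ (k : ℝ) - 1 < ∑ i, w i ∧ ∑ i, w i < k := by
  constructor
  · intro h
    refine ⟨fun i => ?_, ?_⟩
    · simpa [homSeq] using h i.castSucc
    · have := h (Fin.last n)
      simp only [Fin.val_last, homSeq, lt_irrefl, dif_neg, not_false_iff] at this
      constructor <;> linarith
  · rintro ⟨h1, h2, h3⟩ q
    unfold homSeq
    split_ifs with h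
    · exact h1 _
    · constructor <;> linarith

/-- Dimension `0` has to be excluded: there `hslice 0 1` is a point of mass one and `openSlice 0 1`
is empty. -/
lemma openSlice_ae_eq_hslice {n : ℕ} (hn : 1 ≤ n) (k : ℕ) :
    openSlice n k =ᵐ[volume] hslice n k := by
  rw [Filter.eventuallyEq_set]
  filter_upwards [ae_homSeq_ne hn k 1] with w h1
  have := h1 n
  simp only [homSeq, lt_irrefl, dif_neg, not_false_iff] at this
  rw [mem_openSlice_iff]
  constructor
  · rintro ⟨a, b, c⟩; exact ⟨a, b.le, c⟩
  · rintro ⟨a, b, c⟩; exact ⟨a, lt_of_le_of_ne b (fun h => this (by linarith)), c⟩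

lemma openSlice_ae_eq_slice {n : ℕ} (hn : 1 ≤ n) (k : ℕ) :
    openSlice n k =ᵐ[volume] slice n k := by
  rw [Filter.eventuallyEq_set]
  filter_upwards [ae_homSeq_ne hn k 0] with w h1
  have := h1 n
  simp only [homSeq, lt_irrefl, dif_neg, not_false_iff] at this
  rw [mem_openSlice_iff]
  constructor
  · rintro ⟨a, b, c⟩; exact ⟨a, b, c.le⟩
  · rintro ⟨a, b, c⟩; exact ⟨a, b, lt_of_le_of_ne c (fun h => this (by linarith))⟩

/-- The parameters of the points of the `i`-th facet that count for the `i`-th cone. -/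
def facetParam (n k i : ℕ) : Set (Fin n → ℝ) :=
  {w | ∀ q : Fin (n + 2), (q : ℕ) ≠ i →
    let D := apexSign k q * (facetSeq k i (homSeq ((k - facetBit k i : ℕ) : ℝ) w) q - apex k q)
    0 < D ∧ D ≤ 1 ∧ ((q : ℕ) < i → D < 1)}

lemma measurable_facetSeq {n : ℕ} (k i : ℕ) (κ : ℝ) (q : ℕ) :
    Measurable fun w : Fin n → ℝ => facetSeq k i (homSeq κ w) q := by
  unfold facetSeq insSeq
  split_ifs
  · exact measurable_homSeq _ _
  · fun_prop
  · exact measurable_homSeq _ _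

lemma measurableSet_facetParam (n k i : ℕ) : MeasurableSet (facetParam n k i) := by
  have hD : ∀ q, Measurable fun w : Fin n → ℝ => apexSign k q *
      (facetSeq k i (homSeq ((k - facetBit k i : ℕ) : ℝ) w) q - apex k q) := fun q =>
    ((measurable_facetSeq _ _ _ _).sub_const _).const_mul _
  have : facetParam n k i = ⋂ q : Fin (n + 2), {w | (q : ℕ) ≠ i →
    let D := apexSign k q * (facetSeq k i (homSeq ((k - facetBit k i : ℕ) : ℝ) w) q - apex k q)
    0 < D ∧ D ≤ 1 ∧ ((q : ℕ) < i → D < 1)} := by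
    ext w; simp [facetParam]
  rw [this]
  refine MeasurableSet.iInter fun q => ?_
  by_cases h : (q : ℕ) = i
  · simp [h]
  · simp only [ne_eq, h, not_false_iff, forall_true_left]
    refine (measurableSet_lt measurable_const (hD q)).inter
      ((measurableSet_le (hD q) measurable_const).inter ?_)
    by_cases h' : (q : ℕ) < i
    · simp only [h', forall_true_left]
      exact measurableSet_lt (hD q) measurable_const
    · simp only [h', false_imp_iff]
      exact MeasurableSet.univ

/-- Away from the hyperplanes where a coordinate is `0` or `1`, the conditions on `D` say that each
remaining coordinate lies in `(0,1)`, whatever its sign. In dimension `0` the two facets are the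
same point. The tie-break gives this point to the first of them, and the half-open convention of
`hslice` agrees: `hslice 0 1` is the point and `hslice 0 0` is empty. -/
lemma facetParam_ae_eq {n k i : ℕ} (hk : 1 ≤ k) (hkn : k ≤ n + 1) (hi : i ≤ n + 1) :
    facetParam n k i =ᵐ[volume] hslice n (k - facetBit k i) := by
  rcases Nat.eq_zero_or_pos n with rfl | hn
  · obtain rfl : k = 1 := by omega
    refine Filter.EventuallyEq.of_eq ?_
    ext w
    obtain rfl | rfl : i = 0 ∨ i = 1 := by omega
    · simp [facetParam, hslice, facetBit, facetSeq, insSeq, homSeq, apex, apexSign,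
        Fin.forall_fin_two]
    · simp [facetParam, hslice, facetBit, facetSeq, insSeq, homSeq, apex, apexSign,
        Fin.forall_fin_two]
  · refine Filter.EventuallyEq.trans ?_ (openSlice_ae_eq_hslice hn _)
    rw [Filter.eventuallyEq_set]
    filter_upwards [ae_homSeq_ne hn ((k - facetBit k i : ℕ) : ℝ) 0,
      ae_homSeq_ne hn ((k - facetBit k i : ℕ) : ℝ) 1] with w h0 h1
    have hval : ∀ y : ℝ, y ≠ 0 → y ≠ 1 → ∀ q, (0 < y ∧ y < 1 ↔
        (0 < apexSign k q * (y - apex k q) ∧ apexSign k q * (y - apex k q) ≤ 1 ∧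
          (q < i → apexSign k q * (y - apex k q) < 1))) := by
      intro y hy0 hy1 q
      unfold apexSign apex
      split_ifs
      · constructor
        · rintro ⟨a, b⟩; exact ⟨by linarith, by linarith, fun _ => by linarith⟩
        · rintro ⟨a, b, -⟩
          exact ⟨lt_of_le_of_ne (by linarith) hy0.symm, by linarith⟩
      · constructor
        · rintro ⟨a, b⟩; exact ⟨by linarith, by linarith, fun _ => by linarith⟩
        · rintro ⟨a, b, -⟩
          exact ⟨by linarith, lt_of_le_of_ne (by linarith) hy1⟩
    constructor
    · intro hw q
      by_cases hq : (q : ℕ) < i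
      · have := hw ⟨q, by omega⟩ (by simp; omega)
        simp only [facetSeq, insSeq, hq, if_true] at this
        exact (hval _ (h0 q) (h1 q) q).2 (by simpa [hq] using this)
      · have := hw ⟨q + 1, by omega⟩ (by simp; omega)
        simp only [facetSeq, insSeq, show ¬ (q : ℕ) + 1 < i by omega,
          show ¬ (q : ℕ) + 1 = i by omega, if_false, Nat.add_sub_cancel] at this
        exact (hval _ (h0 q) (h1 q) (q + 1)).2
          (by simpa [show ¬ (q : ℕ) + 1 < i by omega] using this)
    · intro hw q hq
      by_cases hq' : (q : ℕ) < i
      · have := (hval _ (h0 q) (h1 q) q).1 (hw ⟨q, by omega⟩)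
        simpa only [facetSeq, insSeq, hq', if_true] using this
      · have := (hval _ (h0 (q - 1)) (h1 (q - 1)) q).1 (hw ⟨q - 1, by omega⟩)
        simpa only [facetSeq, insSeq, hq', hq, if_false] using this

lemma sum_removeNth {n : ℕ} (i : Fin (n + 1)) (a : Fin (n + 1) → ℝ) :
    ∑ p, i.removeNth a p = (∑ q, a q) - a i := by
  rw [Fin.sum_univ_succAbove a i]
  simp [Fin.removeNth]

lemma apexSign_mul_mul (k q : ℕ) : apexSign k q * apexSign k q = 1 := by
  unfold apexSign; split_ifs <;> norm_num

lemma mem_openSlice_iff_facetFun {n k : ℕ} (x : Fin (n + 1) → ℝ) :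
    x ∈ openSlice (n + 1) k ↔ ∀ q, 0 < facetFun n k q x ∧ facetFun n k q x < 1 := by
  refine forall_congr' fun q => ?_
  unfold facetFun apexSign apex
  split_ifs <;> constructor <;> rintro ⟨a, b⟩ <;> constructor <;> linarith

/-- At the parameter `t` the `i`-th gauge functional has the value `t`, and the other ones are `t`
times their values on the facet. After division by `t`, being the first maximum is a condition on
the facet point alone. -/
lemma cone_mem_iff {n k i : ℕ} (hk : 1 ≤ k) (hkn : k ≤ n + 1) (hi : i < n + 2) {t : ℝ} (ht : 0 < t)
    (w : Fin n → ℝ) :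
    slicePt n k i t w ∈ openSlice (n + 1) k ∩ firstMax (facetFun n k) ⟨i, hi⟩ ↔
      t ∈ Set.Ioo (0 : ℝ) 1 ∧ w ∈ facetParam n k i := by
  have hval : ∀ q : Fin (n + 2), facetFun n k q (slicePt n k i t w) = t * (apexSign k q *
      (facetSeq k i (homSeq ((k - facetBit k i : ℕ) : ℝ) w) q - apex k q)) := by
    intro q
    rw [facetFun, homSeq_slicePt hk hkn (by omega) t w (by omega), coneSeq]
    ring
  have hself : facetFun n k ⟨i, hi⟩ (slicePt n k i t w) = t := by
    rw [hval]
    simp only [facetSeq, insSeq, lt_irrefl, if_false, if_true, apexSign, apex, facetBit]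
    split_ifs <;> norm_num
  rw [Set.mem_inter_iff, mem_openSlice_iff_facetFun]
  constructor
  · rintro ⟨h1, h2⟩
    refine ⟨⟨ht, hself ▸ (h1 ⟨i, hi⟩).2⟩, fun q hq => ?_⟩
    have a := (h1 q).1
    have b := h2 q
    rw [hself] at b
    rw [hval] at a b
    refine ⟨pos_of_mul_pos_right a ht.le, ?_, fun hqi => ?_⟩
    · exact le_of_mul_le_mul_left (by linarith [b.1]) ht
    · exact lt_of_mul_lt_mul_left (by linarith [b.2 hqi]) ht.le
  · rintro ⟨h1, h2⟩
    have h3 : ∀ q, 0 < facetFun n k q (slicePt n k i t w) ∧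
        facetFun n k q (slicePt n k i t w) ≤ t ∧
        (q < ⟨i, hi⟩ → facetFun n k q (slicePt n k i t w) < t) := by
      intro q
      by_cases hq : (q : ℕ) = i
      · obtain rfl : q = ⟨i, hi⟩ := Fin.ext hq
        rw [hself]
        exact ⟨ht, le_rfl, fun h => absurd h (lt_irrefl _)⟩
      · obtain ⟨a, b, c⟩ := h2 q hq
        rw [hval]
        refine ⟨mul_pos ht a, ?_, fun h => ?_⟩
        · simpa using mul_le_mul_of_nonneg_left b ht.le
        · simpa using mul_lt_mul_of_pos_left (c h) ht
    refine ⟨fun q => ⟨(h3 q).1, (h3 q).2.1.trans_lt h1.2⟩, fun q => ?_⟩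
    rw [hself]
    exact (h3 q).2

/-- Every height is `±1`, so no Jacobian remains: a facet fixes one homogeneous coordinate at the
bit that the vertex does not have. For the last facet the height is seen in the sum of the free
coordinates. -/
lemma setLIntegral_slice_cone {n k i : ℕ} (hk : 1 ≤ k) (hkn : k ≤ n + 1) (hi : i < n + 2)
    {g : (Fin (n + 1) → ℝ) → ℝ≥0∞} (hg : Measurable g) :
    ∫⁻ x in openSlice (n + 1) k ∩ firstMax (facetFun n k) ⟨i, hi⟩, g x =
      ∫⁻ t in Set.Ioo (0 : ℝ) 1, ENNReal.ofReal (t ^ n) *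
        ∫⁻ w in hslice n (k - facetBit k i), g (slicePt n k i t w) := by
  have hU : MeasurableSet (openSlice (n + 1) k ∩ firstMax (facetFun n k) ⟨i, hi⟩) :=
    (measurableSet_openSlice _ _).inter (measurableSet_firstMax (measurable_facetFun n k) _)
  have hQ := measurableSet_facetParam n k i
  simp only [← setLIntegral_congr (facetParam_ae_eq hk hkn (show i ≤ n + 1 by omega))]
  set a : Fin (n + 1) → ℝ := fun q => apex k q with ha
  have hpos : ∀ x ∈ openSlice (n + 1) k ∩ firstMax (facetFun n k) ⟨i, hi⟩,
      0 < facetFun n k ⟨i, hi⟩ x := fun x hx => ((mem_openSlice_iff_facetFun x).1 hx.1 _).1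
  rcases Nat.lt_or_ge i (n + 1) with h | h
  · have e : ∀ t w, slicePt n k i t w = a + t • ((⟨i, h⟩ : Fin (n + 1)).insertNth
        ((facetBit k i : ℝ) + (0 : (Fin n → ℝ) →ₗ[ℝ] ℝ) w) w - a) := by
      intro t w
      ext q
      simp only [slicePt, coneSeq, ha, Pi.add_apply, Pi.smul_apply, Pi.sub_apply, smul_eq_mul,
        LinearMap.zero_apply, add_zero]
      rw [← facetSeq_eq_insertNth ⟨i, h⟩ ((k - facetBit k i : ℕ) : ℝ) w q]
    have hb : (facetBit k i : ℝ) + (0 : (Fin n → ℝ) →ₗ[ℝ] ℝ) ((⟨i, h⟩ : Fin (n + 1)).removeNth a) -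
        a ⟨i, h⟩ = apexSign k i := by
      simp only [LinearMap.zero_apply, add_zero, ha, facetBit, apexSign, apex]
      split_ifs <;> norm_num
    have hα : apexSign k i ≠ 0 := by unfold apexSign; split_ifs <;> norm_num
    rw [setLIntegral_cone ⟨i, h⟩ hα 0 a hb hU hQ (S := Set.Ioo (0 : ℝ) 1) measurableSet_Ioo (fun t ht => ht.1) ?_ ?_ hg]
    · have : |apexSign k i| = 1 := by unfold apexSign; split_ifs <;> norm_num
      simp only [this, ENNReal.ofReal_one, one_mul, e]
    · intro t w hx
      have := hpos _ hx
      simp only [facetFun, homSeq, h, dif_pos, Pi.add_apply, Fin.insertNth_apply_same, ha,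
        LinearMap.zero_apply] at this
      nlinarith [apexSign_mul_mul k i]
    · intro t ht w
      rw [← e]
      exact cone_mem_iff hk hkn hi ht w
  · obtain rfl : i = n + 1 := by omega
    have hbit : facetBit k (n + 1) = 1 := by simp [facetBit]; omega
    set l : (Fin n → ℝ) →ₗ[ℝ] ℝ := -∑ p, LinearMap.proj p with hl
    have hlw : ∀ w, l w = -∑ p, w p := by intro w; simp [hl]
    have hsum : ∑ q, a q = k := by
      rw [ha, Fin.sum_univ_eq_sum_range (fun q => apex k q), sum_apex hkn]
    have e : ∀ t w, slicePt n k (n + 1) t w = a + t • ((Fin.last n).insertNth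
        (((k - facetBit k (n + 1) : ℕ) : ℝ) + l w) w - a) := by
      intro t w
      ext q
      simp only [slicePt, coneSeq, ha, Pi.add_apply, Pi.smul_apply, Pi.sub_apply, smul_eq_mul, hlw]
      rw [← facetSeq_last_eq_insertNth ((k - facetBit k (n + 1) : ℕ) : ℝ) w q]
    have hb : ((k - facetBit k (n + 1) : ℕ) : ℝ) + l ((Fin.last n).removeNth a) -
        a (Fin.last n) = -1 := by
      rw [hlw, sum_removeNth, hsum, hbit, Nat.cast_sub hk]
      push_cast; ring
    rw [setLIntegral_cone (Fin.last n) (by norm_num) l a hb hU hQ (S := Set.Ioo (0 : ℝ) 1) measurableSet_Ioo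
      (fun t ht => ht.1) ?_ ?_ hg]
    · simp only [abs_neg, abs_one, ENNReal.ofReal_one, one_mul, e]
    · intro t w hx
      have := hpos _ hx
      simp only [facetFun, homSeq, lt_irrefl, dif_neg, not_false_iff, Pi.add_apply,
        Finset.sum_add_distrib, apexSign, apex, show ¬ n + 1 < k by omega, if_false,
        Fin.sum_univ_succAbove _ (Fin.last n), Fin.insertNth_apply_same,
        Fin.insertNth_apply_succAbove, hlw] at this
      have h3 := hsum
      rw [Fin.sum_univ_succAbove _ (Fin.last n)] at h3
      linarith
    · intro t ht w
      rw [← e]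
      exact cone_mem_iff hk hkn hi ht w

/-- A slice is the union of the cones over its facets away from a vertex. -/
lemma setLIntegral_hslice_succ {n k : ℕ} (hk : 1 ≤ k) (hkn : k ≤ n + 1)
    {g : (Fin (n + 1) → ℝ) → ℝ≥0∞} (hg : Measurable g) :
    ∫⁻ x in hslice (n + 1) k, g x =
      ∑ i ∈ Finset.range (n + 2), ∫⁻ t in Set.Ioo (0 : ℝ) 1, ENNReal.ofReal (t ^ n) *
        ∫⁻ w in hslice n (k - facetBit k i), g (slicePt n k i t w) := by
  rw [← setLIntegral_congr (openSlice_ae_eq_hslice (by omega) k),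
    setLIntegral_eq_sum_firstMax (by omega) (measurable_facetFun n k)
      (measurableSet_openSlice _ _), ← Fin.sum_univ_eq_sum_range (fun i =>
      ∫⁻ t in Set.Ioo (0 : ℝ) 1, ENNReal.ofReal (t ^ n) *
        ∫⁻ w in hslice n (k - facetBit k i), g (slicePt n k i t w))]
  exact Finset.sum_congr rfl fun i _ => setLIntegral_slice_cone hk hkn i.2 hg

/-- Of the `n + 2` facets, `k` have the bit `0` and `n + 2 - k` the bit `1`; these are the two
coefficients in `eul_succ`. -/
lemma sum_eul_facet {n k : ℕ} (hk : k ≤ n + 1) :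
    ∑ i ∈ Finset.range (n + 2), eul n (k - facetBit k i) = eul (n + 1) k := by
  rcases k with _ | b
  · simp
  · obtain ⟨r, hr⟩ : ∃ r, n + 2 = b + 1 + r := ⟨n + 1 - b, by omega⟩
    rw [hr, Finset.sum_range_add, eul_succ, show n + 1 - b = r by omega]
    congr 1
    · rw [Finset.sum_congr rfl (g := fun _ => eul n (b + 1)) (fun i hi => by
        simp [facetBit, Finset.mem_range.1 hi])]
      simp
    · rw [Finset.sum_congr rfl (g := fun _ => eul n b) (fun i _ => by
        simp [facetBit, show ¬ b + 1 + i ≤ b by omega])]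
      simp

lemma setLIntegral_pow (n : ℕ) :
    ∫⁻ t in Set.Ioo (0 : ℝ) 1, ENNReal.ofReal (t ^ n) = ENNReal.ofReal (1 / ((n : ℝ) + 1)) := by
  rw [← ofReal_integral_eq_lintegral_ofReal, ← integral_Ioc_eq_integral_Ioo,
    ← intervalIntegral.integral_of_le zero_le_one, integral_pow]
  · simp
  · exact (((continuous_pow n).integrableOn_Icc (a := 0) (b := 1)).mono_set
      Set.Ioo_subset_Icc_self)
  · exact ae_restrict_of_forall_mem measurableSet_Ioo fun t ht => by
      have := ht.1.le
      positivity

lemma hslice_zero_right (n : ℕ) : hslice n 0 = ∅ := by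
  ext w
  simp only [hslice, Set.mem_ofPred_eq, Set.mem_empty_iff_false, iff_false, not_and, not_lt]
  intro h _
  simpa using Finset.sum_nonneg fun i _ => (h i).1.le

lemma hslice_of_lt {n k : ℕ} (hn : 1 ≤ n) (h : n < k) : hslice n k = ∅ := by
  ext w
  simp only [hslice, Set.mem_ofPred_eq, Set.mem_empty_iff_false, iff_false, not_and]
  intro h1 h2
  exfalso
  have : Nonempty (Fin n) := ⟨⟨0, hn⟩⟩
  have : ∑ i, w i < ∑ _i : Fin n, (1 : ℝ) :=
    Finset.sum_lt_sum_of_nonempty Finset.univ_nonempty fun i _ => (h1 i).2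
  have h3 : (n : ℝ) + 1 ≤ k := by exact_mod_cast h
  simp at this
  linarith

lemma volume_univ_fin_zero : volume (Set.univ : Set (Fin 0 → ℝ)) = 1 := by
  rw [volume_pi, Measure.pi_of_empty]; simp

/-- The cones give `1 / (n + 1)` times the sum of the volumes of the facets, which is the Eulerian
recurrence divided by `(n + 1)!`. -/
lemma volume_hslice (n k : ℕ) :
    volume (hslice n k) = ENNReal.ofReal ((eul n k : ℝ) / n.factorial) := by
  induction n generalizing k with
  | zero =>
    rw [eul_zero_left]
    split_ifs with h
    · have : hslice 0 k = Set.univ := by ext w; simp [hslice, h]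
      rw [this, volume_univ_fin_zero]; simp
    · have : hslice 0 k = ∅ := by
        rcases k with _ | _ | k
        · exact hslice_zero_right 0
        · omega
        · refine Set.eq_empty_iff_forall_notMem.2 fun w hw => ?_
          have := hw.2.1
          push_cast at this
          simp only [Finset.univ_eq_empty, Finset.sum_empty] at this
          linarith [Nat.cast_nonneg (α := ℝ) k]
      rw [this]; simp
  | succ n ih =>
    rcases Nat.eq_zero_or_pos k with rfl | hk
    · rw [hslice_zero_right]; simp
    rcases Nat.lt_or_ge (n + 1) k with h | h
    · rw [hslice_of_lt (by omega) h, eul_eq_zero h (by omega)]; simp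
    · rw [← setLIntegral_one, setLIntegral_hslice_succ hk h measurable_const]
      simp only [setLIntegral_one, ih]
      have : ∀ i, ∫⁻ t in Set.Ioo (0 : ℝ) 1, ENNReal.ofReal (t ^ n) *
          ENNReal.ofReal ((eul n (k - facetBit k i) : ℝ) / n.factorial) =
          ENNReal.ofReal ((eul n (k - facetBit k i) : ℝ) / (n + 1).factorial) := by
        intro i
        rw [lintegral_mul_const _ (by fun_prop), setLIntegral_pow,
          ← ENNReal.ofReal_mul (by positivity), Nat.factorial_succ]
        congr 1
        push_cast
        field_simp
      simp only [this]
      rw [← ENNReal.ofReal_sum_of_nonneg (fun i _ => by positivity), ← Finset.sum_div,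
        ← Nat.cast_sum, sum_eul_facet h]

lemma measurableSet_hslice (n k : ℕ) : MeasurableSet (hslice n k) := by
  have : hslice n k = (⋂ i, ({w : Fin n → ℝ | 0 < w i} ∩ {w | w i < 1})) ∩
      ({w : Fin n → ℝ | (k : ℝ) - 1 ≤ ∑ i, w i} ∩ {w | ∑ i, w i < (k : ℝ)}) := by
    ext w; simp [hslice]
  rw [this]
  exact (MeasurableSet.iInter fun i => (measurableSet_lt (by fun_prop) (by fun_prop)).inter
    (measurableSet_lt (by fun_prop) (by fun_prop))).inter
    ((measurableSet_le (by fun_prop) (by fun_prop)).inter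
    (measurableSet_lt (by fun_prop) (by fun_prop)))
/-! ### The nonnegative part of the Sum ball -/

lemma mem_posPart_iff {m k : ℕ} (x : Fin m → ℝ) :
    x ∈ posPart m k ↔ (∀ i, 0 ≤ x i ∧ x i ≤ 1) ∧ ∑ i, x i ≤ k := by
  refine and_congr_right fun h => ?_
  rw [Finset.sum_congr rfl fun i _ => abs_of_nonneg (h i).1]

lemma hslice_disjoint {m b b' : ℕ} (h : b ≠ b') : Disjoint (hslice m b) (hslice m b') := by
  rw [Set.disjoint_left]
  rintro w ⟨-, h1, h2⟩ ⟨-, h3, h4⟩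
  have e1 : (b : ℝ) < b' + 1 := by linarith
  have e2 : (b' : ℝ) < b + 1 := by linarith
  have e1' : b < b' + 1 := by exact_mod_cast e1
  have e2' : b' < b + 1 := by exact_mod_cast e2
  omega

lemma ae_apply_ne (m : ℕ) (c : ℝ) : ∀ᵐ w : Fin m → ℝ, ∀ q, w q ≠ c := by
  rw [ae_all_iff]
  exact fun q => measure_eq_zero_iff_ae_notMem.1 (volume_apply_eq_zero q c)

/-- Up to boundary faces, the layers are the level sets of the integer part of the coordinate sum.
-/
lemma posPart_ae_eq {m k : ℕ} (h : m = 0 ∨ 1 ≤ k) (hk : 1 ≤ k ∨ 1 ≤ m) :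
    posPart m k =ᵐ[volume] ⋃ b ∈ Finset.range (k + 1), hslice m b := by
  rcases Nat.eq_zero_or_pos m with rfl | hm
  · have hk : 1 ≤ k := by omega
    refine Filter.EventuallyEq.of_eq (Set.ext fun w => ?_)
    simp only [mem_posPart_iff, Set.mem_iUnion, Finset.mem_range]
    constructor
    · intro _
      exact ⟨1, by omega, by simp [hslice]⟩
    · intro _
      simp
  · rw [Filter.eventuallyEq_set]
    filter_upwards [ae_apply_ne m 0, ae_apply_ne m 1, ae_homSeq_ne hm k 0] with w h0 h1 h2
    have h2 := h2 m
    simp only [homSeq, lt_irrefl, dif_neg, not_false_iff] at h2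
    simp only [mem_posPart_iff, Set.mem_iUnion, Finset.mem_range]
    constructor
    · rintro ⟨a, b⟩
      have hs : 0 ≤ ∑ i, w i := Finset.sum_nonneg fun i _ => (a i).1
      -- The layer `b` contains the sums with integer part `b - 1`. It is at most `k` because the
      -- sum differs from `k` almost everywhere.
      refine ⟨⌊∑ i, w i⌋₊ + 1, ?_, fun i => ⟨lt_of_le_of_ne (a i).1 (h0 i).symm,
        lt_of_le_of_ne (a i).2 (h1 i)⟩, ?_, ?_⟩
      · have : ⌊∑ i, w i⌋₊ < k := by
          rw [Nat.floor_lt hs]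
          exact lt_of_le_of_ne b (fun h => h2 (by linarith))
        omega
      · push_cast
        linarith [Nat.floor_le hs]
      · push_cast
        exact Nat.lt_floor_add_one _
    · rintro ⟨b, hb, a, -, c⟩
      refine ⟨fun i => ⟨(a i).1.le, (a i).2.le⟩, c.le.trans ?_⟩
      exact_mod_cast (show b ≤ k by omega)

lemma setLIntegral_posPart {m k : ℕ} (hk : 1 ≤ k) (g : (Fin m → ℝ) → ℝ≥0∞) :
    ∫⁻ x in posPart m k, g x = ∑ b ∈ Finset.range (k + 1), ∫⁻ x in hslice m b, g x := by
  rw [setLIntegral_congr (posPart_ae_eq (Or.inr hk) (Or.inl hk)), lintegral_biUnion_finset]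
  · intro b _ b' _ h
    exact hslice_disjoint h
  · exact fun b _ => measurableSet_hslice m b

lemma volume_posPart {m k : ℕ} (hk : 1 ≤ k) :
    volume (posPart m k) = ENNReal.ofReal ((eulerianSum m k : ℝ) / m.factorial) := by
  rw [← setLIntegral_one, setLIntegral_posPart hk]
  simp only [setLIntegral_one, volume_hslice]
  rw [← ENNReal.ofReal_sum_of_nonneg (fun i _ => by positivity), ← Finset.sum_div,
    ← Nat.cast_sum, ← eulerianSum_eq]

lemma volume_slice {m k : ℕ} (hm : 1 ≤ m) :
    volume (slice m k) = ENNReal.ofReal ((eul m k : ℝ) / m.factorial) := by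
  rw [← measure_congr (openSlice_ae_eq_slice hm k), measure_congr (openSlice_ae_eq_hslice hm k),
    volume_hslice]

lemma measurableSet_posPart (m k : ℕ) : MeasurableSet (posPart m k) := by
  have : posPart m k = (⋂ i, ({w : Fin m → ℝ | 0 ≤ w i} ∩ {w | w i ≤ 1})) ∩
      {w : Fin m → ℝ | ∑ i, |w i| ≤ (k : ℝ)} := by
    ext w; simp [posPart]
  rw [this]
  exact (MeasurableSet.iInter fun i => (measurableSet_le (by fun_prop) (by fun_prop)).inter
    (measurableSet_le (by fun_prop) (by fun_prop))).inter
    (measurableSet_le (by fun_prop) (by fun_prop))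

lemma measurableSet_slice (m k : ℕ) : MeasurableSet (slice m k) := by
  have : slice m k = (⋂ i, ({w : Fin m → ℝ | 0 < w i} ∩ {w | w i < 1})) ∩
      ({w : Fin m → ℝ | (k : ℝ) - 1 < ∑ i, w i} ∩ {w | ∑ i, w i ≤ (k : ℝ)}) := by
    ext w; simp [slice]
  rw [this]
  exact (MeasurableSet.iInter fun i => (measurableSet_lt (by fun_prop) (by fun_prop)).inter
    (measurableSet_lt (by fun_prop) (by fun_prop))).inter
    ((measurableSet_lt (by fun_prop) (by fun_prop)).inter
    (measurableSet_le (by fun_prop) (by fun_prop)))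

lemma measurableSet_sumRegion (m k mode : ℕ) : MeasurableSet (sumRegion m k mode) := by
  unfold sumRegion
  split_ifs
  · exact measurableSet_posPart _ _
  · exact measurableSet_slice _ _

/-! ### Cones over the outer faces -/

/-- The gauge functionals of the outer faces of `posPart (n + 1) k`. -/
def outerFun (n k : ℕ) (q : Fin (n + 2)) (x : Fin (n + 1) → ℝ) : ℝ :=
  if h : (q : ℕ) < n + 1 then x ⟨q, h⟩ else (∑ i, x i) / k

lemma measurable_outerFun (n k : ℕ) (q : Fin (n + 2)) : Measurable (outerFun n k q) := by
  unfold outerFun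
  split_ifs <;> fun_prop

lemma outerFun_smul (n k : ℕ) (q : Fin (n + 2)) (t : ℝ) (x : Fin (n + 1) → ℝ) :
    outerFun n k q (t • x) = t * outerFun n k q x := by
  unfold outerFun
  split_ifs
  · rfl
  · simp [← Finset.mul_sum, mul_div_assoc]

lemma outerFun_castSucc (n k : ℕ) (q : Fin (n + 1)) (x : Fin (n + 1) → ℝ) :
    outerFun n k q.castSucc x = x q := dif_pos q.2

lemma outerFun_last (n k : ℕ) (x : Fin (n + 1) → ℝ) :
    outerFun n k (Fin.last (n + 1)) x = (∑ i, x i) / k := dif_neg (lt_irrefl _)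

/-- The open positive orthant. -/
def openOrthant (n : ℕ) : Set (Fin n → ℝ) := {x | ∀ i, 0 < x i}

lemma measurableSet_openOrthant (n : ℕ) : MeasurableSet (openOrthant n) := by
  have : openOrthant n = ⋂ i, {w : Fin n → ℝ | 0 < w i} := by
    ext w; simp [openOrthant]
  rw [this]
  exact MeasurableSet.iInter fun i => measurableSet_lt (by fun_prop) (by fun_prop)

/-- The condition on a point of an outer face to count for the cone over that face. -/
def IsOuter (n k : ℕ) (i : Fin (n + 2)) (p : Fin (n + 1) → ℝ) : Prop :=
  p ∈ openOrthant (n + 1) ∧ ∀ q, outerFun n k q p ≤ 1 ∧ (q < i → outerFun n k q p < 1)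

lemma measurableSet_isOuter (n k : ℕ) (i : Fin (n + 2)) : MeasurableSet {p | IsOuter n k i p} := by
  have : {p | IsOuter n k i p} = openOrthant (n + 1) ∩ ⋂ q, ({p | outerFun n k q p ≤ 1} ∩
      {p | q < i → outerFun n k q p < 1}) := by
    ext w; simp [IsOuter]
  rw [this]
  refine (measurableSet_openOrthant _).inter (MeasurableSet.iInter fun q =>
    (measurableSet_le (measurable_outerFun _ _ _) measurable_const).inter ?_)
  by_cases h : q < i
  · simp only [h, forall_true_left]
    exact measurableSet_lt (measurable_outerFun _ _ _) measurable_const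
  · simp only [h, false_imp_iff]
    exact MeasurableSet.univ

/-- All gauges are homogeneous, so whether the cone over the face contains `t • p` does not depend
on `t > 0`. -/
lemma smul_mem_outerCone_iff {n k : ℕ} {i : Fin (n + 2)} {p : Fin (n + 1) → ℝ}
    (hp : outerFun n k i p = 1) {t : ℝ} (ht : 0 < t) :
    t • p ∈ openOrthant (n + 1) ∩ firstMax (outerFun n k) i ↔ IsOuter n k i p := by
  refine and_congr (forall_congr' fun q => ?_) (forall_congr' fun q => ?_)
  · simp [ht]
  · rw [outerFun_smul, outerFun_smul, hp]
    rw [mul_le_mul_iff_right₀ ht, mul_lt_mul_iff_right₀ ht]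

lemma setLIntegral_outerCone_lt {n k : ℕ} (i : Fin (n + 1))
    {g : (Fin (n + 1) → ℝ) → ℝ≥0∞} (hg : Measurable g) :
    ∫⁻ x in openOrthant (n + 1) ∩ firstMax (outerFun n k) i.castSucc, g x =
      ∫⁻ t in Set.Ioi (0 : ℝ), ENNReal.ofReal (t ^ n) *
        ∫⁻ w in {w | IsOuter n k i.castSucc (i.insertNth (α := fun _ => ℝ) 1 w)},
          g (t • (i.insertNth (α := fun _ => ℝ) 1 w)) := by
  have hm : Measurable fun w : Fin n → ℝ => i.insertNth (α := fun _ => ℝ) 1 w :=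
    (measurable_insertNth i).comp (measurable_const.prodMk measurable_id)
  rw [setLIntegral_cone i (α := 1) (b := 1) one_ne_zero 0 0 (by simp)
    ((measurableSet_openOrthant _).inter (measurableSet_firstMax (measurable_outerFun n k) _))
    (hm (measurableSet_isOuter n k i.castSucc)) (S := Set.Ioi 0) measurableSet_Ioi
    (fun t ht => ht) ?_ ?_ hg]
  · simp
  · intro t w hx
    have := hx.1 i
    simpa using this
  · intro t ht w
    have h1 : outerFun n k i.castSucc (i.insertNth (α := fun _ => ℝ) 1 w) = 1 := by
      rw [outerFun_castSucc, Fin.insertNth_apply_same]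
    have h2 := smul_mem_outerCone_iff h1 ht
    simpa [ht] using h2

/-- The cut face lies on the hyperplane with coordinate sum `k`. For fixed other coordinates the
last one grows by `k` per unit of `t`, hence the Jacobian. -/
lemma setLIntegral_outerCone_last {n k : ℕ} (hk : 1 ≤ k)
    {g : (Fin (n + 1) → ℝ) → ℝ≥0∞} (hg : Measurable g) :
    ∫⁻ x in openOrthant (n + 1) ∩ firstMax (outerFun n k) (Fin.last (n + 1)), g x =
      k * ∫⁻ t in Set.Ioi (0 : ℝ), ENNReal.ofReal (t ^ n) *
        ∫⁻ w in {w | IsOuter n k (Fin.last (n + 1))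
            ((Fin.last n).insertNth (α := fun _ => ℝ) (k - ∑ r, w r) w)},
          g (t • ((Fin.last n).insertNth (α := fun _ => ℝ) (k - ∑ r, w r) w)) := by
  have hm : Measurable fun w : Fin n → ℝ =>
      (Fin.last n).insertNth (α := fun _ => ℝ) (k - ∑ r, w r) w :=
    (measurable_insertNth _).comp (Measurable.prodMk (by fun_prop) measurable_id)
  have hk' : (k : ℝ) ≠ 0 := by positivity
  set l : (Fin n → ℝ) →ₗ[ℝ] ℝ := -∑ p, LinearMap.proj p with hl
  have hlw : ∀ w, l w = -∑ p, w p := by intro w; simp [hl]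
  rw [setLIntegral_cone (Fin.last n) (α := k) (b := k) hk' l 0 (by
      rw [show (Fin.last n).removeNth (0 : Fin (n + 1) → ℝ) = 0 from rfl]; simp)
    ((measurableSet_openOrthant _).inter (measurableSet_firstMax (measurable_outerFun n k) _))
    (hm (measurableSet_isOuter n k (Fin.last (n + 1)))) (S := Set.Ioi 0) measurableSet_Ioi
    (fun t ht => ht) ?_ ?_ hg]
  · simp only [hlw, zero_add, sub_zero, ← sub_eq_add_neg, Nat.abs_cast,
      ENNReal.ofReal_natCast]
    rfl
  · intro t w hx
    have h1 : ∑ q, ((0 : Fin (n + 1) → ℝ) + (Fin.last n).insertNth (α := fun _ => ℝ)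
        (k * t + l w) w) q = k * t := by
      rw [Fin.sum_univ_succAbove _ (Fin.last n)]
      simp [hlw]
    have h2 : 0 < ∑ q, ((0 : Fin (n + 1) → ℝ) + (Fin.last n).insertNth (α := fun _ => ℝ)
        (k * t + l w) w) q := Finset.sum_pos (fun q _ => hx.1 q) Finset.univ_nonempty
    rw [h1] at h2
    exact pos_of_mul_pos_right h2 (Nat.cast_nonneg k)
  · intro t ht w
    have h1 : outerFun n k (Fin.last (n + 1))
        ((Fin.last n).insertNth (α := fun _ => ℝ) (k - ∑ r, w r) w) = 1 := by
      rw [outerFun_last, Fin.sum_univ_succAbove _ (Fin.last n)]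
      simp [hk']
    have h2 := smul_mem_outerCone_iff h1 ht
    simpa [ht, hlw, ← sub_eq_add_neg] using h2

lemma pad_apply {m : ℕ} (x : Fin m → ℝ) (r : Fin m) : pad x r = x r := by
  simp [pad]

lemma facePoint_lt_eq {n k : ℕ} (i : Fin (n + 1)) (w : Fin n → ℝ) (r : Fin (n + 1)) :
    facePoint k (n + 1) i (pad w) r = i.insertNth (α := fun _ => ℝ) 1 w r := by
  have hc : ¬ IsCut k (n + 1) i := fun h => by have := h.1; omega
  rw [facePoint, if_neg hc]
  rcases Fin.eq_self_or_eq_succAbove i r with rfl | ⟨p, rfl⟩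
  · simp
  · simp only [Fin.insertNth_apply_succAbove]
    by_cases h : p.castSucc < i
    · rw [Fin.succAbove_of_castSucc_lt _ _ h]
      have h' : (p : ℕ) < i := h
      simp [h', pad]
    · rw [Fin.succAbove_of_le_castSucc _ _ (not_lt.1 h)]
      have h' : (i : ℕ) ≤ p := not_lt.1 h
      simp [pad, show ¬ (p : ℕ) + 1 < i by omega, show ¬ (p : ℕ) + 1 = i by omega]

lemma facePoint_cut_eq {n k : ℕ} (hk : k < n + 1) (w : Fin n → ℝ) (r : Fin (n + 1)) :
    facePoint k (n + 1) (n + 1) (pad w) r =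
      (Fin.last n).insertNth (α := fun _ => ℝ) (k - ∑ r, w r) w r := by
  rw [facePoint, if_pos (show IsCut k (n + 1) (n + 1) from ⟨rfl, hk⟩)]
  rcases Fin.eq_self_or_eq_succAbove (Fin.last n) r with rfl | ⟨p, rfl⟩
  · simp only [Fin.val_last, if_true, Fin.insertNth_apply_same, Nat.add_sub_cancel]
    rw [← Fin.sum_univ_eq_sum_range]
    simp only [pad_apply]
  · have : ¬ (p : ℕ) = n := by omega
    simp [pad, this]

/-- When one coordinate is `1`, the condition that the gauge `(∑ x) / k` is at most `1` leaves the
sum `k - 1` to the others. -/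
lemma isOuter_lt_ae_eq {n k : ℕ} (hk : 1 ≤ k) (i : Fin (n + 1)) :
    {w | IsOuter n k i.castSucc (i.insertNth (α := fun _ => ℝ) 1 w)} =ᵐ[volume]
      posPart n (k - 1) := by
  rw [Filter.eventuallyEq_set]
  filter_upwards [ae_apply_ne n 0, ae_apply_ne n 1] with w h0 h1
  have hk' : (0 : ℝ) < k := by exact_mod_cast hk
  have hlast : outerFun n k (Fin.last (n + 1)) (i.insertNth (α := fun _ => ℝ) 1 w) =
      (1 + ∑ r, w r) / k := by
    rw [outerFun_last, Fin.sum_univ_succAbove _ i]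
    simp
  have hother : ∀ q : Fin (n + 1), outerFun n k q.castSucc (i.insertNth (α := fun _ => ℝ) 1 w) =
      i.insertNth (α := fun _ => ℝ) 1 w q := by
    exact fun q => outerFun_castSucc _ _ _ _
  rw [mem_posPart_iff, Nat.cast_sub hk]
  constructor
  · rintro ⟨a, b⟩
    have c := (b (Fin.last (n + 1))).1
    rw [hlast, div_le_one hk'] at c
    refine ⟨fun r => ⟨?_, ?_⟩, by push_cast; linarith⟩
    · simpa using (a (i.succAbove r)).le
    · have := (b (i.succAbove r).castSucc).1
      rwa [hother, Fin.insertNth_apply_succAbove] at this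
  · rintro ⟨a, b⟩
    refine ⟨fun r => ?_, fun q => ?_⟩
    · rcases Fin.eq_self_or_eq_succAbove i r with rfl | ⟨p, rfl⟩
      · simp
      · simpa using lt_of_le_of_ne (a p).1 (h0 p).symm
    · refine Fin.lastCases ?_ (fun r => ?_) q
      · rw [hlast, div_le_one hk']
        push_cast at b
        exact ⟨by linarith, fun h => absurd h (not_lt.2 (Fin.le_last _))⟩
      · rw [hother]
        rcases Fin.eq_self_or_eq_succAbove i r with rfl | ⟨p, rfl⟩
        · simp
        · simp only [Fin.insertNth_apply_succAbove]
          exact ⟨(a p).2, fun _ => lt_of_le_of_ne (a p).2 (h1 p)⟩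

/-- The cut face comes last in the tie-break, so all other gauges have to be strictly below `1`;
this makes the equality exact. -/
lemma isOuter_last_eq {n k : ℕ} (hk : 1 ≤ k) :
    {w | IsOuter n k (Fin.last (n + 1))
      ((Fin.last n).insertNth (α := fun _ => ℝ) (k - ∑ r, w r) w)} = openSlice n k := by
  ext w
  have hk' : (0 : ℝ) < k := by exact_mod_cast hk
  have hlast : outerFun n k (Fin.last (n + 1))
      ((Fin.last n).insertNth (α := fun _ => ℝ) (k - ∑ r, w r) w) = 1 := by
    rw [outerFun_last, Fin.sum_univ_succAbove _ (Fin.last n)]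
    simp [hk'.ne']
  have hother : ∀ q : Fin (n + 1), outerFun n k q.castSucc
      ((Fin.last n).insertNth (α := fun _ => ℝ) (k - ∑ r, w r) w) =
      (Fin.last n).insertNth (α := fun _ => ℝ) (k - ∑ r, w r) w q := by
    exact fun q => outerFun_castSucc _ _ _ _
  have hins : ∀ q : Fin n, (Fin.last n).insertNth (α := fun _ => ℝ) (k - ∑ r, w r) w q.castSucc
      = w q := by
    intro q
    have := Fin.insertNth_apply_succAbove (α := fun _ => ℝ) (Fin.last n) (k - ∑ r, w r) w q
    rwa [Fin.succAbove_last] at this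
  rw [mem_openSlice_iff]
  constructor
  · rintro ⟨a, b⟩
    refine ⟨fun r => ⟨?_, ?_⟩, ?_, ?_⟩
    · have := a r.castSucc
      rwa [hins] at this
    · have := (b r.castSucc.castSucc).2 (Fin.castSucc_lt_last _)
      rwa [hother, hins] at this
    · have := (b (Fin.last n).castSucc).2 (Fin.castSucc_lt_last _)
      rw [hother, Fin.insertNth_apply_same] at this
      linarith
    · have := a (Fin.last n)
      rw [Fin.insertNth_apply_same] at this
      linarith
  · rintro ⟨a, b, c⟩
    refine ⟨fun r => ?_, fun q => ?_⟩
    · refine Fin.lastCases ?_ (fun r => ?_) r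
      · rw [Fin.insertNth_apply_same]; linarith
      · rw [hins]; exact (a r).1
    · refine Fin.lastCases ?_ (fun r => ?_) q
      · rw [hlast]; exact ⟨le_rfl, fun h => absurd h (lt_irrefl _)⟩
      · rw [hother]
        suffices h : (Fin.last n).insertNth (α := fun _ => ℝ) (k - ∑ r, w r) w r < 1 from
          ⟨h.le, fun _ => h⟩
        refine Fin.lastCases ?_ (fun r => ?_) r
        · rw [Fin.insertNth_apply_same]; linarith
        · rw [hins]; exact (a r).2

lemma openSlice_eq_empty {n k : ℕ} (h : n + 1 ≤ k) : openSlice n k = ∅ := by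
  refine Set.eq_empty_iff_forall_notMem.2 fun w hw => ?_
  obtain ⟨a, b, -⟩ := (mem_openSlice_iff w).1 hw
  have h1 : ∑ i, w i ≤ ∑ _i : Fin n, (1 : ℝ) := Finset.sum_le_sum fun i _ => (a i).2.le
  have h2 : (n : ℝ) + 1 ≤ k := by exact_mod_cast h
  simp at h1
  linarith

/-- The Jacobian of the cone over an outer face. -/
def faceJac (k j f : ℕ) : ℕ := if f < j then 1 else if k < j then k else 0

/-- The positive orthant is the union of the cones over the outer faces of `posPart j k`. -/
lemma setLIntegral_openOrthant {n k : ℕ} (hk : 1 ≤ k)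
    {g : (Fin (n + 1) → ℝ) → ℝ≥0∞} (hg : Measurable g) :
    ∫⁻ x in openOrthant (n + 1), g x = ∑ f ∈ Finset.range (n + 2),
      faceJac k (n + 1) f * ∫⁻ t in Set.Ioi (0 : ℝ), ENNReal.ofReal (t ^ n) *
        ∫⁻ w in sumRegion n (firstBound k (n + 1) f) (firstMode k (n + 1) f),
          g (t • fun r : Fin (n + 1) => facePoint k (n + 1) f (pad w) r) := by
  rw [setLIntegral_eq_sum_firstMax (by omega) (measurable_outerFun n k)
    (measurableSet_openOrthant _), Fin.sum_univ_castSucc, Finset.sum_range_succ]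
  congr 1
  · rw [← Fin.sum_univ_eq_sum_range (fun f => (faceJac k (n + 1) f : ℝ≥0∞) *
      ∫⁻ t in Set.Ioi (0 : ℝ), ENNReal.ofReal (t ^ n) *
        ∫⁻ w in sumRegion n (firstBound k (n + 1) f) (firstMode k (n + 1) f),
          g (t • fun r : Fin (n + 1) => facePoint k (n + 1) f (pad w) r)) (n + 1)]
    refine Finset.sum_congr rfl fun i _ => ?_
    have hc : ¬ IsCut k (n + 1) i := fun h => by have := h.1; omega
    rw [setLIntegral_outerCone_lt i hg]
    simp only [faceJac, i.2, if_true, Nat.cast_one, one_mul, firstBound, firstMode, hc, if_false,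
      sumRegion, facePoint_lt_eq, ← setLIntegral_congr (isOuter_lt_ae_eq hk i)]
  · rw [setLIntegral_outerCone_last hk hg, isOuter_last_eq hk]
    -- For `k ≥ n + 1` the bound on the sum cuts off nothing but possibly a vertex, and the slice is
    -- empty; `faceJac` is `0` accordingly.
    rcases Nat.lt_or_ge k (n + 1) with h | h
    · have hc : IsCut k (n + 1) (n + 1) := ⟨rfl, h⟩
      simp only [faceJac, lt_irrefl, if_false, h, if_true, firstBound, firstMode, hc, sumRegion,
        one_ne_zero, facePoint_cut_eq h]
      simp only [setLIntegral_congr (openSlice_ae_eq_slice (show 1 ≤ n by omega) k)]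
    · rw [openSlice_eq_empty h]
      simp [faceJac, show ¬ k < n + 1 by omega]
/-! ### The orthants of the Count ball -/

lemma card_neg {d : ℕ} (J : Fin d → Bool) :
    (Finset.univ.filter fun i => J i = false).card = d - numPos J := by
  have h := Finset.card_filter_add_card_filter_not (s := (Finset.univ : Finset (Fin d)))
    (fun i => J i = true)
  simp only [Bool.not_eq_true, Finset.card_univ, Fintype.card_fin] at h
  unfold numPos
  omega

lemma numPos_le {d : ℕ} (J : Fin d → Bool) : numPos J ≤ d := by
  unfold numPos
  simpa using Finset.card_filter_le (Finset.univ : Finset (Fin d)) (fun i => J i = true)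

lemma rank_lt_card {d : ℕ} (J : Fin d → Bool) (i : Fin d) :
    rank J i < (Finset.univ.filter fun i' => J i' = J i).card := by
  refine Finset.card_lt_card ⟨fun i' h => ?_, fun h => ?_⟩
  · simp only [Finset.mem_filter, Finset.mem_univ, true_and] at h ⊢
    exact h.2
  · have := h (show i ∈ _ by simp)
    simp at this

lemma rank_lt_of_pos {d : ℕ} {J : Fin d → Bool} {i : Fin d} (h : J i = true) :
    rank J i < numPos J := by
  have := rank_lt_card J i
  rwa [h] at this

lemma rank_lt_of_neg {d : ℕ} {J : Fin d → Bool} {i : Fin d} (h : ¬ J i = true) :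
    rank J i < d - numPos J := by
  have := rank_lt_card J i
  rwa [Bool.eq_false_of_not_eq_true h, card_neg] at this

lemma rank_lt_rank {d : ℕ} {J : Fin d → Bool} {i i' : Fin d} (h : J i = J i') (hlt : i < i') :
    rank J i < rank J i' := by
  refine Finset.card_lt_card ⟨fun q hq => ?_, fun hs => ?_⟩
  · simp only [Finset.mem_filter, Finset.mem_univ, true_and] at hq ⊢
    exact ⟨hq.1.trans hlt, hq.2.trans h⟩
  · have := hs (show i ∈ _ by simp [hlt, h])
    simp at this

lemma rank_inj {d : ℕ} {J : Fin d → Bool} {i i' : Fin d} (h : J i = J i')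
    (hr : rank J i = rank J i') : i = i' := by
  rcases lt_trichotomy i i' with hlt | he | hlt
  · exact absurd hr (rank_lt_rank h hlt).ne
  · exact he
  · exact absurd hr (rank_lt_rank h.symm hlt).ne'

/-- The position of `i` among the coordinates of the same sign. -/
def signIdx {d j : ℕ} (J : Fin d → Bool) (hj : numPos J = j) (i : Fin d) : Fin j ⊕ Fin (d - j) :=
  if h : J i = true then Sum.inl ⟨rank J i, hj ▸ rank_lt_of_pos h⟩
  else Sum.inr ⟨rank J i, hj ▸ rank_lt_of_neg h⟩

lemma signIdx_bijective {d j : ℕ} (J : Fin d → Bool) (hj : numPos J = j) :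
    Function.Bijective (signIdx J hj) := by
  rw [Fintype.bijective_iff_injective_and_card]
  constructor
  · intro i i' h
    unfold signIdx at h
    split_ifs at h with h1 h2 h2
    · exact rank_inj (h1.trans h2.symm) (by simpa using h)
    · exact rank_inj (J := J) (by rw [Bool.eq_false_of_not_eq_true h1, Bool.eq_false_of_not_eq_true h2]) (by simpa using h)
  · have := numPos_le J
    simp
    omega

/-- The coordinates split into positive and negative ones. -/
def signEquiv {d j : ℕ} (J : Fin d → Bool) (hj : numPos J = j) : Fin d ≃ Fin j ⊕ Fin (d - j) :=
  Equiv.ofBijective _ (signIdx_bijective J hj)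

/-- The point with the coordinates `x` in the positive and `-y` in the negative positions. -/
def joinSigns {d j : ℕ} (J : Fin d → Bool) (hj : numPos J = j)
    (p : (Fin j → ℝ) × (Fin (d - j) → ℝ)) : Fin d → ℝ :=
  fun i => Sum.elim p.1 (fun r => -p.2 r) (signEquiv J hj i)

lemma signEquiv_symm_inl {d j : ℕ} (J : Fin d → Bool) (hj : numPos J = j)
    (p : Fin j) : J ((signEquiv J hj).symm (Sum.inl p)) = true := by
  have h : signIdx J hj ((signEquiv J hj).symm (Sum.inl p)) = Sum.inl p :=
    (signEquiv J hj).apply_symm_apply _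
  by_contra hc
  simp [signIdx, hc] at h

lemma signEquiv_symm_inr {d j : ℕ} (J : Fin d → Bool) (hj : numPos J = j)
    (p : Fin (d - j)) : J ((signEquiv J hj).symm (Sum.inr p)) = false := by
  have h : signIdx J hj ((signEquiv J hj).symm (Sum.inr p)) = Sum.inr p :=
    (signEquiv J hj).apply_symm_apply _
  by_contra hc
  simp [signIdx, Bool.eq_true_of_not_eq_false hc] at h

lemma joinSigns_inl {d j : ℕ} (J : Fin d → Bool) (hj : numPos J = j)
    (x : (Fin j → ℝ) × (Fin (d - j) → ℝ)) (p : Fin j) :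
    joinSigns J hj x ((signEquiv J hj).symm (Sum.inl p)) = x.1 p := by
  simp [joinSigns]

lemma joinSigns_inr {d j : ℕ} (J : Fin d → Bool) (hj : numPos J = j)
    (x : (Fin j → ℝ) × (Fin (d - j) → ℝ)) (p : Fin (d - j)) :
    joinSigns J hj x ((signEquiv J hj).symm (Sum.inr p)) = -x.2 p := by
  simp [joinSigns]

lemma sum_signEquiv {d j : ℕ} (J : Fin d → Bool) (hj : numPos J = j)
    (F : Fin d → ℝ) : ∑ i, F i =
    ∑ p, F ((signEquiv J hj).symm (Sum.inl p)) + ∑ r, F ((signEquiv J hj).symm (Sum.inr r)) := by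
  rw [← (signEquiv J hj).symm.sum_comp, Fintype.sum_sum_type]

lemma forall_signEquiv {d j : ℕ} (J : Fin d → Bool) (hj : numPos J = j)
    {P : Fin d → Prop} : (∀ i, P i) ↔
    (∀ p, P ((signEquiv J hj).symm (Sum.inl p))) ∧
      ∀ r, P ((signEquiv J hj).symm (Sum.inr r)) := by
  rw [← (signEquiv J hj).symm.forall_congr_right, Sum.forall]

/-- The map negates some coordinates and permutes all of them. -/
lemma measurePreserving_joinSigns {d j : ℕ} (J : Fin d → Bool) (hj : numPos J = j) :
    MeasurePreserving (joinSigns J hj) (volume.prod volume) volume := by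
  have h1 : MeasurePreserving (fun p : (Fin j → ℝ) × (Fin (d - j) → ℝ) => (p.1, -p.2))
      (volume.prod volume) (volume.prod volume) :=
    (MeasurePreserving.id volume).prod (Measure.measurePreserving_neg volume)
  have h2 := (volume_measurePreserving_sumPiEquivProdPi_symm (fun _ : Fin j ⊕ Fin (d - j) => ℝ)).comp h1
  have h3 := (volume_measurePreserving_piCongrLeft (fun _ : Fin d => ℝ) (signEquiv J hj).symm).comp h2
  convert! h3 using 1
  ext p i
  have : i = (signEquiv J hj).symm (signEquiv J hj i) := by simp
  rw [this]
  simp only [Function.comp_apply, MeasurableEquiv.piCongrLeft, MeasurableEquiv.coe_mk,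
    Equiv.piCongrLeft_apply_apply]
  rw [joinSigns, ← this]
  rcases signEquiv J hj i with q | q <;> rfl

/-- The multiple `a • posPart m k`. -/
def scaledPart (m k : ℕ) (a : ℝ) : Set (Fin m → ℝ) :=
  {x | (∀ i, 0 ≤ x i ∧ x i ≤ a) ∧ ∑ i, x i ≤ k * a}

lemma scaledPart_one (m k : ℕ) : scaledPart m k 1 = posPart m k := by
  ext x
  rw [mem_posPart_iff]
  simp [scaledPart]

lemma scaledPart_mono {m k : ℕ} {a b : ℝ} (h : a ≤ b) : scaledPart m k a ⊆ scaledPart m k b := by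
  rintro x ⟨h1, h2⟩
  exact ⟨fun i => ⟨(h1 i).1, (h1 i).2.trans h⟩,
    h2.trans (mul_le_mul_of_nonneg_left h (Nat.cast_nonneg k))⟩

lemma smul_mem_scaledPart_iff {m k : ℕ} {a : ℝ} (ha : 0 < a) (x : Fin m → ℝ) :
    a • x ∈ scaledPart m k a ↔ x ∈ posPart m k := by
  rw [mem_posPart_iff]
  refine and_congr (forall_congr' fun i => ?_) ?_
  · simp only [Pi.smul_apply, smul_eq_mul]
    rw [mul_le_iff_le_one_right ha, mul_nonneg_iff_of_pos_left ha]
  · simp only [Pi.smul_apply, smul_eq_mul, ← Finset.mul_sum]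
    rw [mul_comm (k : ℝ), mul_le_mul_iff_right₀ ha]

/-! ### Membership in the Count ball, and its compactness -/

lemma convex_posPart (d k : ℕ) : Convex ℝ (posPart d k) := by
  intro x hx y hy a b ha hb hab
  rw [mem_posPart_iff] at *
  refine ⟨fun i => ⟨?_, ?_⟩, ?_⟩
  · have := (hx.1 i).1
    have := (hy.1 i).1
    simp only [Pi.add_apply, Pi.smul_apply, smul_eq_mul]
    positivity
  · have h1 := mul_le_mul_of_nonneg_left (hx.1 i).2 ha
    have h2 := mul_le_mul_of_nonneg_left (hy.1 i).2 hb
    simp only [Pi.add_apply, Pi.smul_apply, smul_eq_mul]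
    linarith
  · have h1 := mul_le_mul_of_nonneg_left hx.2 ha
    have h2 := mul_le_mul_of_nonneg_left hy.2 hb
    simp only [Pi.add_apply, Pi.smul_apply, smul_eq_mul, Finset.sum_add_distrib, ← Finset.mul_sum]
    calc _ ≤ a * k + b * k := add_le_add h1 h2
      _ = k := by rw [← add_mul, hab, one_mul]

lemma zero_mem_posPart (d k : ℕ) : (0 : Fin d → ℝ) ∈ posPart d k := by
  simp [posPart]

/-- Both halves are convex and nonempty, so the hull of their union consists of segments with one
endpoint in each. -/
lemma mem_countBall_iff {d k : ℕ} (x : Fin d → ℝ) : x ∈ countBall d k ↔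
    ∃ v ∈ posPart d k, ∃ v' ∈ posPart d k, ∃ a : ℝ, 0 ≤ a ∧ a ≤ 1 ∧ x = a • v - (1 - a) • v' := by
  rw [countBall, convexHull_union ⟨0, zero_mem_posPart d k⟩ ⟨0, by simpa using zero_mem_posPart d k⟩,
    (convex_posPart d k).convexHull_eq, (convex_posPart d k).neg.convexHull_eq, mem_convexJoin]
  constructor
  · rintro ⟨v, hv, w, hw, a, b, ha, hb, hab, rfl⟩
    refine ⟨v, hv, -w, hw, a, ha, by linarith, ?_⟩
    rw [show 1 - a = b by linarith]
    simp
  · rintro ⟨v, hv, v', hv', a, ha, ha1, rfl⟩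
    exact ⟨v, hv, -v', by simpa using hv', a, 1 - a, ha, by linarith, by ring, by
      simp [sub_eq_add_neg]⟩

lemma isCompact_posPart (d k : ℕ) : IsCompact (posPart d k) := by
  refine Metric.isCompact_of_isClosed_isBounded ?_ ?_
  · have : posPart d k = (⋂ i, ({w : Fin d → ℝ | 0 ≤ w i} ∩ {w | w i ≤ 1})) ∩
        {w : Fin d → ℝ | ∑ i, |w i| ≤ (k : ℝ)} := by
      ext w; simp [posPart]
    rw [this]
    exact (isClosed_iInter fun i => (isClosed_le (by fun_prop) (by fun_prop)).inter
      (isClosed_le (by fun_prop) (by fun_prop))).inter (isClosed_le (by fun_prop) (by fun_prop))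
  · exact (Metric.isBounded_Icc (0 : Fin d → ℝ) 1).subset fun x hx =>
      ⟨fun i => (hx.1 i).1, fun i => (hx.1 i).2⟩

/-- A continuous image of a compact product; this is the source of measurability. -/
lemma isCompact_countBall (d k : ℕ) : IsCompact (countBall d k) := by
  have : countBall d k = (fun p : (Fin d → ℝ) × (Fin d → ℝ) × ℝ =>
      p.2.2 • p.1 - (1 - p.2.2) • p.2.1) '' (posPart d k ×ˢ (posPart d k ×ˢ Set.Icc 0 1)) := by
    ext x
    rw [mem_countBall_iff]
    constructor
    · rintro ⟨v, hv, v', hv', a, ha, ha1, rfl⟩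
      exact ⟨(v, v', a), ⟨hv, hv', ha, ha1⟩, rfl⟩
    · rintro ⟨⟨v, v', a⟩, ⟨hv, hv', ha, ha1⟩, rfl⟩
      exact ⟨v, hv, v', hv', a, ha, ha1, rfl⟩
  rw [this]
  exact ((isCompact_posPart d k).prod ((isCompact_posPart d k).prod isCompact_Icc)).image
    (by fun_prop)

lemma measurableSet_countBall (d k : ℕ) : MeasurableSet (countBall d k) :=
  (isCompact_countBall d k).measurableSet

lemma measurableSet_orthant {d : ℕ} (J : Fin d → Bool) : MeasurableSet (orthant J) := by
  have : orthant J = ⋂ i, {x : Fin d → ℝ | if J i then 0 ≤ x i else x i ≤ 0} := by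
    ext x
    simp only [Set.mem_iInter]
    rfl
  rw [this]
  refine MeasurableSet.iInter fun i => ?_
  split_ifs
  · exact measurableSet_le (by fun_prop) (by fun_prop)
  · exact measurableSet_le (by fun_prop) (by fun_prop)

/-- In `a • v - (1 - a) • v'` the second term can only lower a positive coordinate and the first can
only shrink the size of a negative one. So the two parts are dominated by `a • v` and `(1 - a) •
v'`, and lowering coordinates that stay nonnegative preserves the bounds. Conversely, `v` and `v'`
may be taken to vanish outside the positions of their sign. -/
lemma joinSigns_mem_iff {d j k : ℕ} (J : Fin d → Bool) (hj : numPos J = j)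
    (x : (Fin j → ℝ) × (Fin (d - j) → ℝ)) :
    joinSigns J hj x ∈ countBall d k ∩ orthant J ↔
      ∃ a : ℝ, 0 ≤ a ∧ a ≤ 1 ∧ x.1 ∈ scaledPart j k a ∧ x.2 ∈ scaledPart (d - j) k (1 - a) := by
  rw [Set.mem_inter_iff, mem_countBall_iff]
  constructor
  · rintro ⟨⟨v, hv, v', hv', a, ha, ha1, hx⟩, ho⟩
    rw [mem_posPart_iff] at hv hv'
    have hsum : ∀ w : Fin d → ℝ, (∀ i, 0 ≤ w i ∧ w i ≤ 1) →
        ∑ p, w ((signEquiv J hj).symm (Sum.inl p)) ≤ ∑ i, w i ∧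
        ∑ p, w ((signEquiv J hj).symm (Sum.inr p)) ≤ ∑ i, w i := by
      intro w hw
      rw [sum_signEquiv J hj w]
      have h1 : 0 ≤ ∑ p, w ((signEquiv J hj).symm (Sum.inl p)) :=
        Finset.sum_nonneg fun p _ => (hw _).1
      have h2 : 0 ≤ ∑ p, w ((signEquiv J hj).symm (Sum.inr p)) :=
        Finset.sum_nonneg fun p _ => (hw _).1
      constructor <;> linarith
    have hb : 0 ≤ 1 - a := by linarith
    have e1 : ∀ p, x.1 p ≤ a * v ((signEquiv J hj).symm (Sum.inl p)) := by
      intro p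
      rw [← joinSigns_inl J hj x p, hx]
      have := mul_nonneg hb (hv'.1 ((signEquiv J hj).symm (Sum.inl p))).1
      simp only [Pi.sub_apply, Pi.smul_apply, smul_eq_mul]
      linarith
    have e2 : ∀ p, x.2 p ≤ (1 - a) * v' ((signEquiv J hj).symm (Sum.inr p)) := by
      intro p
      rw [← neg_neg (x.2 p), ← joinSigns_inr J hj x p, hx]
      have := mul_nonneg ha (hv.1 ((signEquiv J hj).symm (Sum.inr p))).1
      simp only [Pi.sub_apply, Pi.smul_apply, smul_eq_mul]
      linarith
    refine ⟨a, ha, ha1, ⟨fun p => ⟨?_, ?_⟩, ?_⟩, ⟨fun p => ⟨?_, ?_⟩, ?_⟩⟩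
    · have := ho ((signEquiv J hj).symm (Sum.inl p))
      rwa [if_pos (signEquiv_symm_inl J hj p), joinSigns_inl] at this
    · exact (e1 p).trans (mul_le_of_le_one_right ha (hv.1 _).2)
    · calc ∑ p, x.1 p ≤ ∑ p, a * v ((signEquiv J hj).symm (Sum.inl p)) :=
            Finset.sum_le_sum fun p _ => e1 p
        _ ≤ k * a := by
            rw [← Finset.mul_sum, mul_comm]
            exact mul_le_mul_of_nonneg_right ((hsum v hv.1).1.trans hv.2) ha
    · have := ho ((signEquiv J hj).symm (Sum.inr p))
      rw [signEquiv_symm_inr J hj p, if_neg (by simp), joinSigns_inr] at this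
      linarith
    · exact (e2 p).trans (mul_le_of_le_one_right hb (hv'.1 _).2)
    · calc ∑ p, x.2 p ≤ ∑ p, (1 - a) * v' ((signEquiv J hj).symm (Sum.inr p)) :=
            Finset.sum_le_sum fun p _ => e2 p
        _ ≤ k * (1 - a) := by
            rw [← Finset.mul_sum, mul_comm]
            exact mul_le_mul_of_nonneg_right ((hsum v' hv'.1).2.trans hv'.2) hb
  · rintro ⟨a, ha, ha1, h1, h2⟩
    have hb : 0 ≤ 1 - a := by linarith
    -- For `a = 0` the quotient `x / 0 = 0` is the right value, because then `x = 0`; the same holds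
    -- for `1 - a`.
    refine ⟨⟨fun i => Sum.elim (fun p => x.1 p / a) (fun _ => 0) (signEquiv J hj i), ?_,
      fun i => Sum.elim (fun _ => 0) (fun p => x.2 p / (1 - a)) (signEquiv J hj i), ?_,
      a, ha, ha1, ?_⟩, ?_⟩
    · rw [mem_posPart_iff]
      refine ⟨(forall_signEquiv J hj).2 ⟨fun p => ?_, fun p => ?_⟩, ?_⟩
      · simp only [Equiv.apply_symm_apply, Sum.elim_inl]
        exact ⟨div_nonneg (h1.1 p).1 ha, div_le_one_of_le₀ (h1.1 p).2 ha⟩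
      · simp
      · rw [sum_signEquiv J hj]
        simp only [Equiv.apply_symm_apply, Sum.elim_inl, Sum.elim_inr, Finset.sum_const_zero,
          add_zero, ← Finset.sum_div]
        exact div_le_of_le_mul₀ ha (Nat.cast_nonneg k) h1.2
    · rw [mem_posPart_iff]
      refine ⟨(forall_signEquiv J hj).2 ⟨fun p => ?_, fun p => ?_⟩, ?_⟩
      · simp
      · simp only [Equiv.apply_symm_apply, Sum.elim_inr]
        exact ⟨div_nonneg (h2.1 p).1 hb, div_le_one_of_le₀ (h2.1 p).2 hb⟩
      · rw [sum_signEquiv J hj]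
        simp only [Equiv.apply_symm_apply, Sum.elim_inl, Sum.elim_inr, Finset.sum_const_zero,
          zero_add, ← Finset.sum_div]
        exact div_le_of_le_mul₀ hb (Nat.cast_nonneg k) h2.2
    · have hdiv : ∀ {y b : ℝ}, 0 ≤ y → y ≤ b → b * (y / b) = y := by
        intro y b hy hyb
        rcases eq_or_ne b 0 with rfl | hb0
        · simp; linarith
        · field_simp
      refine funext ((forall_signEquiv J hj).2 ⟨fun p => ?_, fun p => ?_⟩)
      · rw [joinSigns_inl]
        simp [hdiv (h1.1 p).1 (h1.1 p).2]
      · rw [joinSigns_inr]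
        simp [hdiv (h2.1 p).1 (h2.1 p).2]
    · refine (forall_signEquiv J hj).2 ⟨fun p => ?_, fun p => ?_⟩
      · rw [if_pos (signEquiv_symm_inl J hj p), joinSigns_inl]
        exact (h1.1 p).1
      · rw [signEquiv_symm_inr J hj p, if_neg (by simp), joinSigns_inr]
        linarith [(h2.1 p).1]

lemma assemble_eq {d j : ℕ} (J : Fin d → Bool) (hj : numPos J = j) (k f : ℕ) (t : ℝ) (u : ℕ → ℝ)
    (v : Fin (d - j) → ℝ) : assemble k (J, t, f, u, pad v) =
      joinSigns J hj (t • (fun r : Fin j => facePoint k j f u r), (1 - t) • v) := by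
  subst hj
  ext i
  simp only [assemble, joinSigns]
  change _ = Sum.elim _ _ (signIdx J rfl i)
  unfold signIdx
  by_cases h : J i = true
  · simp [h]
  · simp [h, pad, rank_lt_of_neg h]
    ring
-- Radial coordinates on the orthant parts of the Count ball
lemma indicator_congr_of_iff {α β γ : Type*} [Zero γ] {s : Set α} {t : Set β} {f : α → γ} {g : β → γ}
    {x : α} {y : β} (h : x ∈ s ↔ y ∈ t) (hfg : f x = g y) : s.indicator f x = t.indicator g y := by
  by_cases hx : x ∈ s
  · rw [Set.indicator_of_mem hx, Set.indicator_of_mem (h.1 hx), hfg]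
  · rw [Set.indicator_of_notMem hx, Set.indicator_of_notMem (fun hy => hx (h.2 hy))]

/-- The disjunction says that the gauge of the face point is exactly `1`. This is what
`smul_mem_scaledPart_iff_le` needs in order to read off the gauge `t` of `t • p`. -/
lemma facePoint_mem {n k f : ℕ} (hk : 1 ≤ k) (hf : f < n + 1 ∨ f = n + 1 ∧ k < n + 1)
    {w : Fin n → ℝ} (hw : w ∈ sumRegion n (firstBound k (n + 1) f) (firstMode k (n + 1) f)) :
    (fun r : Fin (n + 1) => facePoint k (n + 1) f (pad w) r) ∈ posPart (n + 1) k ∧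
      ((∃ r : Fin (n + 1), facePoint k (n + 1) f (pad w) r = 1) ∨
        ∑ r : Fin (n + 1), facePoint k (n + 1) f (pad w) r = k) := by
  rw [mem_posPart_iff]
  rcases hf with hf | ⟨rfl, hf⟩
  · have hc : ¬ IsCut k (n + 1) f := fun h => by have := h.1; omega
    simp only [sumRegion, firstBound, firstMode, hc, if_false, if_true, mem_posPart_iff,
      Nat.cast_sub hk] at hw
    obtain ⟨h1, h2⟩ := hw
    have e : ∀ r : Fin (n + 1), facePoint k (n + 1) f (pad w) r =
        (⟨f, hf⟩ : Fin (n + 1)).insertNth (α := fun _ => ℝ) 1 w r := facePoint_lt_eq ⟨f, hf⟩ w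
    simp only [e]
    refine ⟨⟨fun r => ?_, ?_⟩, Or.inl ⟨⟨f, hf⟩, by simp⟩⟩
    · rcases Fin.eq_self_or_eq_succAbove ⟨f, hf⟩ r with rfl | ⟨p, rfl⟩
      · simp
      · simpa using h1 p
    · rw [Fin.sum_univ_succAbove _ ⟨f, hf⟩]
      simp only [Fin.insertNth_apply_same, Fin.insertNth_apply_succAbove]
      push_cast at h2
      linarith
  · have hc : IsCut k (n + 1) (n + 1) := ⟨rfl, hf⟩
    simp only [sumRegion, firstBound, firstMode, hc, if_true, one_ne_zero, if_false] at hw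
    obtain ⟨h1, h2, h3⟩ := hw
    simp only [facePoint_cut_eq hf]
    have hs : ∑ r : Fin (n + 1), (Fin.last n).insertNth (α := fun _ => ℝ) (k - ∑ r, w r) w r = k := by
      rw [Fin.sum_univ_succAbove _ (Fin.last n)]
      simp only [Fin.insertNth_apply_same, Fin.insertNth_apply_succAbove]
      ring
    refine ⟨⟨fun r => ?_, hs.le⟩, Or.inr hs⟩
    rcases Fin.eq_self_or_eq_succAbove (Fin.last n) r with rfl | ⟨p, rfl⟩
    · rw [Fin.insertNth_apply_same]
      constructor <;> linarith
    · rw [Fin.insertNth_apply_succAbove]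
      exact ⟨(h1 p).1.le, (h1 p).2.le⟩

lemma smul_mem_scaledPart_iff_le {m k : ℕ} (hk : 1 ≤ k) {p : Fin m → ℝ} (hp : p ∈ posPart m k)
    (hp' : (∃ r, p r = 1) ∨ ∑ r, p r = k) {t : ℝ} (ht : 0 < t) (a : ℝ) :
    t • p ∈ scaledPart m k a ↔ t ≤ a := by
  constructor
  · rintro ⟨h1, h2⟩
    rcases hp' with ⟨r, hr⟩ | hs
    · have := (h1 r).2
      simpa [hr] using this
    · simp only [Pi.smul_apply, smul_eq_mul, ← Finset.mul_sum, hs] at h2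
      have hk' : (0 : ℝ) < k := by exact_mod_cast hk
      rw [mul_comm] at h2
      exact le_of_mul_le_mul_left h2 hk'
  · intro h
    exact scaledPart_mono h ((smul_mem_scaledPart_iff ht p).2 hp)

lemma measurableSet_scaledPart (m k : ℕ) (a : ℝ) : MeasurableSet (scaledPart m k a) := by
  have : scaledPart m k a = (⋂ i, ({w : Fin m → ℝ | 0 ≤ w i} ∩ {w | w i ≤ a})) ∩
      {w : Fin m → ℝ | ∑ i, w i ≤ k * a} := by
    ext w; simp [scaledPart]
  rw [this]
  exact (MeasurableSet.iInter fun i => (measurableSet_le (by fun_prop) (by fun_prop)).inter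
    (measurableSet_le (by fun_prop) (by fun_prop))).inter
    (measurableSet_le (by fun_prop) (by fun_prop))

lemma setLIntegral_scaledPart {m k : ℕ} {a : ℝ} (ha : 0 < a) {g : (Fin m → ℝ) → ℝ≥0∞}
    (hg : Measurable g) : ∫⁻ y in scaledPart m k a, g y =
      ENNReal.ofReal (a ^ m) * ∫⁻ v in posPart m k, g (a • v) := by
  rw [← lintegral_indicator (measurableSet_scaledPart m k a),
    lintegral_scale ha (hg.indicator (measurableSet_scaledPart m k a)),
    ← lintegral_indicator (measurableSet_posPart m k)]
  congr 1
  refine lintegral_congr fun v => ?_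
  exact indicator_congr_of_iff (smul_mem_scaledPart_iff ha v) rfl

lemma setLIntegral_orthant_eq {d j k : ℕ} (J : Fin d → Bool) (hj : numPos J = j)
    {g : (Fin d → ℝ) → ℝ≥0∞} (hg : Measurable g) :
    ∫⁻ x in countBall d k ∩ orthant J, g x =
      ∫⁻ x, ∫⁻ y, (countBall d k ∩ orthant J).indicator g (joinSigns J hj (x, y)) := by
  have hB := (measurableSet_countBall d k).inter (measurableSet_orthant J)
  have hm := measurePreserving_joinSigns J hj
  rw [← lintegral_indicator hB, ← hm.lintegral_comp (hg.indicator hB), lintegral_prod]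
  exact ((hg.indicator hB).comp hm.measurable).aemeasurable

lemma measurable_joinSigns_indicator {d j k : ℕ} (J : Fin d → Bool) (hj : numPos J = j)
    {g : (Fin d → ℝ) → ℝ≥0∞} (hg : Measurable g) :
    Measurable fun p : (Fin j → ℝ) × (Fin (d - j) → ℝ) =>
      (countBall d k ∩ orthant J).indicator g (joinSigns J hj p) :=
  (hg.indicator ((measurableSet_countBall d k).inter (measurableSet_orthant J))).comp
    (measurePreserving_joinSigns J hj).measurable

/-- The part of the Count ball in an orthant, in terms of the random choices of the sampler. -/
lemma setLIntegral_orthant_succ {d n k : ℕ} (hk : 1 ≤ k) (J : Fin d → Bool)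
    (hj : numPos J = n + 1) {g : (Fin d → ℝ) → ℝ≥0∞} (hg : Measurable g) :
    ∫⁻ x in countBall d k ∩ orthant J, g x = ∑ f ∈ Finset.range (n + 2),
      faceJac k (n + 1) f * ∫⁻ t in Set.Ioo (0 : ℝ) 1, ENNReal.ofReal (t ^ n) *
        ∫⁻ w in sumRegion n (firstBound k (n + 1) f) (firstMode k (n + 1) f),
          ENNReal.ofReal ((1 - t) ^ (d - (n + 1))) * ∫⁻ v in posPart (d - (n + 1)) k,
            g (assemble k (J, t, f, pad w, pad v)) := by
  rw [setLIntegral_orthant_eq J hj hg]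
  set G : (Fin (n + 1) → ℝ) → ℝ≥0∞ := fun x =>
    ∫⁻ y, (countBall d k ∩ orthant J).indicator g (joinSigns J hj (x, y)) with hG
  have hGm : Measurable G := (measurable_joinSigns_indicator J hj hg).lintegral_prod_right
  -- A positive part with a negative coordinate gives no point of the orthant, and one with a zero
  -- coordinate is negligible.
  have h0 : ∫⁻ x, G x = ∫⁻ x in openOrthant (n + 1), G x := by
    rw [← lintegral_indicator (measurableSet_openOrthant _)]
    refine lintegral_congr_ae ?_
    filter_upwards [ae_apply_ne (n + 1) 0] with x hx
    by_cases h : x ∈ openOrthant (n + 1)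
    · rw [Set.indicator_of_mem h]
    · rw [Set.indicator_of_notMem h]
      have : ∀ y, (countBall d k ∩ orthant J).indicator g (joinSigns J hj (x, y)) = 0 := by
        intro y
        refine Set.indicator_of_notMem (fun hm => h fun i => ?_) _
        obtain ⟨a, -, -, h1, -⟩ := (joinSigns_mem_iff J hj _).1 hm
        exact lt_of_le_of_ne (h1.1 i).1 (hx i).symm
      simp [hG, this]
  rw [h0, setLIntegral_openOrthant hk hGm]
  refine Finset.sum_congr rfl fun f hf => ?_
  have hf := Finset.mem_range.1 hf
  by_cases hff : f < n + 1 ∨ f = n + 1 ∧ k < n + 1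
  swap
  · have : faceJac k (n + 1) f = 0 := by
      unfold faceJac
      rw [if_neg (by tauto), if_neg]
      intro h
      exact hff (Or.inr ⟨by omega, h⟩)
    simp [this]
  congr 1
  rw [← lintegral_indicator measurableSet_Ioi, ← lintegral_indicator measurableSet_Ioo]
  refine lintegral_congr_ae ?_
  -- At `t = 1` the fibre degenerates to a multiple by `0`; this single value is discarded.
  have hne : ∀ᵐ t : ℝ, t ≠ 1 := by
    rw [ae_iff]
    simp
  filter_upwards [hne] with t ht1
  by_cases ht : 0 < t
  swap
  · rw [Set.indicator_of_notMem (by simpa using ht), Set.indicator_of_notMem (fun h => ht h.1)]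
  rw [Set.indicator_of_mem (show t ∈ Set.Ioi 0 from ht)]
  -- Admissible are the `a` with `t ≤ a ≤ 1`. The choice `a = t` leaves most room for `y`, so the
  -- fibre over `t • p` is the whole multiple by `1 - t`.
  have hmem : ∀ w ∈ sumRegion n (firstBound k (n + 1) f) (firstMode k (n + 1) f), ∀ y,
      joinSigns J hj (t • (fun r : Fin (n + 1) => facePoint k (n + 1) f (pad w) r), y) ∈
        countBall d k ∩ orthant J ↔ t < 1 ∧ y ∈ scaledPart (d - (n + 1)) k (1 - t) := by
    intro w hw y
    obtain ⟨p1, p2⟩ := facePoint_mem hk hff hw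
    rw [joinSigns_mem_iff]
    simp only [smul_mem_scaledPart_iff_le hk p1 p2 ht]
    constructor
    · rintro ⟨a, -, ha1, hta, hy⟩
      exact ⟨lt_of_le_of_ne (hta.trans ha1) ht1, scaledPart_mono (by linarith) hy⟩
    · rintro ⟨h1, hy⟩
      exact ⟨t, ht.le, h1.le, le_rfl, hy⟩
  by_cases ht' : t < 1
  · rw [Set.indicator_of_mem (show t ∈ Set.Ioo 0 1 from ⟨ht, ht'⟩)]
    congr 1
    refine setLIntegral_congr_fun (measurableSet_sumRegion _ _ _) fun w hw => ?_
    have hgw : Measurable fun y => g (joinSigns J hj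
        (t • (fun r : Fin (n + 1) => facePoint k (n + 1) f (pad w) r), y)) :=
      hg.comp ((measurePreserving_joinSigns J hj).measurable.comp
        (measurable_const.prodMk measurable_id))
    simp only [assemble_eq J hj]
    rw [← setLIntegral_scaledPart (by linarith) hgw,
      ← lintegral_indicator (measurableSet_scaledPart _ _ _)]
    refine lintegral_congr fun y => ?_
    exact indicator_congr_of_iff (by rw [hmem w hw]; simp [ht']) rfl
  · rw [Set.indicator_of_notMem (fun h => ht' h.2)]
    have : ∫⁻ w in sumRegion n (firstBound k (n + 1) f) (firstMode k (n + 1) f),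
        G (t • fun r : Fin (n + 1) => facePoint k (n + 1) f (pad w) r) =
        ∫⁻ w in sumRegion n (firstBound k (n + 1) f) (firstMode k (n + 1) f), 0 := by
      refine setLIntegral_congr_fun (measurableSet_sumRegion _ _ _) fun w hw => ?_
      simp [hG, Set.indicator, hmem w hw, ht']
    rw [this]
    simp

/-- With no positive coordinate `a = 0` is the best choice, and the piece is the reflected
nonnegative part of the Sum ball. No face point is ever read, so `f` and `u` are arbitrary. -/
lemma setLIntegral_orthant_zero {d k : ℕ} (J : Fin d → Bool)
    (hj : numPos J = 0) {g : (Fin d → ℝ) → ℝ≥0∞} (hg : Measurable g) (f : ℕ) (u : ℕ → ℝ) :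
    ∫⁻ x in countBall d k ∩ orthant J, g x =
      ∫⁻ v in posPart (d - 0) k, g (assemble k (J, 0, f, u, pad v)) := by
  rw [setLIntegral_orthant_eq J hj hg]
  simp only [assemble_eq J hj]
  have h0 : ∀ x : Fin 0 → ℝ,
      ∫⁻ y, (countBall d k ∩ orthant J).indicator g (joinSigns J hj (x, y)) =
      ∫⁻ v in posPart (d - 0) k, g (joinSigns J hj
        ((0 : ℝ) • (fun r : Fin 0 => facePoint k 0 f u r), (1 - (0 : ℝ)) • v)) := by
    intro x
    rw [← lintegral_indicator (measurableSet_posPart _ _)]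
    refine lintegral_congr fun y => ?_
    have hx : (0 : ℝ) • (fun r : Fin 0 => facePoint k 0 f u r) = x := Subsingleton.elim _ _
    have hiff : joinSigns J hj (x, y) ∈ countBall d k ∩ orthant J ↔ y ∈ posPart (d - 0) k := by
      rw [joinSigns_mem_iff]
      constructor
      · rintro ⟨a, ha, -, -, h⟩
        rw [← scaledPart_one]
        exact scaledPart_mono (by linarith) h
      · intro h
        refine ⟨0, le_rfl, zero_le_one, ⟨fun i => i.elim0, by simp⟩, ?_⟩
        rw [sub_zero, scaledPart_one]
        exact h
    rw [hx, sub_zero]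
    exact indicator_congr_of_iff hiff (by rw [one_smul])
  simp only [h0]
  rw [lintegral_const, volume_univ_fin_zero, mul_one]

/-! ### Volumes -/

lemma beta_natCast (n m : ℕ) :
    beta ((n : ℝ) + 1) ((m : ℝ) + 1) = (n.factorial * m.factorial : ℝ) / (n + m + 1).factorial := by
  rw [beta, Real.Gamma_nat_eq_factorial, Real.Gamma_nat_eq_factorial,
    show (n : ℝ) + 1 + ((m : ℝ) + 1) = ((n + m + 1 : ℕ) : ℝ) + 1 by push_cast; ring,
    Real.Gamma_nat_eq_factorial]

lemma betaPDF_natCast {n m : ℕ} {t : ℝ} (ht : t ∈ Set.Ioo (0 : ℝ) 1) :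
    betaPDF ((n : ℝ) + 1) ((m : ℝ) + 1) t = ENNReal.ofReal (1 / beta ((n : ℝ) + 1) ((m : ℝ) + 1)) *
      (ENNReal.ofReal (t ^ n) * ENNReal.ofReal ((1 - t) ^ m)) := by
  have h1 : 0 ≤ t := ht.1.le
  have h2 : 0 ≤ 1 - t := by linarith [ht.2]
  have h3 := (beta_pos (show (0 : ℝ) < n + 1 by positivity) (show (0 : ℝ) < m + 1 by positivity)).le
  rw [betaPDF_of_pos_lt_one ht.1 ht.2, ← ENNReal.ofReal_mul (by positivity),
    ← ENNReal.ofReal_mul (by positivity)]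
  simp only [add_sub_cancel_right, Real.rpow_natCast]
  rw [mul_assoc]

lemma lintegral_betaMeasure (n m : ℕ) (g : ℝ → ℝ≥0∞) :
    ∫⁻ t, g t ∂(betaMeasure ((n : ℝ) + 1) ((m : ℝ) + 1)) =
      ENNReal.ofReal (1 / beta ((n : ℝ) + 1) ((m : ℝ) + 1)) *
      ∫⁻ t in Set.Ioo (0 : ℝ) 1, ENNReal.ofReal (t ^ n) * (ENNReal.ofReal ((1 - t) ^ m) * g t) := by
  have hm : Measurable (betaPDF ((n : ℝ) + 1) ((m : ℝ) + 1)) :=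
    (measurable_betaPDFReal _ _).ennreal_ofReal
  rw [betaMeasure, lintegral_withDensity_eq_lintegral_mul_non_measurable _ hm
    (Filter.Eventually.of_forall fun _ => ENNReal.ofReal_lt_top),
    ← lintegral_const_mul' _ _ ENNReal.ofReal_ne_top, ← lintegral_indicator measurableSet_Ioo]
  refine lintegral_congr fun t => ?_
  by_cases ht : t ∈ Set.Ioo (0 : ℝ) 1
  · rw [Set.indicator_of_mem ht, Pi.mul_apply, betaPDF_natCast ht]
    ring
  · rw [Set.indicator_of_notMem ht, Pi.mul_apply]
    rcases le_or_gt t 0 with h | h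
    · rw [betaPDF_eq_zero_of_nonpos h, zero_mul]
    · rw [betaPDF_eq_zero_of_one_le (not_lt.1 fun h' => ht ⟨h, h'⟩), zero_mul]

/-- The value is read off from the total mass one of the Beta measure. -/
lemma setLIntegral_beta (n m : ℕ) :
    ∫⁻ t in Set.Ioo (0 : ℝ) 1, ENNReal.ofReal (t ^ n) * ENNReal.ofReal ((1 - t) ^ m) =
      ENNReal.ofReal (beta ((n : ℝ) + 1) ((m : ℝ) + 1)) := by
  have hb := beta_pos (show (0 : ℝ) < n + 1 by positivity) (show (0 : ℝ) < m + 1 by positivity)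
  have := isProbabilityMeasureBeta (show (0 : ℝ) < n + 1 by positivity)
    (show (0 : ℝ) < m + 1 by positivity)
  have h := lintegral_betaMeasure n m (fun _ => 1)
  simp only [lintegral_one, measure_univ, mul_one] at h
  have h2 : ENNReal.ofReal (beta ((n : ℝ) + 1) ((m : ℝ) + 1)) *
      ENNReal.ofReal (1 / beta ((n : ℝ) + 1) ((m : ℝ) + 1)) = 1 := by
    rw [← ENNReal.ofReal_mul hb.le, mul_one_div_cancel hb.ne', ENNReal.ofReal_one]
  rw [← one_mul (∫⁻ t in Set.Ioo (0 : ℝ) 1, _), ← h2, mul_assoc, ← h, mul_one]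

/-- The bound `1 - 1` is the one that a face `x_f = 1` leaves to the other coordinates when `k = 1`.
-/
lemma posPart_ae_eq_empty {m : ℕ} (hm : 1 ≤ m) : posPart m (1 - 1) =ᵐ[volume] (∅ : Set (Fin m → ℝ)) := by
  rw [Filter.eventuallyEq_set]
  filter_upwards [ae_homSeq_ne hm 0 0] with w h
  have h := h m
  simp only [homSeq, lt_irrefl, dif_neg, not_false_iff] at h
  simp only [mem_posPart_iff, Set.mem_empty_iff_false, iff_false]
  rintro ⟨h1, h2⟩
  have h3 : 0 ≤ ∑ i, w i := Finset.sum_nonneg fun i _ => (h1 i).1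
  simp at h2
  exact h (by linarith)

/-- The face weights are chosen so that each is, up to `n!`, the Jacobian times the volume of the
parameter set of its face. -/
lemma faceJac_mul_volume {n k f : ℕ} (hk : 1 ≤ k) (hf : f ≤ n + 1) :
    faceJac k (n + 1) f * volume (sumRegion n (firstBound k (n + 1) f) (firstMode k (n + 1) f)) =
      ENNReal.ofReal ((faceWeight k (n + 1) f : ℝ) / n.factorial) := by
  by_cases hc : IsCut k (n + 1) f
  · have hn : 1 ≤ n := by have := hc.2; omega
    obtain ⟨rfl, h⟩ := hc
    have hc : IsCut k (n + 1) (n + 1) := ⟨rfl, h⟩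
    simp only [faceJac, lt_irrefl, if_false, h, if_true, firstBound, firstMode, hc, sumRegion,
      one_ne_zero, faceWeight, show ¬ n + 1 ≤ 1 by omega, Nat.add_sub_cancel]
    rw [volume_slice hn, ← ENNReal.ofReal_natCast, ← ENNReal.ofReal_mul (by positivity), eul,
      if_neg (by omega)]
    push_cast
    rw [mul_div_assoc]
  · simp only [firstBound, firstMode, hc, if_false, sumRegion, if_true, faceWeight,
      Nat.add_sub_cancel]
    -- A face of dimension `0` is a point of mass one even for `k = 1`, although `eulerianSum 0 0 =
    -- 0`; this is why `faceWeight` treats `j ≤ 1` apart.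
    rcases Nat.eq_zero_or_pos n with rfl | hn
    · have hv : volume (posPart 0 (k - 1)) = 1 := by
        rw [← volume_univ_fin_zero]
        congr 1
        ext x
        simp [posPart]
      rw [hv]
      obtain rfl | rfl : f = 0 ∨ f = 1 := by omega
      · simp [faceJac]
      · simp [faceJac]
    · rw [if_neg (by omega)]
      by_cases hlt : f < n + 1
      · simp only [faceJac, hlt, if_true, Nat.cast_one, one_mul]
        rcases Nat.eq_or_lt_of_le hk with rfl | hk
        · rw [measure_congr (posPart_ae_eq_empty hn)]
          simp [eulerianSum]
        · exact volume_posPart (by omega)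
      · have hkn : ¬ k < n + 1 := fun h => hc ⟨by omega, h⟩
        simp [faceJac, hlt, hkn]

/-- This is `eulerianSum_succ`. When the bound reaches the dimension there is no cut face, and its
term there vanishes as well. -/
lemma sum_faceWeight {n k : ℕ} (hk : 1 ≤ k) :
    ∑ f ∈ Finset.range (n + 2), faceWeight k (n + 1) f = eulerianSum (n + 1) k := by
  rcases Nat.eq_zero_or_pos n with rfl | hn
  · rw [eulerianSum_of_ge (m := 1) le_rfl le_rfl hk]
    simp [Finset.sum_range_succ, faceWeight, eulerianSum_eq, eul_one]
  · obtain ⟨k, rfl⟩ : ∃ k', k = k' + 1 := ⟨k - 1, by omega⟩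
    rw [eulerianSum_succ, Finset.sum_range_succ]
    congr 1
    · rw [Finset.sum_congr rfl (g := fun _ => eulerianSum n k) (fun f hf => by
        have := Finset.mem_range.1 hf
        rw [faceWeight, if_neg (by omega), if_pos this]; simp)]
      simp
    · rw [faceWeight, if_neg (by omega), if_neg (lt_irrefl _)]
      split_ifs with h
      · simp [eul]
      · have : ¬ k + 1 < n + 1 := fun h' => h ⟨rfl, h'⟩
        rw [eul_eq_zero (by omega) hn, mul_zero]

/-- For `j = n + 1` and `d - j = m` the integral of `1` splits into the Beta integral `n! * m! /
d!`, the volume `eulerianSum m k / m!`, and the total face weight `eulerianSum (n + 1) k / n!`. For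
`j = 0` the piece is a reflected Sum part, and `eulerianSum 0 k = 1`. -/
theorem volume_countBall_inter_orthant {d k : ℕ} (hk : 1 ≤ k) (J : Fin d → Bool) :
    volume (countBall d k ∩ orthant J) =
      ENNReal.ofReal ((orthantWeight d k (numPos J) : ℝ) / d.factorial) := by
  rw [← setLIntegral_one]
  rcases Nat.eq_zero_or_pos (numPos J) with hj | hj
  · rw [setLIntegral_orthant_zero J hj measurable_const 0 0, setLIntegral_one, volume_posPart hk,
      hj, orthantWeight, eulerianSum_of_ge (n := 0) (m := 1) zero_le_one le_rfl hk]
    simp [eulerianSum_eq, Finset.sum_range_succ, eul_one]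
  · obtain ⟨n, hn⟩ : ∃ n, numPos J = n + 1 := ⟨numPos J - 1, by omega⟩
    have hd := numPos_le J
    obtain ⟨m, rfl⟩ : ∃ m, d = n + 1 + m := ⟨d - (n + 1), by omega⟩
    rw [setLIntegral_orthant_succ hk J hn measurable_const, hn]
    simp only [lintegral_const, Measure.restrict_apply MeasurableSet.univ,
      Set.univ_inter, Nat.add_sub_cancel_left, volume_posPart hk, one_mul]
    have h1 : ∀ f, ∫⁻ t in Set.Ioo (0 : ℝ) 1, ENNReal.ofReal (t ^ n) *
        (ENNReal.ofReal ((1 - t) ^ m) *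
          ENNReal.ofReal ((eulerianSum m k : ℝ) / m.factorial) *
          volume (sumRegion n (firstBound k (n + 1) f) (firstMode k (n + 1) f))) =
        ENNReal.ofReal (beta ((n : ℝ) + 1) ((m : ℝ) + 1)) *
          (ENNReal.ofReal ((eulerianSum m k : ℝ) / m.factorial) *
          volume (sumRegion n (firstBound k (n + 1) f) (firstMode k (n + 1) f))) := by
      intro f
      rw [← setLIntegral_beta, ← lintegral_mul_const _ (by fun_prop)]
      simp only [mul_assoc]
    simp only [h1]
    have h2 : ∀ f ∈ Finset.range (n + 2), (faceJac k (n + 1) f : ℝ≥0∞) *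
        (ENNReal.ofReal (beta ((n : ℝ) + 1) ((m : ℝ) + 1)) *
          (ENNReal.ofReal ((eulerianSum m k : ℝ) / m.factorial) *
          volume (sumRegion n (firstBound k (n + 1) f) (firstMode k (n + 1) f)))) =
        ENNReal.ofReal (beta ((n : ℝ) + 1) ((m : ℝ) + 1) * ((eulerianSum m k : ℝ) / m.factorial) *
          ((faceWeight k (n + 1) f : ℝ) / n.factorial)) := by
      intro f hf
      have hb := (beta_pos (show (0 : ℝ) < n + 1 by positivity)
        (show (0 : ℝ) < m + 1 by positivity)).le
      rw [ENNReal.ofReal_mul (by positivity), ENNReal.ofReal_mul hb,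
        ← faceJac_mul_volume hk (by have := Finset.mem_range.1 hf; omega)]
      ring
    rw [Finset.sum_congr rfl h2, ← ENNReal.ofReal_sum_of_nonneg, ← Finset.mul_sum,
      ← Finset.sum_div, ← Nat.cast_sum, sum_faceWeight hk, beta_natCast, orthantWeight,
      Nat.add_sub_cancel_left, show n + m + 1 = n + 1 + m by omega]
    · congr 1
      push_cast
      field_simp
    · intro f _
      have hb := (beta_pos (show (0 : ℝ) < n + 1 by positivity)
        (show (0 : ℝ) < m + 1 by positivity)).le
      positivity
/-! ### The law of the output -/

lemma orthant_mem_unique {d : ℕ} {J J' : Fin d → Bool} {x : Fin d → ℝ} (hx : ∀ i, x i ≠ 0)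
    (h : x ∈ orthant J) (h' : x ∈ orthant J') : J = J' := by
  ext i
  have h1 := h i
  have h2 := h' i
  have h3 := hx i
  cases hJ : J i <;> cases hJ' : J' i <;> simp only [hJ, hJ', if_true] at h1 h2 ⊢ <;>
    first
    | rfl
    | exact absurd (le_antisymm (by simpa using h1) (by simpa using h2)) h3
    | exact absurd (le_antisymm (by simpa using h2) (by simpa using h1)) h3

lemma exists_mem_orthant {d : ℕ} (x : Fin d → ℝ) : ∃ J, x ∈ orthant J := by
  refine ⟨fun i => decide (0 ≤ x i), fun i => ?_⟩
  by_cases h : 0 ≤ x i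
  · simp [h]
  · simp [h, (not_le.1 h).le]

/-- Distinct closed orthants meet only where some coordinate is zero. -/
lemma setLIntegral_countBall {d k : ℕ} {g : (Fin d → ℝ) → ℝ≥0∞} (hg : Measurable g) :
    ∫⁻ x in countBall d k, g x = ∑ J : Fin d → Bool, ∫⁻ x in countBall d k ∩ orthant J, g x := by
  have hm := fun J : Fin d → Bool => (measurableSet_countBall d k).inter (measurableSet_orthant J)
  simp only [← lintegral_indicator (hm _)]
  rw [← lintegral_indicator (measurableSet_countBall d k),
    ← lintegral_finsetSum _ (fun J _ => hg.indicator (hm J))]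
  refine lintegral_congr_ae ?_
  filter_upwards [ae_apply_ne d 0] with x hx
  obtain ⟨J, hJ⟩ := exists_mem_orthant x
  rw [Finset.sum_eq_single J]
  · exact indicator_congr_of_iff ⟨fun h => ⟨h, hJ⟩, fun h => h.1⟩ rfl
  · intro J' _ hne
    exact Set.indicator_of_notMem (fun h => hne (orthant_mem_unique hx h.2 hJ)) _
  · simp

lemma measurable_facePoint (k j f r : ℕ) : Measurable fun u : ℕ → ℝ => facePoint k j f u r := by
  unfold facePoint
  split_ifs <;> fun_prop

/-- The discrete components `J` and `f` are separated off; for each of their countably many values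
the map is measurable in the other arguments. -/
lemma measurable_assemble (d k : ℕ) : Measurable (assemble (d := d) k) := by
  let G : ((Fin d → Bool) × ℕ) × (ℝ × (ℕ → ℝ) × (ℕ → ℝ)) → Fin d → ℝ :=
    fun p => assemble k (p.1.1, p.2.1, p.1.2, p.2.2.1, p.2.2.2)
  have hG : Measurable G := by
    refine measurable_from_prod_countable_right fun a => ?_
    refine measurable_pi_iff.2 fun i => ?_
    simp only [G, assemble]
    split_ifs
    · exact measurable_fst.mul ((measurable_facePoint _ _ _ _).comp (by fun_prop))
    · fun_prop
  exact hG.comp (f := fun p : (Fin d → Bool) × ℝ × ℕ × (ℕ → ℝ) × (ℕ → ℝ) =>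
    ((p.1, p.2.2.1), (p.2.1, p.2.2.2.1, p.2.2.2.2))) (by fun_prop)

lemma measurable_pad (m : ℕ) : Measurable (pad (m := m)) := by
  refine measurable_pi_iff.2 fun r => ?_
  unfold pad
  split_ifs <;> fun_prop

instance (d j : ℕ) : SFinite (crossSectionLaw d j) := by
  unfold crossSectionLaw betaMeasure
  split_ifs <;> infer_instance

lemma lintegral_choice {ι : Type*} [MeasurableSpace ι] (J : ι) (ν : Measure ℝ) [SFinite ν] (f : ℕ)
    {m m' : ℕ} (A : Measure (Fin m → ℝ)) (B : Measure (Fin m' → ℝ)) [SFinite A] [SFinite B]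
    {g : ι × ℝ × ℕ × (ℕ → ℝ) × (ℕ → ℝ) → ℝ≥0∞} (hg : Measurable g) :
    ∫⁻ x, g x ∂((Measure.dirac J).prod (ν.prod ((Measure.dirac f).prod
      ((A.map pad).prod (B.map pad))))) = ∫⁻ t, ∫⁻ w, ∫⁻ v, g (J, t, f, pad w, pad v) ∂B ∂A ∂ν := by
  rw [lintegral_prod _ hg.aemeasurable, lintegral_dirac' _ hg.lintegral_prod_right',
    lintegral_prod _ (by exact (hg.comp (by fun_prop)).aemeasurable)]
  refine lintegral_congr fun t => ?_
  have h1 : Measurable fun z : ℕ × (ℕ → ℝ) × (ℕ → ℝ) => g (J, t, z) := hg.comp (by fun_prop)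
  rw [lintegral_prod _ h1.aemeasurable, lintegral_dirac' _ h1.lintegral_prod_right']
  have h2 : Measurable fun z : (ℕ → ℝ) × (ℕ → ℝ) => g (J, t, f, z) := hg.comp (by fun_prop)
  rw [lintegral_prod _ h2.aemeasurable, lintegral_map h2.lintegral_prod_right' (measurable_pad m)]
  refine lintegral_congr fun w => ?_
  rw [lintegral_map (f := fun y => g (J, t, f, pad w, y)) (hg.comp (by fun_prop)) (measurable_pad m')]

lemma lintegral_cond {Ω : Type*} [MeasurableSpace Ω] (μ : Measure Ω) (s : Set Ω) (g : Ω → ℝ≥0∞) :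
    ∫⁻ x, g x ∂(cond μ s) = (μ s)⁻¹ * ∫⁻ x in s, g x ∂μ := by
  rw [ProbabilityTheory.cond, lintegral_smul_measure, smul_eq_mul]

lemma volume_sumRegion_ne_top (m κ mode : ℕ) : volume (sumRegion m κ mode) ≠ ⊤ := by
  refine ne_top_of_le_ne_top ?_ (measure_mono (show sumRegion m κ mode ⊆ Set.Icc 0 1 from ?_))
  · exact isCompact_Icc.measure_lt_top.ne
  · unfold sumRegion
    split_ifs
    · exact fun x hx => ⟨fun i => (hx.1 i).1, fun i => (hx.1 i).2⟩
    · exact fun x hx => ⟨fun i => (hx.1 i).1.le, fun i => (hx.1 i).2.le⟩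

/-- A face drawn by its weight and then a uniform parameter amount to integration with the Jacobian,
since the volume cancels. A null parameter set has an infinite normalising factor, and `hI` disposes
of it. -/
lemma faceProb_mul {n k f : ℕ} (hk : 1 ≤ k) (hf : f ≤ n + 1) {I : ℝ≥0∞}
    (hI : volume (sumRegion n (firstBound k (n + 1) f) (firstMode k (n + 1) f)) = 0 → I = 0) :
    faceProb k (n + 1) f *
      ((volume (sumRegion n (firstBound k (n + 1) f) (firstMode k (n + 1) f)))⁻¹ * I) =
      (n.factorial : ℝ≥0∞) / eulerianSum (n + 1) k * (faceJac k (n + 1) f * I) := by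
  set V := volume (sumRegion n (firstBound k (n + 1) f) (firstMode k (n + 1) f)) with hV
  by_cases h0 : V = 0
  · rw [hI h0]; simp
  have htop : V ≠ ⊤ := volume_sumRegion_ne_top _ _ _
  have h1 := faceJac_mul_volume hk hf
  rw [← hV, ENNReal.ofReal_div_of_pos (by positivity), ENNReal.ofReal_natCast,
    ENNReal.ofReal_natCast] at h1
  have h2 : (faceWeight k (n + 1) f : ℝ≥0∞) = faceJac k (n + 1) f * V * n.factorial := by
    rw [h1, ENNReal.div_mul_cancel (by positivity) (ENNReal.natCast_ne_top _)]
  rw [faceProb, sum_faceWeight hk, h2, div_eq_mul_inv, div_eq_mul_inv]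
  calc _ = (faceJac k (n + 1) f * n.factorial * (eulerianSum (n + 1) k : ℝ≥0∞)⁻¹ * I) *
        (V * V⁻¹) := by ring
    _ = _ := by rw [ENNReal.mul_inv_cancel h0 htop]; ring

/-- Given the orthant, the output is uniform on the part of the Count ball in this orthant. -/
lemma sum_face_lintegral {d k : ℕ} (hk : 1 ≤ k) (J : Fin d → Bool) {g : (Fin d → ℝ) → ℝ≥0∞}
    (hg : Measurable g) :
    ∑ f ∈ Finset.range (numPos J + 1), faceProb k (numPos J) f *
      ∫⁻ t, ∫⁻ w, ∫⁻ v, g (assemble k (J, t, f, pad w, pad v))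
        ∂(cond volume (sumRegion (d - numPos J) k 0))
        ∂(cond volume (sumRegion (numPos J - 1) (firstBound k (numPos J) f)
            (firstMode k (numPos J) f)))
        ∂(crossSectionLaw d (numPos J)) =
      (d.factorial : ℝ≥0∞) / orthantWeight d k (numPos J) *
        ∫⁻ x in countBall d k ∩ orthant J, g x := by
  have hsum0 : ∀ m, (eulerianSum m k : ℝ≥0∞) ≠ 0 := fun m => by
    exact_mod_cast (eulerianSum_pos m hk).ne'
  rcases Nat.eq_zero_or_pos (numPos J) with hj | hj
  · have hc : ¬ IsCut k 0 0 := by simp [IsCut]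
    have hv0 : volume (posPart 0 (k - 1)) = 1 := by
      rw [← volume_univ_fin_zero]
      congr 1
      ext x
      simp [posPart]
    have hw : ∀ w : Fin 0 → ℝ, pad w = (0 : ℕ → ℝ) := by
      intro w; funext r; simp [pad]
    rw [hj]
    simp only [zero_add, Finset.range_one, Finset.sum_singleton, crossSectionLaw, if_true,
      firstBound, firstMode, hc, if_false, sumRegion, hw, lintegral_cond]
    rw [lintegral_dirac' _ (by
      refine Measurable.const_mul (Measurable.lintegral_prod_right' (f := fun p : ℝ × (Fin 0 → ℝ) =>
        (volume (posPart (d - 0) k))⁻¹ * ∫⁻ v in posPart (d - 0) k,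
          g (assemble k (J, p.1, 0, (0 : ℕ → ℝ), pad v))) ?_) _
      refine Measurable.const_mul (Measurable.lintegral_prod_right'
        (f := fun p : (ℝ × (Fin 0 → ℝ)) × (Fin (d - 0) → ℝ) =>
          g (assemble k (J, p.1.1, 0, (0 : ℕ → ℝ), pad p.2))) ?_) _
      have := measurable_pad (d - 0)
      exact hg.comp ((measurable_assemble d k).comp (by fun_prop)))]
    rw [← setLIntegral_orthant_zero J hj hg 0 0]
    simp only [lintegral_const, Measure.restrict_apply MeasurableSet.univ, Set.univ_inter, hv0,
      inv_one, one_mul, mul_one, volume_posPart hk]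
    have h1 : faceProb k 0 0 = 1 := by simp [faceProb, faceWeight]
    rw [h1, one_mul, orthantWeight, ENNReal.ofReal_div_of_pos (by positivity),
      ENNReal.ofReal_natCast, ENNReal.ofReal_natCast, Nat.sub_zero,
      eulerianSum_of_ge (n := 0) (m := 1) zero_le_one le_rfl hk,
      ENNReal.inv_div (Or.inl (ENNReal.natCast_ne_top _)) (Or.inl (by positivity))]
    simp [eulerianSum_eq 0, Finset.sum_range_succ, eul_one]
  · obtain ⟨n, hn⟩ : ∃ n, numPos J = n + 1 := ⟨numPos J - 1, by omega⟩
    have hd := numPos_le J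
    obtain ⟨m, hm⟩ : ∃ m, d = n + 1 + m := ⟨d - (n + 1), by omega⟩
    have hdm : d - (n + 1) = m := by omega
    have hb := (beta_pos (show (0 : ℝ) < n + 1 by positivity) (show (0 : ℝ) < m + 1 by positivity))
    rw [setLIntegral_orthant_succ hk J hn hg, Finset.mul_sum, hn]
    refine Finset.sum_congr rfl fun f hf => ?_
    have hlaw : crossSectionLaw d (n + 1) = betaMeasure ((n : ℝ) + 1) ((m : ℝ) + 1) := by
      rw [crossSectionLaw, if_neg (by omega), hm]
      push_cast
      congr 1
      ring
    rw [hlaw, lintegral_betaMeasure, Nat.add_sub_cancel]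
    set Q := sumRegion n (firstBound k (n + 1) f) (firstMode k (n + 1) f) with hQ
    have hT : sumRegion (d - (n + 1)) k 0 = posPart (d - (n + 1)) k := by simp [sumRegion]
    simp only [lintegral_cond, hT, volume_posPart hk]
    set c := (ENNReal.ofReal ((eulerianSum (d - (n + 1)) k : ℝ) / (d - (n + 1)).factorial))⁻¹ with hc
    have hctop : c ≠ ⊤ := by
      rw [hc, ENNReal.inv_ne_top, ne_eq, ENNReal.ofReal_eq_zero, not_le]
      have := eulerianSum_pos (d - (n + 1)) hk
      positivity
    set I := ∫⁻ t in Set.Ioo (0 : ℝ) 1, ENNReal.ofReal (t ^ n) *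
        ∫⁻ w in Q, ENNReal.ofReal ((1 - t) ^ (d - (n + 1))) * ∫⁻ v in posPart (d - (n + 1)) k,
            g (assemble k (J, t, f, pad w, pad v)) with hI
    have e1 : ∫⁻ t in Set.Ioo (0 : ℝ) 1, ENNReal.ofReal (t ^ n) * (ENNReal.ofReal ((1 - t) ^ m) *
        ((volume Q)⁻¹ * ∫⁻ w in Q, c * ∫⁻ v in posPart (d - (n + 1)) k,
            g (assemble k (J, t, f, pad w, pad v)))) = c * ((volume Q)⁻¹ * I) := by
      -- For a null set the factor `(volume Q)⁻¹` is infinite and cannot be moved through the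
      -- integral; but then both sides are zero.
      by_cases h0 : volume Q = 0
      · have hr : volume.restrict Q = 0 := Measure.restrict_eq_zero.2 h0
        simp [hI, hr]
      · have hQt : (volume Q)⁻¹ ≠ ⊤ := by simpa using h0
        rw [hI, ← mul_assoc, ← lintegral_const_mul' _ _ (ENNReal.mul_ne_top hctop hQt)]
        refine lintegral_congr fun t => ?_
        rw [lintegral_const_mul' _ _ hctop, lintegral_const_mul' _ _ ENNReal.ofReal_ne_top, hdm]
        ring
    rw [e1]
    have hI0 : volume Q = 0 → I = 0 := by
      intro h0
      have hr : volume.restrict Q = 0 := Measure.restrict_eq_zero.2 h0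
      simp [hI, hr]
    calc _ = ENNReal.ofReal (1 / beta ((n : ℝ) + 1) ((m : ℝ) + 1)) * c *
          (faceProb k (n + 1) f * ((volume Q)⁻¹ * I)) := by ring
      _ = ENNReal.ofReal (1 / beta ((n : ℝ) + 1) ((m : ℝ) + 1)) * c *
          ((n.factorial : ℝ≥0∞) / eulerianSum (n + 1) k) * (faceJac k (n + 1) f * I) := by
          rw [faceProb_mul hk (by have := Finset.mem_range.1 hf; omega) hI0]; ring
      _ = _ := by
          -- The constants multiply to `(n+m+1)! / (n! m!)` times `m! / eulerianSum m k` times `n! /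
          -- eulerianSum (n+1) k`, and `n + m + 1 = d`.
          congr 1
          have e2 := eulerianSum_pos m hk
          have e3 := eulerianSum_pos (n + 1) hk
          rw [hc, hdm, ← ENNReal.ofReal_inv_of_pos (by positivity), ← ENNReal.ofReal_natCast,
            ← ENNReal.ofReal_natCast (eulerianSum (n + 1) k),
            ← ENNReal.ofReal_div_of_pos (by positivity), ← ENNReal.ofReal_mul (by positivity),
            ← ENNReal.ofReal_mul (by positivity), ← ENNReal.ofReal_natCast,
            ← ENNReal.ofReal_natCast (orthantWeight d k (n + 1)),
            ← ENNReal.ofReal_div_of_pos (by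
              rw [orthantWeight, hdm]; push_cast; positivity), beta_natCast, orthantWeight, hdm]
          congr 1
          rw [hm, show n + m + 1 = n + 1 + m by omega]
          push_cast
          field_simp

lemma volume_countBall {d k : ℕ} (hk : 1 ≤ k) :
    volume (countBall d k) = ((∑ J : Fin d → Bool, orthantWeight d k (numPos J) : ℕ) : ℝ≥0∞) /
      d.factorial := by
  rw [← setLIntegral_one, setLIntegral_countBall measurable_const]
  simp only [setLIntegral_one, volume_countBall_inter_orthant hk]
  rw [Nat.cast_sum, div_eq_mul_inv, Finset.sum_mul]
  refine Finset.sum_congr rfl fun J _ => ?_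
  rw [ENNReal.ofReal_div_of_pos (by positivity), ENNReal.ofReal_natCast, ENNReal.ofReal_natCast,
    div_eq_mul_inv]

lemma orthantWeight_pos (d : ℕ) {k : ℕ} (hk : 1 ≤ k) (j : ℕ) : 0 < orthantWeight d k j :=
  Nat.mul_pos (eulerianSum_pos _ hk) (eulerianSum_pos _ hk)

/-- The assembled point is uniform on the Count ball. -/
theorem map_assemble_choiceLaw {d k : ℕ} (hk : 1 ≤ k) :
    (choiceLaw d k).map (assemble k) = cond volume (countBall d k) := by
  refine Measure.ext_of_lintegral _ fun g hg => ?_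
  have hga : Measurable fun x => g (assemble (d := d) k x) := hg.comp (measurable_assemble d k)
  rw [lintegral_map hg (measurable_assemble d k), choiceLaw, lintegral_finsetSum_measure,
    lintegral_cond, setLIntegral_countBall hg, Finset.mul_sum, volume_countBall hk]
  refine Finset.sum_congr rfl fun J _ => ?_
  have hw0 : (orthantWeight d k (numPos J) : ℝ≥0∞) ≠ 0 := by
    exact_mod_cast (orthantWeight_pos d hk _).ne'
  rw [lintegral_finsetSum_measure]
  simp only [lintegral_smul_measure, lintegral_choice _ _ _ _ _ hga, smul_eq_mul, mul_assoc]
  rw [← Finset.mul_sum, sum_face_lintegral hk J hg, orthantProb, ← mul_assoc,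
    ENNReal.inv_div (Or.inl (ENNReal.natCast_ne_top _)) (Or.inl (by positivity))]
  congr 1
  rw [div_eq_mul_inv, div_eq_mul_inv, div_eq_mul_inv]
  calc _ = (d.factorial : ℝ≥0∞) * ((∑ J' : Fin d → Bool, orthantWeight d k (numPos J') : ℕ) : ℝ≥0∞)⁻¹ *
        ((orthantWeight d k (numPos J) : ℝ≥0∞) * (orthantWeight d k (numPos J) : ℝ≥0∞)⁻¹) := by ring
    _ = _ := by rw [ENNReal.mul_inv_cancel hw0 (ENNReal.natCast_ne_top _), mul_one]
/-! ### The tape -/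

instance : IsProbabilityMeasure tapeLaw := by unfold tapeLaw; infer_instance

/-- The first `n` random reals from `a`, the later ones from `b`. -/
def splice (n : ℕ) (a b : Tape) : Tape := fun i => if i < n then a i else b (i - n)

/-- The random reals from the `n`-th on. -/
def shift (n : ℕ) (ω : Tape) : Tape := fun i => ω (n + i)

lemma measurable_shift (n : ℕ) : Measurable (shift n) := by
  unfold shift; fun_prop

lemma measurable_splice (n : ℕ) : Measurable fun p : Tape × Tape => splice n p.1 p.2 := by
  refine measurable_pi_iff.2 fun i => ?_
  unfold splice
  split_ifs <;> fun_prop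

lemma shift_splice (n : ℕ) (a b : Tape) : shift n (splice n a b) = b := by
  funext i
  simp [shift, splice]

/-- Checked on cylinder sets: the conditions at positions below `n` concern the first tape only, the
other ones the second tape only. -/
lemma measurePreserving_splice (n : ℕ) :
    MeasurePreserving (fun p : Tape × Tape => splice n p.1 p.2) (tapeLaw.prod tapeLaw) tapeLaw := by
  refine ⟨measurable_splice n, Measure.eq_infinitePi _ fun s t ht => ?_⟩
  rw [Measure.map_apply (measurable_splice n) (MeasurableSet.pi s.countable_toSet fun i _ => ht i)]
  set s1 := s.filter (· < n)
  set s2 := (s.filter fun i => ¬ i < n).image (· - n)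
  have hpre : (fun p : Tape × Tape => splice n p.1 p.2) ⁻¹' (Set.pi (s : Set ℕ) t) =
      (Set.pi (s1 : Set ℕ) t) ×ˢ (Set.pi (s2 : Set ℕ) fun i => t (n + i)) := by
    ext p
    simp only [Set.mem_preimage, Set.mem_prod, Set.mem_pi, Finset.mem_coe, s1, s2,
      Finset.mem_filter, Finset.mem_image, splice]
    constructor
    · intro h
      refine ⟨fun i hi => by simpa [hi.2] using h i hi.1, ?_⟩
      rintro i ⟨q, ⟨hq, hqn⟩, rfl⟩
      have := h q hq
      rw [if_neg hqn] at this
      rwa [show n + (q - n) = q by omega]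
    · rintro ⟨h1, h2⟩ i hi
      split_ifs with hin
      · exact h1 i ⟨hi, hin⟩
      · have := h2 (i - n) ⟨i, ⟨hi, hin⟩, rfl⟩
        rwa [show n + (i - n) = i by omega] at this
  rw [hpre, Measure.prod_prod]
  unfold tapeLaw
  rw [Measure.infinitePi_pi _ fun i _ => ht i, Measure.infinitePi_pi _ fun i _ => ht (n + i),
    ← Finset.prod_filter_mul_prod_filter_not s (· < n), Finset.prod_image]
  · congr 1
    refine Finset.prod_congr rfl fun i hi => ?_
    have := (Finset.mem_filter.1 hi).2
    rw [show n + (i - n) = i by omega]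
  · intro i hi i' hi' h
    have h1 := (Finset.mem_filter.1 (Finset.mem_coe.1 hi)).2
    have h2 := (Finset.mem_filter.1 (Finset.mem_coe.1 hi')).2
    have h : i - n = i' - n := h
    omega

lemma lintegral_splice (n : ℕ) {F : Tape → ℝ≥0∞} (hF : Measurable F) :
    ∫⁻ ω, F ω ∂tapeLaw = ∫⁻ a, ∫⁻ b, F (splice n a b) ∂tapeLaw ∂tapeLaw := by
  rw [← (measurePreserving_splice n).lintegral_comp hF, lintegral_prod]
  exact (hF.comp (measurable_splice n)).aemeasurable

/-- `f` uses only the first `n` random reals. -/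
def DependsOnFirst {α : Type*} (n : ℕ) (f : Tape → α) : Prop :=
  ∀ a b : Tape, (∀ i < n, a i = b i) → f a = f b

lemma DependsOnFirst.splice {α : Type*} {n : ℕ} {f : Tape → α} (hf : DependsOnFirst n f)
    (a b : Tape) : f (splice n a b) = f a :=
  hf _ _ fun i hi => by simp [CountBall.splice, hi]

/-- Later random reals are independent of the earlier ones. -/
lemma map_pair_shift {α β : Type*} [MeasurableSpace α] [MeasurableSpace β] {n : ℕ} {f : Tape → α}
    (hf : DependsOnFirst n f) (hfm : Measurable f) {g : Tape → β} (hg : Measurable g) :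
    tapeLaw.map (fun ω => (f ω, g (shift n ω))) = (tapeLaw.map f).prod (tapeLaw.map g) := by
  rw [Measure.map_prod_map tapeLaw tapeLaw hfm hg]
  conv_lhs => rw [← (measurePreserving_splice n).map_eq]
  rw [Measure.map_map (g := fun ω => (f ω, g (shift n ω)))
    (hfm.prodMk (hg.comp (measurable_shift n))) (measurable_splice n)]
  congr 1
  funext p
  simp [hf.splice, shift_splice, Prod.map]

lemma measurable_apply_countable {Ω ι β : Type*} [MeasurableSpace Ω] [MeasurableSpace ι]
    [Countable ι] [MeasurableSingletonClass ι] [MeasurableSpace β] {f : Ω → ι} (hf : Measurable f)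
    {h : ι → Ω → β} (hh : ∀ i, Measurable (h i)) : Measurable fun ω => h (f ω) ω :=
  (measurable_from_prod_countable_right (f := fun p : ι × Ω => h p.1 p.2) hh).comp
    (hf.prodMk measurable_id)

/-- The law of a random choice that depends on an earlier discrete choice. -/
lemma lintegral_apply_shift {ι : Type*} [MeasurableSpace ι] [Countable ι]
    [MeasurableSingletonClass ι] {n : ℕ} {f : Tape → ι} (hf : DependsOnFirst n f)
    (hfm : Measurable f) {s : Finset ι} (hs : ∀ ω, f ω ∈ s) {h : ι → Tape → ℝ≥0∞}
    (hh : ∀ i, Measurable (h i)) :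
    ∫⁻ ω, h (f ω) (shift n ω) ∂tapeLaw =
      ∑ i ∈ s, tapeLaw {ω | f ω = i} * ∫⁻ ω, h i ω ∂tapeLaw := by
  classical
  have hF : Measurable fun ω => h (f ω) (shift n ω) :=
    measurable_apply_countable (h := fun i ω => h i (shift n ω)) hfm
      (fun i => (hh i).comp (measurable_shift n))
  rw [lintegral_splice n hF]
  simp only [hf.splice, shift_splice]
  have : ∀ a, ∫⁻ b, h (f a) b ∂tapeLaw =
      ∑ i ∈ s, {ω | f ω = i}.indicator (fun _ => (∫⁻ ω, h i ω ∂tapeLaw : ℝ≥0∞)) a := by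
    intro a
    rw [Finset.sum_eq_single (f a)]
    · exact (Set.indicator_of_mem (s := {ω | f ω = f a}) (a := a) rfl
        (fun _ => (∫⁻ ω, h (f a) ω ∂tapeLaw : ℝ≥0∞))).symm
    · intro i _ hi
      exact Set.indicator_of_notMem (s := {ω | f ω = i}) (fun h => hi (Eq.symm h)) _
    · exact fun h => absurd (hs a) h
  have hm : ∀ i, MeasurableSet {ω | f ω = i} := fun i => hfm (measurableSet_singleton i)
  simp only [this]
  rw [lintegral_finsetSum _ fun i _ => measurable_const.indicator (hm i)]
  refine Finset.sum_congr rfl fun i _ => ?_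
  rw [lintegral_indicator (hm i), lintegral_const, Measure.restrict_apply MeasurableSet.univ,
    Set.univ_inter, mul_comm]

/-! ### Discrete choices -/

lemma unitInterval_lt_div {T c : ℕ} (hT : 0 < T) (u : unitInterval) :
    (u : ℝ) * T < c ↔ (u : ℝ) < c / T := by
  rw [lt_div_iff₀ (by exact_mod_cast hT)]

lemma div_mem_unitInterval {T c : ℕ} (h : c ≤ T) : (c : ℝ) / T ∈ unitInterval :=
  ⟨by positivity, div_le_one_of_le₀ (by exact_mod_cast h) (by positivity)⟩

lemma ofReal_natCast_div {T c : ℕ} (hT : 0 < T) :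
    ENNReal.ofReal ((c : ℝ) / T) = (c : ℝ≥0∞) / T := by
  rw [ENNReal.ofReal_div_of_pos (by exact_mod_cast hT), ENNReal.ofReal_natCast,
    ENNReal.ofReal_natCast]

lemma volume_mul_lt {T c : ℕ} (hT : 0 < T) (h : c ≤ T) :
    volume {u : unitInterval | (u : ℝ) * T < c} = (c : ℝ≥0∞) / T := by
  have : {u : unitInterval | (u : ℝ) * T < c} = Set.Iio ⟨(c : ℝ) / T, div_mem_unitInterval h⟩ := by
    ext u
    exact unitInterval_lt_div hT u
  rw [this, unitInterval.volume_Iio, ofReal_natCast_div hT]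

lemma volume_not_mul_lt {T c : ℕ} (hT : 0 < T) (h : c ≤ T) :
    volume {u : unitInterval | ¬ (u : ℝ) * T < c} = ((T - c : ℕ) : ℝ≥0∞) / T := by
  have : {u : unitInterval | ¬ (u : ℝ) * T < c} =
      Set.Ici ⟨(c : ℝ) / T, div_mem_unitInterval h⟩ := by
    ext u
    exact (not_congr (unitInterval_lt_div hT u)).trans not_lt
  rw [this, unitInterval.volume_Ici, ← ofReal_natCast_div hT, Nat.cast_sub h, sub_div,
    div_self (by positivity)]

/-- The index that is chosen with weights `w 0, …, w (n - 1)` by the uniform real `u`. -/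
def pickIdx (w : ℕ → ℕ) (n : ℕ) (u : ℝ) : ℕ :=
  ∑ i ∈ Finset.range (n - 1), if u * (∑ q ∈ Finset.range n, w q : ℕ) <
    (∑ q ∈ Finset.range (i + 1), w q : ℕ) then 0 else 1

lemma pickIdx_lt (w : ℕ → ℕ) {n : ℕ} (hn : 1 ≤ n) (u : ℝ) : pickIdx w n u < n := by
  have : pickIdx w n u ≤ ∑ i ∈ Finset.range (n - 1), 1 :=
    Finset.sum_le_sum fun i _ => by split_ifs <;> omega
  simp at this
  omega

lemma pickIdx_congr {w w' : ℕ → ℕ} {n : ℕ} (h : ∀ q < n, w q = w' q) (u : ℝ) :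
    pickIdx w n u = pickIdx w' n u := by
  have h1 : ∀ m ≤ n, ∑ q ∈ Finset.range m, w q = ∑ q ∈ Finset.range m, w' q := fun m hm =>
    Finset.sum_congr rfl fun q hq => h q (by have := Finset.mem_range.1 hq; omega)
  refine Finset.sum_congr rfl fun i hi => ?_
  have := Finset.mem_range.1 hi
  rw [h1 n le_rfl, h1 (i + 1) (by omega)]

/-- Since `p` persists once it holds, the number of failures below `N` is the first index at which
`p` holds, or `N` if there is none. -/
lemma sum_boole_eq_iff {p : ℕ → Prop} [DecidablePred p] (hp : ∀ q, p q → p (q + 1)) (N i : ℕ) :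
    (∑ q ∈ Finset.range N, if p q then 0 else 1) = i ↔
      (i ≤ N ∧ (∀ q < i, ¬ p q) ∧ (i < N → p i)) := by
  have hmono : ∀ q q', q ≤ q' → p q → p q' := fun q q' h hq => by
    induction h with
    | refl => exact hq
    | step _ ih => exact hp _ ih
  induction N generalizing i with
  | zero =>
    simp
    constructor
    · rintro rfl; simp
    · rintro ⟨rfl, -⟩; rfl
  | succ N ih =>
    rw [Finset.sum_range_succ]
    by_cases h : p N
    · rw [if_pos h, add_zero]
      refine (ih i).trans ?_
      constructor
      · rintro ⟨h1, h2, h3⟩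
        refine ⟨by omega, h2, fun h4 => ?_⟩
        rcases Nat.lt_or_ge i N with h5 | h5
        · exact h3 h5
        · obtain rfl : i = N := by omega
          exact h
      · rintro ⟨h1, h2, h3⟩
        have : i ≤ N := by
          by_contra hc
          exact h2 N (by omega) h
        exact ⟨this, h2, fun h4 => h3 (by omega)⟩
    · have hall : ∀ q ≤ N, ¬ p q := fun q hq hpq => h (hmono q N hq hpq)
      rw [if_neg h]
      have h1 : (∑ q ∈ Finset.range N, if p q then 0 else 1) = N :=
        (ih N).2 ⟨le_rfl, fun q hq => hall q hq.le, fun h => absurd h (lt_irrefl _)⟩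
      rw [h1]
      constructor
      · rintro rfl
        exact ⟨le_rfl, fun q hq => hall q (by omega), fun h => absurd h (lt_irrefl _)⟩
      · rintro ⟨h1, h2, h3⟩
        by_contra hc
        exact hall i (by omega) (h3 (by omega))

/-- Inversion of the distribution function: the index `i` is chosen when `u * T` is at least the
`i`-th partial sum and below the next one. -/
lemma volume_pickIdx {w : ℕ → ℕ} {n i : ℕ} (hi : i < n) (hT : 0 < ∑ q ∈ Finset.range n, w q) :
    volume {u : unitInterval | pickIdx w n u = i} =
      (w i : ℝ≥0∞) / (∑ q ∈ Finset.range n, w q : ℕ) := by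
  set T := ∑ q ∈ Finset.range n, w q with hTdef
  have hmono : ∀ m m', m ≤ m' → ∑ q ∈ Finset.range m, w q ≤ ∑ q ∈ Finset.range m', w q :=
    fun m m' h => Finset.sum_le_sum_of_subset (Finset.range_mono h)
  have hc : ∀ m ≤ n, ∑ q ∈ Finset.range m, w q ≤ T := fun m hm => hmono m n hm
  have hiff : ∀ u : unitInterval, pickIdx w n u = i ↔
      ¬ ((u : ℝ) * T < (∑ q ∈ Finset.range i, w q : ℕ)) ∧
        (i < n - 1 → (u : ℝ) * T < (∑ q ∈ Finset.range (i + 1), w q : ℕ)) := by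
    intro u
    rw [pickIdx, sum_boole_eq_iff (fun q hq => hq.trans_le (by
      exact_mod_cast hmono (q + 1) (q + 1 + 1) (by omega)))]
    constructor
    · rintro ⟨-, h2, h3⟩
      refine ⟨?_, h3⟩
      rcases i with _ | i
      · simp only [Finset.range_zero, Finset.sum_empty, Nat.cast_zero, not_lt]
        exact mul_nonneg u.2.1 (Nat.cast_nonneg _)
      · exact h2 i (by omega)
    · rintro ⟨h1, h2⟩
      refine ⟨by omega, fun q hq hlt => h1 (hlt.trans_le ?_), h2⟩
      exact_mod_cast hmono (q + 1) i (by omega)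
  have hsub : (w i : ℝ≥0∞) / T = ENNReal.ofReal
      (((∑ q ∈ Finset.range (i + 1), w q : ℕ) : ℝ) / T - ((∑ q ∈ Finset.range i, w q : ℕ) : ℝ) / T) := by
    rw [← ofReal_natCast_div hT, ← sub_div, Finset.sum_range_succ]
    push_cast
    congr 2
    ring
  rw [hsub]
  rcases Nat.lt_or_ge i (n - 1) with h | h
  · rw [← unitInterval.volume_Ico (x := ⟨_, div_mem_unitInterval (hc i hi.le)⟩)
      (y := ⟨_, div_mem_unitInterval (hc (i + 1) hi)⟩)]
    congr 1
    ext u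
    refine (hiff u).trans ?_
    simp only [h, true_imp_iff, unitInterval_lt_div hT, not_lt, Set.mem_Ico]
    rfl
  -- The last index has no upper threshold, so its interval is closed and includes `u = 1`.
  · have hin : i + 1 = n := by omega
    have h1 : ((∑ q ∈ Finset.range (i + 1), w q : ℕ) : ℝ) / T = 1 := by
      rw [hin, ← hTdef, div_self (by positivity)]
    rw [h1, ← unitInterval.volume_Ici (x := ⟨_, div_mem_unitInterval (hc i hi.le)⟩)]
    congr 1
    ext u
    refine (hiff u).trans ?_
    simp only [show ¬ i < n - 1 by omega, false_imp_iff, and_true, unitInterval_lt_div hT, not_lt,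
      Set.mem_Ici]
    rfl

lemma measurable_pickIdx (w : ℕ → ℕ) (n : ℕ) : Measurable (pickIdx w n) := by
  refine Finset.measurable_fun_sum _ fun i _ => ?_
  exact Measurable.ite (measurableSet_lt (by fun_prop) measurable_const) measurable_const
    measurable_const

lemma measurePreserving_eval (i : ℕ) :
    MeasurePreserving (fun ω : Tape => ω i) tapeLaw volume :=
  measurePreserving_eval_infinitePi _ i

lemma tapeLaw_pickIdx {w : ℕ → ℕ} {n i : ℕ} (hi : i < n) (hT : 0 < ∑ q ∈ Finset.range n, w q) :
    tapeLaw {ω | pickIdx w n (ω 0) = i} = (w i : ℝ≥0∞) / (∑ q ∈ Finset.range n, w q : ℕ) := by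
  rw [← volume_pickIdx hi hT, ← (measurePreserving_eval 0).measure_preimage]
  · rfl
  · have := (measurable_pickIdx w n).comp (measurable_subtype_coe (p := (· ∈ unitInterval)))
    exact (this (measurableSet_singleton i)).nullMeasurableSet
/-! ### Order statistics -/

/-- The open unit cube. -/
def unitCube (n : ℕ) : Set (Fin n → ℝ) := Set.pi Set.univ fun _ => Set.Ioo 0 1

lemma measurableSet_unitCube (n : ℕ) : MeasurableSet (unitCube n) :=
  MeasurableSet.univ_pi fun _ => measurableSet_Ioo

lemma measurable_tape_fin (n : ℕ) : Measurable fun (ω : Tape) (i : Fin n) => (ω i : ℝ) := by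
  fun_prop

/-- The first `n` random reals are uniform on the unit cube. -/
lemma map_tape_fin (n : ℕ) :
    tapeLaw.map (fun ω (i : Fin n) => (ω i : ℝ)) = volume.restrict (unitCube n) := by
  rw [unitCube, volume_pi, Measure.restrict_pi_pi]
  refine (Measure.pi_eq fun s hs => ?_).symm
  rw [Measure.map_apply (measurable_tape_fin n) (MeasurableSet.univ_pi hs)]
  let t : ℕ → Set unitInterval := fun i => if h : i < n then Subtype.val ⁻¹' s ⟨i, h⟩ else Set.univ
  have ht : ∀ i, MeasurableSet (t i) := fun i => by
    simp only [t]
    split_ifs with h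
    · exact measurable_subtype_coe (hs _)
    · exact MeasurableSet.univ
  have : (fun (ω : Tape) (i : Fin n) => (ω i : ℝ)) ⁻¹' (Set.pi Set.univ s) =
      Set.pi (Finset.range n : Set ℕ) t := by
    ext ω
    simp only [Set.mem_preimage, Set.mem_pi, Set.mem_univ, true_imp_iff, Finset.mem_coe,
      Finset.mem_range, t]
    constructor
    · intro h i hi
      rw [dif_pos hi]
      exact h ⟨i, hi⟩
    · intro h i
      simpa using h i i.2
  rw [this, tapeLaw, Measure.infinitePi_pi _ fun i _ => ht i, Finset.prod_range]
  refine Finset.prod_congr rfl fun i _ => ?_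
  simp only [t, i.2, dif_pos]
  rw [← unitInterval.measurePreserving_coe.map_eq.trans (Measure.restrict_congr_set Ioo_ae_eq_Icc.symm),
    Measure.map_apply measurable_subtype_coe (hs i)]

lemma lintegral_tape_fin (n : ℕ) {F : (Fin n → ℝ) → ℝ≥0∞} (hF : Measurable F) :
    ∫⁻ ω, F (fun i => (ω i : ℝ)) ∂tapeLaw = ∫⁻ x in unitCube n, F x := by
  rw [← map_tape_fin, lintegral_map hF (measurable_tape_fin n)]

/-- The number of the first `d` entries of `x` that are less than `v`. -/
def countLt (x : ℕ → ℝ) (d : ℕ) (v : ℝ) : ℕ := ∑ q ∈ Finset.range d, if x q < v then 1 else 0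

lemma countLt_lt {x : ℕ → ℝ} {d i i' : ℕ} (hi : i < d) (h : x i < x i') :
    countLt x d (x i) < countLt x d (x i') := by
  refine Finset.sum_lt_sum (fun q _ => ?_) ⟨i, Finset.mem_range.2 hi, by simp [h]⟩
  split_ifs with h1 h2 <;> first | omega | exact absurd (h1.trans h) h2

lemma countLt_lt_self {x : ℕ → ℝ} {d i : ℕ} (hi : i < d) : countLt x d (x i) < d := by
  calc countLt x d (x i) < ∑ q ∈ Finset.range d, 1 :=
        Finset.sum_lt_sum (fun q _ => by split_ifs <;> omega) ⟨i, Finset.mem_range.2 hi, by simp⟩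
    _ = d := by simp

/-- Search for the `j`-th smallest of the first `d` entries of `x` among the first `m` ones. -/
def orderStat (x : ℕ → ℝ) (d j : ℕ) : ℕ → ℝ
  | 0 => 0
  | m + 1 => if countLt x d (x m) + 1 = j then x m else orderStat x d j m

/-- The greatest of `0` and the first `n` entries of `x`. -/
def runMax (x : ℕ → ℝ) : ℕ → ℝ
  | 0 => 0
  | n + 1 => if runMax x n < x n then x n else runMax x n

/-- For distinct entries the rank maps the `d` indices injectively into the `d` possible ranks,
hence bijectively. -/
lemma exists_countLt_eq {x : ℕ → ℝ} {d j : ℕ} (hx : ∀ i < d, ∀ i' < d, x i = x i' → i = i')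
    (hj : j < d) : ∃ i < d, countLt x d (x i) = j ∧ ∀ i' < d, countLt x d (x i') = j → i' = i := by
  let c : Fin d → Fin d := fun i => ⟨countLt x d (x i), countLt_lt_self i.2⟩
  have hc : Function.Injective c := by
    intro i i' h
    have h : countLt x d (x i) = countLt x d (x i') := congrArg Fin.val h
    refine Fin.ext (hx _ i.2 _ i'.2 ?_)
    by_contra hne
    rcases lt_or_gt_of_ne hne with h1 | h1
    · exact absurd h (countLt_lt i.2 h1).ne
    · exact absurd h (countLt_lt i'.2 h1).ne'
  obtain ⟨i, hi⟩ := (Finite.injective_iff_surjective.1 hc) ⟨j, hj⟩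
  refine ⟨i, i.2, congrArg Fin.val hi, fun i' hi' h => ?_⟩
  have : c ⟨i', hi'⟩ = c i := by rw [hi]; exact Fin.ext h
  exact congrArg Fin.val (hc this)

lemma orderStat_eq {x : ℕ → ℝ} {d j i : ℕ} (hi : countLt x d (x i) + 1 = j)
    (hu : ∀ i' < d, countLt x d (x i') + 1 = j → i' = i) {m : ℕ} (hm : m ≤ d) :
    orderStat x d j m = if i < m then x i else 0 := by
  induction m with
  | zero => simp [orderStat]
  | succ m ih =>
    rw [orderStat, ih (by omega)]
    by_cases h : countLt x d (x m) + 1 = j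
    · obtain rfl := hu m (by omega) h
      simp [h]
    · rw [if_neg h]
      have : m ≠ i := by rintro rfl; exact h hi
      split_ifs <;> first | rfl | omega

lemma le_runMax {x : ℕ → ℝ} {n q : ℕ} (hq : q < n) : x q ≤ runMax x n := by
  induction n with
  | zero => omega
  | succ n ih =>
    rw [runMax]
    rcases Nat.lt_or_ge q n with h | h
    · split_ifs with h1
      · exact (ih h).trans h1.le
      · exact ih h
    · obtain rfl : q = n := by omega
      split_ifs with h1
      · exact le_rfl
      · exact not_lt.1 h1

lemma exists_runMax_eq {x : ℕ → ℝ} (hx : ∀ q, 0 ≤ x q) (n : ℕ) :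
    ∃ q < n + 1, runMax x (n + 1) = x q := by
  induction n with
  | zero =>
    refine ⟨0, by omega, ?_⟩
    rw [runMax, runMax]
    split_ifs with h
    · rfl
    · exact le_antisymm (hx 0) (not_lt.1 h)
  | succ n ih =>
    obtain ⟨q, hq, h⟩ := ih
    rw [runMax]
    split_ifs with h1
    · exact ⟨n + 1, by omega, rfl⟩
    · exact ⟨q, by omega, h⟩

/-- The entry of the highest rank is the maximum; thus the law of the maximum is a special case of
the law of an order statistic. -/
lemma runMax_eq_orderStat {x : ℕ → ℝ} {n : ℕ} (h0 : ∀ q, 0 ≤ x q)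
    (hx : ∀ i < n + 1, ∀ i' < n + 1, x i = x i' → i = i') :
    runMax x (n + 1) = orderStat x (n + 1) (n + 1) (n + 1) := by
  obtain ⟨i, hi, h1, h2⟩ := exists_countLt_eq hx (Nat.lt_succ_self n)
  rw [orderStat_eq (i := i) (by omega) (fun i' hi' h => h2 i' hi' (by omega)) le_rfl, if_pos hi]
  obtain ⟨q, hq, h⟩ := exists_runMax_eq h0 n
  rw [h]
  by_contra hne
  have hlt : x i < x q := lt_of_le_of_ne (h ▸ le_runMax hi) (Ne.symm hne)
  have := countLt_lt hi hlt
  have := countLt_lt_self (x := x) hq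
  omega

/-! ### Laws of the order statistics of uniform reals -/

lemma tape_ae_injective (d : ℕ) :
    ∀ᵐ ω ∂tapeLaw, ∀ i < d, ∀ i' < d, (ω i : ℝ) = ω i' → i = i' := by
  have h1 : ∀ᵐ x : Fin d → ℝ, ∀ i i', x i = x i' → i = i' := by
    rw [ae_all_iff]; intro i
    rw [ae_all_iff]; intro i'
    by_cases h : i = i'
    · exact Filter.Eventually.of_forall fun _ _ => h
    · have hsub : ∀ᵐ x : Fin d → ℝ, x i - x i' ≠ 0 := by
        let l : (Fin d → ℝ) →ₗ[ℝ] ℝ := (LinearMap.proj i : (Fin d → ℝ) →ₗ[ℝ] ℝ) -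
          (LinearMap.proj i' : (Fin d → ℝ) →ₗ[ℝ] ℝ)
        have hl : LinearMap.ker l ≠ ⊤ := by
          intro h1
          have := (LinearMap.mem_ker (f := l) (y := Pi.single i 1)).1 (h1 ▸ Submodule.mem_top)
          simp [l, Ne.symm h] at this
        exact measure_eq_zero_iff_ae_notMem.1 (Measure.addHaar_submodule volume _ hl)
      filter_upwards [hsub] with x hx hxe
      exact absurd (sub_eq_zero.2 hxe) hx
  have h2 := ae_restrict_of_ae (s := unitCube d) h1
  rw [← map_tape_fin] at h2
  filter_upwards [ae_of_ae_map (measurable_tape_fin d).aemeasurable h2] with ω hω i hi i' hi' h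
  exact congrArg Fin.val (hω ⟨i, hi⟩ ⟨i', hi'⟩ h)

/-- The number of coordinates of `y` that are less than `s`. -/
def finCountLt {n : ℕ} (y : Fin n → ℝ) (s : ℝ) : ℕ := ∑ q, if y q < s then 1 else 0

/-- The binomial law: the event is a disjoint union of boxes, one for each set of `b` coordinates
below `s`. -/
lemma volume_finCountLt_eq (n b : ℕ) {s : ℝ} (hs : s ∈ Set.Ioo (0 : ℝ) 1) :
    volume ({y : Fin n → ℝ | finCountLt y s = b} ∩ unitCube n) =
      ENNReal.ofReal (n.choose b * (s ^ b * (1 - s) ^ (n - b))) := by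
  classical
  let B : Finset (Fin n) → Set (Fin n → ℝ) := fun A =>
    Set.pi Set.univ fun q => if q ∈ A then Set.Ioo 0 s else Set.Ico s 1
  have hB : ∀ A y, y ∈ B A → (Finset.univ.filter fun q => y q < s) = A := by
    intro A y hy
    ext q
    have : y q ∈ if q ∈ A then Set.Ioo 0 s else Set.Ico s 1 := hy q trivial
    simp only [Finset.mem_filter, Finset.mem_univ, true_and]
    split_ifs at this with h
    · simp [h, this.2]
    · simp [h, this.1]
  have hU : ({y : Fin n → ℝ | finCountLt y s = b} ∩ unitCube n) =
      ⋃ A ∈ Finset.powersetCard b Finset.univ, B A := by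
    ext y
    simp only [Set.mem_inter_iff, Set.mem_iUnion, Finset.mem_powersetCard, exists_prop]
    constructor
    · rintro ⟨h1, h2⟩
      refine ⟨_, ⟨Finset.subset_univ _, (Finset.card_filter _ _).trans h1⟩, fun q _ => ?_⟩
      have := h2 q trivial
      simp only [Finset.mem_filter, Finset.mem_univ, true_and]
      split_ifs with h
      · exact ⟨this.1, h⟩
      · exact ⟨not_lt.1 h, this.2⟩
    · rintro ⟨A, ⟨-, hA⟩, hy⟩
      refine ⟨?_, fun q _ => ?_⟩
      · show (∑ q, if y q < s then 1 else 0) = b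
        rw [← Finset.card_filter, hB A y hy, hA]
      · have : y q ∈ if q ∈ A then Set.Ioo 0 s else Set.Ico s 1 := hy q trivial
        split_ifs at this with h
        · exact ⟨this.1, this.2.trans hs.2⟩
        · exact ⟨hs.1.trans_le this.1, this.2⟩
  rw [hU, measure_biUnion_finset]
  · have hv : ∀ A ∈ Finset.powersetCard b (Finset.univ : Finset (Fin n)),
        volume (B A) = ENNReal.ofReal (s ^ b * (1 - s) ^ (n - b)) := by
      intro A hA
      have hc := (Finset.mem_powersetCard.1 hA).2
      have h1 : ∀ q : Fin n, volume (if q ∈ A then Set.Ioo 0 s else Set.Ico s 1) =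
          ENNReal.ofReal (if q ∈ A then s else 1 - s) := by
        intro q; split_ifs <;> simp
      have h2 : (Finset.univ.filter fun q => ¬ q ∈ A).card = n - b := by
        rw [← Finset.compl_filter, Finset.card_compl, Fintype.card_fin]
        simp [hc]
      simp only [B, volume_pi_pi, h1]
      rw [← ENNReal.ofReal_prod_of_nonneg (fun q _ => by
        split_ifs
        · exact hs.1.le
        · linarith [hs.2]), Finset.prod_ite, Finset.prod_const, Finset.prod_const, h2]
      simp [hc]
    rw [Finset.sum_congr rfl hv, Finset.sum_const, Finset.card_powersetCard, Finset.card_univ,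
      Fintype.card_fin, nsmul_eq_mul, ENNReal.ofReal_mul (p := (n.choose b : ℝ)) (by positivity),
      ENNReal.ofReal_natCast]
  · intro A _ A' _ hne
    exact Set.disjoint_left.2 fun y h h' => hne ((hB A y h).symm.trans (hB A' y h'))
  · intro A _
    refine MeasurableSet.univ_pi fun q => ?_
    split_ifs
    exacts [measurableSet_Ioo, measurableSet_Ico]

lemma measurable_finCountLt (n : ℕ) : Measurable fun p : ℝ × (Fin n → ℝ) => finCountLt p.2 p.1 := by
  refine Finset.measurable_fun_sum _ fun q _ => Measurable.ite ?_ measurable_const measurable_const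
  exact measurableSet_lt (by fun_prop) (by fun_prop)

lemma finCountLt_insertNth {n : ℕ} (i : Fin (n + 1)) (s : ℝ) (y : Fin n → ℝ) :
    finCountLt (i.insertNth s y : Fin (n + 1) → ℝ) ((i.insertNth s y : Fin (n + 1) → ℝ) i) =
      finCountLt y s := by
  rw [finCountLt, Fin.sum_univ_succAbove _ i]
  simp [finCountLt]

lemma insertNth_mem_unitCube {n : ℕ} (i : Fin (n + 1)) (s : ℝ) (y : Fin n → ℝ) :
    (i.insertNth s y : Fin (n + 1) → ℝ) ∈ unitCube (n + 1) ↔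
      s ∈ Set.Ioo (0 : ℝ) 1 ∧ y ∈ unitCube n := by
  simp only [unitCube, Set.mem_pi, Set.mem_univ, true_imp_iff]
  rw [Fin.forall_iff_succAbove i]
  simp

/-- Fix the value `s` of the coordinate `i`. It is not less than itself, so its rank counts the
other `n` coordinates below `s` and is binomial. -/
lemma setLIntegral_finCountLt {n j : ℕ} (i : Fin (n + 1)) {G : ℝ → ℝ≥0∞} (hG : Measurable G) :
    ∫⁻ x in unitCube (n + 1), (if finCountLt x (x i) = j then G (x i) else 0) =
      ∫⁻ s in Set.Ioo (0 : ℝ) 1, ENNReal.ofReal (n.choose j * (s ^ j * (1 - s) ^ (n - j))) * G s := by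
  have hc : Measurable fun x : Fin (n + 1) → ℝ => finCountLt x (x i) :=
    (measurable_finCountLt (n + 1)).comp (g := fun p : ℝ × (Fin (n + 1) → ℝ) => finCountLt p.2 p.1)
      (f := fun x : Fin (n + 1) → ℝ => (x i, x)) (by fun_prop)
  have hF : Measurable fun x : Fin (n + 1) → ℝ => if finCountLt x (x i) = j then G (x i) else 0 :=
    Measurable.ite (hc (measurableSet_singleton j)) (by fun_prop) measurable_const
  rw [← lintegral_indicator (measurableSet_unitCube _), ← lintegral_indicator measurableSet_Ioo,
    lintegral_insertNth i one_ne_zero (l := fun _ => 0) measurable_const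
      (hF.indicator (measurableSet_unitCube _))]
  simp only [abs_one, ENNReal.ofReal_one, one_mul, add_zero]
  refine lintegral_congr fun s => ?_
  by_cases hs : s ∈ Set.Ioo (0 : ℝ) 1
  · have hm : MeasurableSet ({y : Fin n → ℝ | finCountLt y s = j} ∩ unitCube n) :=
      (((measurable_finCountLt n).comp measurable_prodMk_left)
        (measurableSet_singleton j)).inter (measurableSet_unitCube n)
    rw [Set.indicator_of_mem hs, ← volume_finCountLt_eq n j hs, mul_comm, ← lintegral_indicator_const hm]
    refine lintegral_congr fun y => ?_
    classical
    rw [Set.indicator_apply, Set.indicator_apply, insertNth_mem_unitCube, finCountLt_insertNth,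
      Fin.insertNth_apply_same]
    simp only [hs, true_and, Set.mem_inter_iff, Set.mem_ofPred_eq]
    split_ifs <;> first | rfl | tauto
  · rw [Set.indicator_of_notMem hs]
    refine (lintegral_congr fun y => ?_).trans lintegral_zero
    exact Set.indicator_of_notMem (fun h => hs ((insertNth_mem_unitCube i s y).1 h).1) _

lemma finCountLt_tape (d : ℕ) (ω : Tape) (v : ℝ) :
    finCountLt (fun i : Fin d => (ω i : ℝ)) v = countLt (fun q => ω q) d v := by
  rw [finCountLt, countLt, Finset.sum_range]

/-- Almost surely exactly one index has rank `j`, so the order statistic is a sum over the `d`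
indices with equal contributions. The factor `d * (d-1).choose j` is the reciprocal of the Beta
constant. -/
lemma lintegral_orderStat {d j : ℕ} (hj : j < d) {G : ℝ → ℝ≥0∞} (hG : Measurable G) :
    ∫⁻ ω, G (orderStat (fun q => ω q) d (j + 1) d) ∂tapeLaw =
      ∫⁻ t, G t ∂(betaMeasure ((j : ℝ) + 1) (((d - 1 - j : ℕ) : ℝ) + 1)) := by
  obtain ⟨n, rfl⟩ : ∃ n, d = n + 1 := ⟨d - 1, by omega⟩
  have h1 : (fun ω : Tape => G (orderStat (fun q => ω q) (n + 1) (j + 1) (n + 1))) =ᵐ[tapeLaw]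
      fun ω => ∑ i : Fin (n + 1),
        if finCountLt (fun i : Fin (n + 1) => (ω i : ℝ)) (ω i) = j then G (ω i) else 0 := by
    filter_upwards [tape_ae_injective (n + 1)] with ω hω
    obtain ⟨i, hi, h1, h2⟩ := exists_countLt_eq hω hj
    rw [orderStat_eq (i := i) (by omega) (fun i' hi' h => h2 i' hi' (by omega)) le_rfl, if_pos hi,
      Finset.sum_eq_single ⟨i, hi⟩]
    · rw [finCountLt_tape, if_pos h1]
    · intro i' _ hne
      rw [finCountLt_tape, if_neg fun h => hne (Fin.ext (h2 i' i'.2 h))]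
    · simp
  have hm : ∀ i : Fin (n + 1), Measurable fun x : Fin (n + 1) → ℝ =>
      if finCountLt x (x i) = j then G (x i) else 0 := fun i => by
    have hc : Measurable fun x : Fin (n + 1) → ℝ => finCountLt x (x i) :=
      (measurable_finCountLt (n + 1)).comp (g := fun p : ℝ × (Fin (n + 1) → ℝ) => finCountLt p.2 p.1)
      (f := fun x : Fin (n + 1) → ℝ => (x i, x)) (by fun_prop)
    exact Measurable.ite (hc (measurableSet_singleton j)) (by fun_prop) measurable_const
  rw [lintegral_congr_ae h1, lintegral_tape_fin (n + 1)
    (F := fun x => ∑ i, if finCountLt x (x i) = j then G (x i) else 0)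
    (Finset.measurable_fun_sum _ fun i _ => hm i), lintegral_finsetSum _ fun i _ => hm i]
  simp only [setLIntegral_finCountLt _ hG]
  rw [Finset.sum_const, Finset.card_univ, Fintype.card_fin, nsmul_eq_mul, lintegral_betaMeasure,
    ← lintegral_const_mul' _ _ (by simp), ← lintegral_const_mul' _ _ (by simp)]
  refine setLIntegral_congr_fun measurableSet_Ioo fun t ht => ?_
  have ht0 : 0 ≤ t := ht.1.le
  have ht1 : 0 ≤ 1 - t := by linarith [ht.2]
  show _ * (_ * _) = _ * (_ * (_ * _))
  simp only [← mul_assoc]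
  congr 1
  have hb : 0 ≤ 1 / beta ((j : ℝ) + 1) (((n + 1 - 1 - j : ℕ) : ℝ) + 1) := by
    rw [beta_natCast]; positivity
  have hb' := mul_nonneg hb (pow_nonneg ht0 j)
  rw [← ENNReal.ofReal_natCast, ← ENNReal.ofReal_mul (by positivity),
    ← ENNReal.ofReal_mul hb, ← ENNReal.ofReal_mul hb']
  congr 1
  rw [beta_natCast, show n + 1 - 1 - j = n - j by omega, show j + (n - j) + 1 = n + 1 by omega,
    Nat.cast_choose ℝ (show j ≤ n by omega), Nat.factorial_succ]
  have := Nat.factorial_ne_zero j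
  have := Nat.factorial_ne_zero (n - j)
  push_cast
  field_simp

lemma measurable_countLt (x : Tape → ℕ → ℝ) (hx : ∀ q, Measurable fun ω => x ω q) (d i : ℕ) :
    Measurable fun ω => countLt (x ω) d (x ω i) := by
  refine Finset.measurable_fun_sum _ fun q _ => Measurable.ite ?_ measurable_const measurable_const
  exact measurableSet_lt (hx q) (hx i)

lemma measurable_orderStat (x : Tape → ℕ → ℝ) (hx : ∀ q, Measurable fun ω => x ω q) (d j m : ℕ) :
    Measurable fun ω => orderStat (x ω) d j m := by
  induction m with
  | zero => exact measurable_const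
  | succ m ih =>
    refine Measurable.ite ?_ (hx m) ih
    exact ((measurable_countLt x hx d m).add_const 1) (measurableSet_singleton j)

lemma measurable_runMax (x : Tape → ℕ → ℝ) (hx : ∀ q, Measurable fun ω => x ω q) (n : ℕ) :
    Measurable fun ω => runMax (x ω) n := by
  induction n with
  | zero => exact measurable_const
  | succ n ih => exact Measurable.ite (measurableSet_lt ih (hx n)) (hx n) ih

lemma map_orderStat {d j : ℕ} (hj : j ≤ d) :
    tapeLaw.map (fun ω => orderStat (fun q => ω q) d j d) = crossSectionLaw d j := by
  rcases j with _ | j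
  -- No entry has `countLt + 1 = 0`, so the search ends with its default value `0`, the atom that
  -- `crossSectionLaw` has for `j = 0`.
  · have : ∀ x m, orderStat x d 0 m = 0 := fun x m => by
      induction m with
      | zero => rfl
      | succ m ih => simp [orderStat, ih]
    simp only [this, crossSectionLaw, if_true]
    simp
  · refine Measure.ext_of_lintegral _ fun G hG => ?_
    rw [lintegral_map hG (measurable_orderStat _ (by fun_prop) _ _ _), lintegral_orderStat hj hG,
      crossSectionLaw, if_neg (by omega), Nat.sub_sub, Nat.cast_sub (by omega)]
    push_cast
    congr 2
    ring

/-- The law of the greatest of `n + 1` random reals. -/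
lemma lintegral_runMax (n : ℕ) {G : ℝ → ℝ≥0∞} (hG : Measurable G) :
    ∫⁻ ω, G (runMax (fun q => ω q) (n + 1)) ∂tapeLaw =
      ((n + 1 : ℕ) : ℝ≥0∞) * ∫⁻ t in Set.Ioo (0 : ℝ) 1, ENNReal.ofReal (t ^ n) * G t := by
  have h : (fun ω : Tape => G (runMax (fun q => ω q) (n + 1))) =ᵐ[tapeLaw]
      fun ω => G (orderStat (fun q => ω q) (n + 1) (n + 1) (n + 1)) := by
    filter_upwards [tape_ae_injective (n + 1)] with ω hω
    rw [runMax_eq_orderStat (fun q => (ω q).2.1) hω]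
  rw [lintegral_congr_ae h, lintegral_orderStat (by omega) hG, lintegral_betaMeasure, beta_natCast]
  have : (1 / ((n.factorial : ℝ) * (n + 1 - 1 - n : ℕ).factorial /
      (n + (n + 1 - 1 - n) + 1 : ℕ).factorial)) = ((n + 1 : ℕ) : ℝ) := by
    rw [show n + 1 - 1 - n = 0 by omega, add_zero, Nat.factorial_succ]
    have := Nat.factorial_ne_zero n
    push_cast
    simp
    field_simp
  rw [this, ENNReal.ofReal_natCast]
  simp

/-! ### Random signs -/

/-- The sum of `W (p + numPos J)` over all sign vectors `J` of length `l`. -/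
def pathWeight (W : ℕ → ℕ) : ℕ → ℕ → ℕ
  | 0, p => W p
  | l + 1, p => pathWeight W l p + pathWeight W l (p + 1)

lemma pathWeight_pos {W : ℕ → ℕ} (hW : ∀ p, 0 < W p) (l p : ℕ) : 0 < pathWeight W l p := by
  induction l generalizing p with
  | zero => exact hW p
  | succ l ih => exact Nat.add_pos_left (ih p) _

/-- Whether the sign at position `i` is positive, when `p` of the earlier ones are. -/
def SignTest (W : ℕ → ℕ) (d : ℕ) (x : ℕ → ℝ) (i p : ℕ) : Prop :=
  x i * (pathWeight W (d - i) p : ℕ) < (pathWeight W (d - i - 1) (p + 1) : ℕ)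

instance (W : ℕ → ℕ) (d : ℕ) (x : ℕ → ℝ) (i p : ℕ) : Decidable (SignTest W d x i p) :=
  inferInstanceAs (Decidable (_ < _))

/-- The number of positive signs among the first `i` ones. -/
def posCount (W : ℕ → ℕ) (d : ℕ) (x : ℕ → ℝ) : ℕ → ℕ
  | 0 => 0
  | i + 1 => posCount W d x i + if SignTest W d x i (posCount W d x i) then 1 else 0

/-- Sign vectors with probabilities proportional to `W (numPos J)`. -/
def randSigns (W : ℕ → ℕ) (d : ℕ) (x : ℕ → ℝ) (i : Fin d) : Bool :=
  decide (SignTest W d x i (posCount W d x i))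

/-- The number of positive signs among the first `m` ones. -/
def prefixCount (b : ℕ → Bool) (m : ℕ) : ℕ := ∑ q ∈ Finset.range m, if b q then 1 else 0

lemma posCount_eq_prefixCount {W : ℕ → ℕ} {d : ℕ} {x : ℕ → ℝ} {b : ℕ → Bool} {m : ℕ}
    (h : ∀ i < m, SignTest W d x i (posCount W d x i) ↔ b i = true) :
    posCount W d x m = prefixCount b m := by
  induction m with
  | zero => rfl
  | succ m ih =>
    rw [posCount, prefixCount, Finset.sum_range_succ, ← prefixCount,
      ← ih fun i hi => h i (hi.trans m.lt_succ_self)]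
    simp only [h m m.lt_succ_self]

/-- Here the tests are evaluated along the prescribed signs `b` instead of along the actual path; by
induction the two agree. -/
lemma posCount_eq_prefixCount' {W : ℕ → ℕ} {d : ℕ} {x : ℕ → ℝ} {b : ℕ → Bool} {m : ℕ}
    (h : ∀ i < m, SignTest W d x i (prefixCount b i) ↔ b i = true) :
    posCount W d x m = prefixCount b m := by
  induction m with
  | zero => rfl
  | succ m ih =>
    rw [posCount, prefixCount, Finset.sum_range_succ, ← prefixCount,
      ih fun i hi => h i (hi.trans m.lt_succ_self)]
    simp only [h m m.lt_succ_self]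

/-- A sign vector as a sequence. -/
def signSeq {d : ℕ} (J : Fin d → Bool) (i : ℕ) : Bool := if h : i < d then J ⟨i, h⟩ else false

lemma signSeq_val {d : ℕ} (J : Fin d → Bool) (i : Fin d) : signSeq J i = J i := by
  simp [signSeq]

lemma prefixCount_signSeq {d : ℕ} (J : Fin d → Bool) : prefixCount (signSeq J) d = numPos J := by
  rw [prefixCount, numPos, Finset.card_filter, Finset.sum_range]
  simp only [signSeq_val]

lemma numPos_randSigns (W : ℕ → ℕ) (d : ℕ) (x : ℕ → ℝ) :
    numPos (randSigns W d x) = posCount W d x d := by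
  rw [← prefixCount_signSeq]
  refine (posCount_eq_prefixCount fun i hi => ?_).symm
  simp [signSeq, hi, randSigns]

/-- With the counts taken along the fixed target `J`, each condition involves one random real only.
The event becomes a product set. -/
lemma randSigns_eq_iff {W : ℕ → ℕ} {d : ℕ} {x : ℕ → ℝ} {J : Fin d → Bool} :
    randSigns W d x = J ↔
      ∀ i < d, SignTest W d x i (prefixCount (signSeq J) i) ↔ signSeq J i = true := by
  constructor
  · rintro rfl i hi
    rw [← posCount_eq_prefixCount (W := W) (d := d) (x := x) fun q hq => by
      simp [signSeq, hq.trans hi, randSigns]]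
    simp [signSeq, hi, randSigns]
  · intro h
    funext i
    have := h i i.2
    rw [← posCount_eq_prefixCount' fun q hq => h q (hq.trans i.2), signSeq_val] at this
    rw [randSigns]
    cases hJ : J i <;> simp [this, hJ]

lemma volume_signTest {W : ℕ → ℕ} (hW : ∀ p, 0 < W p) {d i : ℕ} (hi : i < d) (p : ℕ) (b : Bool) :
    volume {u : unitInterval | SignTest W d (fun _ => u) i p ↔ b = true} =
      (pathWeight W (d - (i + 1)) (p + if b then 1 else 0) : ℝ≥0∞) / pathWeight W (d - i) p := by
  have hs : pathWeight W (d - i) p =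
      pathWeight W (d - (i + 1)) p + pathWeight W (d - (i + 1)) (p + 1) := by
    rw [show d - i = d - (i + 1) + 1 by omega, pathWeight]
  unfold SignTest
  rw [Nat.sub_sub]
  cases b
  · simp only [Bool.false_eq_true, iff_false, if_false, add_zero]
    rw [volume_not_mul_lt (pathWeight_pos hW _ _) (by omega)]
    congr 2
    omega
  · simp only [iff_true, if_true]
    rw [volume_mul_lt (pathWeight_pos hW _ _) (by omega)]

lemma measurableSet_signTest (W : ℕ → ℕ) (d i p : ℕ) (b : Bool) :
    MeasurableSet {u : unitInterval | SignTest W d (fun _ => u) i p ↔ b = true} := by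
  have : MeasurableSet {u : unitInterval | SignTest W d (fun _ => u) i p} :=
    measurableSet_lt (by fun_prop) measurable_const
  cases b
  · simp only [Bool.false_eq_true, iff_false]
    exact this.compl
  · simpa using this

lemma prod_div_telescope (a : ℕ → ℕ) (d : ℕ) (ha : ∀ i, 0 < a i) :
    ∏ i ∈ Finset.range d, ((a (i + 1) : ℝ≥0∞) / a i) = (a d : ℝ≥0∞) / a 0 := by
  have h0 : ∀ i, (a i : ℝ≥0∞) ≠ 0 := fun i => by exact_mod_cast (ha i).ne'
  induction d with
  | zero => simp [ENNReal.div_self (h0 0) (ENNReal.natCast_ne_top _)]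
  | succ d ih =>
    rw [Finset.prod_range_succ, ih, mul_comm, ← mul_div_assoc,
      ENNReal.div_mul_cancel (h0 d) (ENNReal.natCast_ne_top _)]

/-- Each condition has as probability the ratio of two successive path weights along `J`, and the
product of these telescopes. -/
lemma tapeLaw_randSigns_aux {W : ℕ → ℕ} (hW : ∀ p, 0 < W p) {d : ℕ} (J : Fin d → Bool) :
    tapeLaw {ω | randSigns W d (fun q => ω q) = J} =
      (W (numPos J) : ℝ≥0∞) / pathWeight W d 0 := by
  let t : ℕ → Set unitInterval := fun i =>
    {u | SignTest W d (fun _ => u) i (prefixCount (signSeq J) i) ↔ signSeq J i = true}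
  have : {ω : Tape | randSigns W d (fun q => ω q) = J} = Set.pi (Finset.range d : Set ℕ) t := by
    ext ω
    simp only [Set.mem_ofPred_eq, randSigns_eq_iff, Set.mem_pi, Finset.mem_coe, Finset.mem_range]
    rfl
  rw [this, tapeLaw, Measure.infinitePi_pi _ fun i _ => measurableSet_signTest _ _ _ _ _,
    Finset.prod_congr rfl fun i hi =>
      volume_signTest hW (Finset.mem_range.1 hi) (prefixCount (signSeq J) i) (signSeq J i)]
  have h1 : ∀ i, prefixCount (signSeq J) i + (if signSeq J i then 1 else 0) =
      prefixCount (signSeq J) (i + 1) := fun i => by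
    rw [prefixCount, prefixCount, Finset.sum_range_succ]
  simp only [h1]
  rw [prod_div_telescope (fun i => pathWeight W (d - i) (prefixCount (signSeq J) i)) d
    (fun i => pathWeight_pos hW _ _), Nat.sub_self, prefixCount_signSeq]
  rfl

lemma measurable_posCount (W : ℕ → ℕ) (d m : ℕ) :
    Measurable fun ω : Tape => posCount W d (fun q => ω q) m := by
  induction m with
  | zero => exact measurable_const
  | succ m ih =>
    refine ih.add (Measurable.ite ?_ measurable_const measurable_const)
    have h : ∀ g : ℕ → ℝ, Measurable fun ω : Tape => g (posCount W d (fun q => ω q) m) :=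
      fun g => (measurable_from_top (f := g)).comp ih
    exact measurableSet_lt (Measurable.mul (by fun_prop) (h fun p => (pathWeight W (d - m) p : ℕ)))
      (h fun p => (pathWeight W (d - m - 1) (p + 1) : ℕ))

lemma measurable_randSigns (W : ℕ → ℕ) (d : ℕ) :
    Measurable fun ω : Tape => randSigns W d fun q => ω q := by
  refine measurable_pi_iff.2 fun i => ?_
  -- A sign is positive exactly when the count jumps, which exhibits it as a function of two
  -- measurable natural numbers.
  have h : (fun ω : Tape => randSigns W d (fun q => ω q) i) = fun ω : Tape =>
      decide (posCount W d (fun q => ω q) (i + 1) ≠ posCount W d (fun q => ω q) i) := by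
    funext ω
    rw [posCount, randSigns]
    by_cases hs : SignTest W d (fun q => ω q) i (posCount W d (fun q => ω q) i) <;> simp [hs]
  rw [h]
  exact (measurable_of_countable (fun p : ℕ × ℕ => decide (p.1 ≠ p.2))).comp
    ((measurable_posCount W d (i + 1)).prodMk (measurable_posCount W d i))

lemma posCount_congr {W : ℕ → ℕ} {d m : ℕ} {x y : ℕ → ℝ} (h : ∀ i < m, x i = y i) :
    posCount W d x m = posCount W d y m := by
  induction m with
  | zero => rfl
  | succ m ih =>
    rw [posCount, posCount, ih fun i hi => h i (by omega)]
    congr 1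
    exact if_congr (by simp only [SignTest, h m (by omega)]) rfl rfl

lemma randSigns_congr {W : ℕ → ℕ} {d : ℕ} {x y : ℕ → ℝ} (h : ∀ i < d, x i = y i) :
    randSigns W d x = randSigns W d y := by
  funext i
  rw [randSigns, randSigns, posCount_congr fun q hq => h q (hq.trans i.2)]
  exact decide_eq_decide.2 (by simp only [SignTest, h i i.2])

/-- That the path weight at the origin is the sum of all weights follows from the fact that the
probabilities add up to one. -/
lemma tapeLaw_randSigns {W : ℕ → ℕ} (hW : ∀ p, 0 < W p) {d : ℕ} (J : Fin d → Bool) :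
    tapeLaw {ω | randSigns W d (fun q => ω q) = J} =
      (W (numPos J) : ℝ≥0∞) / ((∑ J' : Fin d → Bool, W (numPos J') : ℕ) : ℝ≥0∞) := by
  have h := sum_measure_preimage_singleton (μ := tapeLaw) Finset.univ
    (f := fun ω : Tape => randSigns W d fun q => ω q)
    fun J _ => measurable_randSigns W d (measurableSet_singleton J)
  have h2 : ∀ J : Fin d → Bool, tapeLaw ((fun ω : Tape => randSigns W d fun q => ω q) ⁻¹' {J}) =
      (W (numPos J) : ℝ≥0∞) / pathWeight W d 0 := fun J => tapeLaw_randSigns_aux hW J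
  have h0 : (pathWeight W d 0 : ℝ≥0∞) ≠ 0 := by exact_mod_cast (pathWeight_pos hW d 0).ne'
  simp only [h2, Finset.coe_univ, Set.preimage_univ, measure_univ, div_eq_mul_inv,
    ← Finset.sum_mul] at h
  rw [← div_eq_mul_inv] at h
  rw [tapeLaw_randSigns_aux hW, Nat.cast_sum,
    (ENNReal.div_eq_one_iff h0 (ENNReal.natCast_ne_top _)).1 h]

/-! ### The law of the Sum sampler -/

/-- The number of random reals used by `sliceSeq`. -/
def numDraws : ℕ → ℕ
  | 0 => 0
  | n + 1 => 1 + numDraws n + (n + 1)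

/-- A random point of the slice `k` of the cube of dimension `n`, followed by the coordinate that
makes the sum equal to `k`, computed from the random reals `x`. -/
def sliceSeq : ℕ → ℕ → (ℕ → ℝ) → ℕ → ℝ
  | 0, _, _ => fun _ => 1
  | n + 1, k, x =>
    let i := pickIdx (fun q => eul n (k - facetBit k q)) (n + 2) (x 0)
    coneSeq k i (runMax (fun q => x (1 + numDraws n + q)) (n + 1))
      (sliceSeq n (k - facetBit k i) fun q => x (1 + q))

lemma insSeq_congr {α : Type*} {N p : ℕ} (hp : p ≤ N) (c : α) {y z : ℕ → α}
    (h : ∀ q < N, y q = z q) {q : ℕ} (hq : q ≤ N) : insSeq p c y q = insSeq p c z q := by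
  unfold insSeq
  split_ifs with h1 h2
  · exact h q (by omega)
  · rfl
  · exact h (q - 1) (by omega)

lemma coneSeq_congr {N k i : ℕ} (hi : i ≤ N) (t : ℝ) {y z : ℕ → ℝ} (h : ∀ q < N, y q = z q)
    {q : ℕ} (hq : q ≤ N) : coneSeq k i t y q = coneSeq k i t z q := by
  rw [coneSeq, coneSeq, facetSeq, facetSeq, insSeq_congr hi _ h hq]

lemma measurable_pickIdx_tape (w : ℕ → ℕ) (n i : ℕ) :
    Measurable fun ω : Tape => pickIdx w n (ω i) :=
  (measurable_pickIdx w n).comp (by fun_prop)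

lemma measurable_coneSeq {Ω : Type*} [MeasurableSpace Ω] {t : Ω → ℝ} {y : Ω → ℕ → ℝ}
    (ht : Measurable t) (hy : ∀ q, Measurable fun ω => y ω q) (k i q : ℕ) :
    Measurable fun ω => coneSeq k i (t ω) (y ω) q := by
  refine measurable_const.add (ht.mul (Measurable.sub ?_ measurable_const))
  unfold facetSeq insSeq
  split_ifs
  · exact hy q
  · exact measurable_const
  · exact hy (q - 1)

lemma measurable_sliceSeq (n k q : ℕ) :
    Measurable fun ω : Tape => sliceSeq n k (fun q => ω q) q := by
  induction n generalizing k q with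
  | zero => exact measurable_const
  | succ n ih =>
    refine measurable_apply_countable (h := fun i (ω : Tape) => coneSeq k i
      (runMax (fun q => ω (1 + numDraws n + q)) (n + 1))
      (sliceSeq n (k - facetBit k i) fun q => ω (1 + q)) q)
      (measurable_pickIdx_tape (fun q => eul n (k - facetBit k q)) (n + 2) 0) fun i => ?_
    exact measurable_coneSeq (measurable_runMax _ (by fun_prop) _)
      (fun q => (ih (k - facetBit k i) q).comp (measurable_shift 1)) k i q

lemma runMax_congr {x y : ℕ → ℝ} {n : ℕ} (h : ∀ q < n, x q = y q) : runMax x n = runMax y n := by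
  induction n with
  | zero => rfl
  | succ n ih => rw [runMax, runMax, ih fun q hq => h q (by omega), h n (by omega)]

lemma sliceSeq_congr {n k : ℕ} {x y : ℕ → ℝ} (h : ∀ q < numDraws n, x q = y q) :
    sliceSeq n k x = sliceSeq n k y := by
  induction n generalizing k x y with
  | zero => rfl
  | succ n ih =>
    have hn : numDraws (n + 1) = 1 + numDraws n + (n + 1) := rfl
    rw [sliceSeq, sliceSeq]
    rw [h 0 (by omega), runMax_congr (x := fun q => x (1 + numDraws n + q))
      (y := fun q => y (1 + numDraws n + q)) fun q hq => h _ (by omega),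
      ih (x := fun q => x (1 + q)) (y := fun q => y (1 + q)) fun q hq => h _ (by omega)]

/-- A point of the slice as a vector that includes the last coordinate. -/
def sliceVec (n k : ℕ) (ω : Tape) : Fin (n + 1) → ℝ := fun q => sliceSeq n k (fun q => ω q) q

lemma measurable_sliceVec (n k : ℕ) : Measurable (sliceVec n k) :=
  measurable_pi_iff.2 fun q => measurable_sliceSeq n k q

lemma dependsOnFirst_sliceVec (n k : ℕ) : DependsOnFirst (numDraws n) (sliceVec n k) := by
  intro a b h
  unfold sliceVec
  rw [sliceSeq_congr (y := fun q => (b q : ℝ)) fun q hq => by rw [h q hq]]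

lemma pos_of_eul_pos {n k : ℕ} (h : 0 < eul n k) : 1 ≤ k := by
  rcases k with _ | k
  · simp at h
  · omega

lemma le_of_eul_pos {n k : ℕ} (hn : 1 ≤ n) (h : 0 < eul n k) : k ≤ n := by
  by_contra hc
  rw [eul_eq_zero (by omega) hn] at h
  omega

lemma measurable_coneVec (n k i : ℕ) :
    Measurable fun p : ℝ × (Fin (n + 1) → ℝ) => fun q : Fin (n + 2) => coneSeq k i p.1 (pad p.2) q :=
  measurable_pi_iff.2 fun q => measurable_coneSeq measurable_fst
    (fun q => ((measurable_pi_apply q).comp (measurable_pad (n + 1))).comp measurable_snd) k i q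

lemma coneSeq_pad {n k i : ℕ} (hi : i ≤ n + 1) (t : ℝ) (y : ℕ → ℝ) (q : Fin (n + 2)) :
    coneSeq k i t (pad fun q : Fin (n + 1) => y q) q = coneSeq k i t y q :=
  coneSeq_congr hi t (fun q hq => by simp [pad, hq]) (by omega)

lemma div_mul_div_cancel_left_natCast {a : ℕ} (ha : 0 < a) (b c : ℝ≥0∞) :
    (a : ℝ≥0∞) / b * (c / a) = c / b := by
  have h : (a : ℝ≥0∞) ≠ 0 := by exact_mod_cast ha.ne'
  calc (a : ℝ≥0∞) / b * (c / a) = a * (a : ℝ≥0∞)⁻¹ * (c / b) := by simp only [div_eq_mul_inv]; ring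
    _ = c / b := by rw [ENNReal.mul_inv_cancel h (ENNReal.natCast_ne_top _), one_mul]

/-- The law of a random point of the slice. -/
lemma lintegral_sliceVec {n k : ℕ} (hk : 0 < eul n k) {G : (Fin (n + 1) → ℝ) → ℝ≥0∞}
    (hG : Measurable G) :
    ∫⁻ ω, G (sliceVec n k ω) ∂tapeLaw =
      (n.factorial : ℝ≥0∞) / eul n k *
        ∫⁻ w in hslice n k, G fun q => homSeq (k : ℝ) w q := by
  induction n generalizing k with
  | zero =>
    have h1 : k = 1 := by
      rw [eul_zero_left] at hk
      by_contra h
      simp [h] at hk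
    subst h1
    have h2 : ∀ w : Fin 0 → ℝ, (fun q : Fin 1 => homSeq ((1 : ℕ) : ℝ) w q) = fun _ => 1 := by
      intro w; funext q; simp [homSeq]
    have h3 : hslice 0 1 = Set.univ := by ext w; simp [hslice]
    have h4 : ∀ ω, sliceVec 0 1 ω = fun _ => 1 := fun ω => rfl
    simp only [h2, h3, h4, eul_zero_left, lintegral_const, measure_univ, Measure.restrict_univ,
      volume_univ_fin_zero]
    simp
  | succ n ih =>
    have hk1 := pos_of_eul_pos hk
    have hkn : k ≤ n + 1 := le_of_eul_pos (by omega) hk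
    have hsum := sum_eul_facet hkn
    set w : ℕ → ℕ := fun q => eul n (k - facetBit k q) with hw
    let T : ℕ → ℝ × (Fin (n + 1) → ℝ) → Fin (n + 2) → ℝ := fun i p q =>
      coneSeq k i p.1 (pad p.2) q
    have hT : ∀ i, Measurable (T i) := fun i => measurable_coneVec n k i
    let h : ℕ → Tape → ℝ≥0∞ := fun i ω =>
      G (T i (runMax (fun q => shift (numDraws n) ω q) (n + 1), sliceVec n (k - facetBit k i) ω))
    have hR : Measurable fun ω : Tape => runMax (fun q => (ω q : ℝ)) (n + 1) :=
      measurable_runMax _ (by fun_prop) _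
    have hh : ∀ i, Measurable (h i) := fun i => by
      exact hG.comp ((hT i).comp ((hR.comp (measurable_shift (numDraws n))).prodMk
        (measurable_sliceVec n (k - facetBit k i))))
    have hpick : ∀ ω : Tape, pickIdx w (n + 2) (ω 0) ∈ Finset.range (n + 2) := fun ω =>
      Finset.mem_range.2 (pickIdx_lt w (by omega) _)
    have e1 : ∀ ω : Tape, G (sliceVec (n + 1) k ω) = h (pickIdx w (n + 2) (ω 0)) (shift 1 ω) := by
      intro ω
      have hi := Finset.mem_range.1 (hpick ω)
      refine congrArg G (funext fun q => ?_)
      refine Eq.trans ?_ (coneSeq_pad (by omega) _ _ q).symm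
      simp only [sliceVec, sliceSeq, shift, ← hw, add_assoc]
    simp only [e1]
    rw [lintegral_apply_shift (n := 1) (fun a b hab => by rw [hab 0 (by omega)])
      (measurable_pickIdx_tape w (n + 2) 0) hpick hh,
      setLIntegral_hslice_succ hk1 hkn (g := fun w => G fun q => homSeq (k : ℝ) w q)
        (hG.comp (measurable_pi_iff.2 fun q => measurable_homSeq _ _)), Finset.mul_sum]
    refine Finset.sum_congr rfl fun i hi => ?_
    have hi := Finset.mem_range.1 hi
    rw [tapeLaw_pickIdx hi (by rw [hw, hsum]; exact hk)]
    have hwi : (∑ q ∈ Finset.range (n + 2), w q) = eul (n + 1) k := hsum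
    rw [hwi]
    -- A facet of weight zero has a null parameter set, so its terms vanish on both sides; the
    -- induction hypothesis requires a positive weight.
    rcases Nat.eq_zero_or_pos (w i) with h0 | hpos
    · have hempty : volume (hslice n (k - facetBit k i)) = 0 := by
        rw [volume_hslice, show eul n (k - facetBit k i) = 0 from h0]; simp
      simp [h0, Measure.restrict_eq_zero.2 hempty]
    · have hH : Measurable fun p : (Fin (n + 1) → ℝ) × ℝ => G (T i (p.2, p.1)) :=
        hG.comp ((hT i).comp measurable_swap)
      -- The recursive point reads the first `numDraws n` reals and the maximum only later ones, so
      -- the two are independent.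
      have e2 : ∫⁻ ω, h i ω ∂tapeLaw =
          ∫⁻ t, ∫⁻ ω, G (T i (t, sliceVec n (k - facetBit k i) ω)) ∂tapeLaw
            ∂(tapeLaw.map fun ω : Tape => runMax (fun q => (ω q : ℝ)) (n + 1)) := by
        have hmap := map_pair_shift (dependsOnFirst_sliceVec n (k - facetBit k i))
          (measurable_sliceVec n (k - facetBit k i)) hR
        have h5 : ∫⁻ ω, h i ω ∂tapeLaw = ∫⁻ p, G (T i (p.2, p.1)) ∂(tapeLaw.map fun ω =>
            (sliceVec n (k - facetBit k i) ω,
              runMax (fun q => (shift (numDraws n) ω q : ℝ)) (n + 1))) := by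
          have hpair : Measurable fun ω => (sliceVec n (k - facetBit k i) ω,
              runMax (fun q => (shift (numDraws n) ω q : ℝ)) (n + 1)) :=
            (measurable_sliceVec _ _).prodMk (hR.comp (measurable_shift (numDraws n)))
          exact (lintegral_map hH hpair).symm
        have : IsProbabilityMeasure (tapeLaw.map fun ω : Tape =>
          runMax (fun q => (ω q : ℝ)) (n + 1)) := Measure.isProbabilityMeasure_map hR.aemeasurable
        have : IsProbabilityMeasure (tapeLaw.map (sliceVec n (k - facetBit k i))) :=
          Measure.isProbabilityMeasure_map (measurable_sliceVec _ _).aemeasurable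
        rw [h5]
        rw [hmap, lintegral_prod_symm _ hH.aemeasurable]
        refine lintegral_congr fun t => ?_
        exact lintegral_map (f := fun y => G (T i (t, y))) (hH.comp measurable_prodMk_right)
          (measurable_sliceVec _ _)
      have e3 : ∀ t, ∫⁻ ω, G (T i (t, sliceVec n (k - facetBit k i) ω)) ∂tapeLaw =
          (n.factorial : ℝ≥0∞) / w i * ∫⁻ y in hslice n (k - facetBit k i),
            G fun q => homSeq (k : ℝ) (slicePt n k i t y) q := by
        intro t
        refine (ih hpos (G := fun y => G (T i (t, y)))
          (hG.comp ((hT i).comp measurable_prodMk_left))).trans ?_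
        congr 2
        funext y
        refine congrArg G (funext fun q => ?_)
        rw [homSeq_slicePt hk1 hkn (by omega) t y (by omega)]
        exact coneSeq_pad (k := k) (Nat.le_of_lt_succ hi) t
          (homSeq ((k - facetBit k i : ℕ) : ℝ) y) q
      have hmeas : Measurable fun t => ∫⁻ y in hslice n (k - facetBit k i),
          G fun q => homSeq (k : ℝ) (slicePt n k i t y) q := by
        have h6 : Measurable fun p : ℝ × (Fin n → ℝ) =>
            G fun q : Fin (n + 2) => homSeq (k : ℝ) (slicePt n k i p.1 p.2) q := by
          refine hG.comp (measurable_pi_iff.2 fun q => (measurable_homSeq _ _).comp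
            (measurable_pi_iff.2 fun r => ?_))
          exact measurable_coneSeq measurable_fst
            (fun q => (measurable_homSeq _ q).comp measurable_snd) k i r
        exact h6.lintegral_prod_right'
      rw [e2]
      simp only [e3]
      rw [lintegral_map (hmeas.const_mul _) hR,
        lintegral_runMax n (hmeas.const_mul _)]
      have hw0 : (w i : ℝ≥0∞) ≠ 0 := by exact_mod_cast hpos.ne'
      -- The weight `w i` cancels between the probability of the facet and the normalisation of the
      -- recursive point; the factor `n + 1` of the law of the maximum completes the factorial.
      have hc : (w i : ℝ≥0∞) / eul (n + 1) k * (((n + 1 : ℕ) : ℝ≥0∞) * (n.factorial / w i)) =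
          ((n + 1).factorial : ℝ≥0∞) / eul (n + 1) k := by
        rw [Nat.factorial_succ, Nat.cast_mul, ← mul_div_assoc,
          div_mul_div_cancel_left_natCast hpos]
      have hne : (n.factorial : ℝ≥0∞) / w i ≠ ∞ := ENNReal.div_ne_top (by simp) hw0
      rw [← hc, mul_assoc, mul_assoc, ← lintegral_const_mul' _ _ hne]
      congr 2
      refine lintegral_congr fun t => ?_
      ring

/-- The slice from which the Sum sampler draws. -/
def sliceIdx (m κ mode : ℕ) (u : ℝ) : ℕ :=
  if mode = 0 then pickIdx (eul m) (min κ m + 1) u else min κ m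

/-- The output of the Sum sampler. -/
def sumSeq (m κ mode : ℕ) (x : ℕ → ℝ) : ℕ → ℝ :=
  sliceSeq m (sliceIdx m κ mode (x 0)) fun q => x (1 + q)

/-- The output of the Sum sampler as a vector. -/
def sumVec (m κ mode : ℕ) (ω : Tape) : Fin m → ℝ := fun i => sumSeq m κ mode (fun q => ω q) i

lemma measurable_sumVec (m κ mode : ℕ) : Measurable (sumVec m κ mode) := by
  refine measurable_pi_iff.2 fun i => ?_
  refine measurable_apply_countable (f := fun ω : Tape => sliceIdx m κ mode (ω 0))
    (h := fun b (ω : Tape) => sliceSeq m b (fun q => ω (1 + q)) i) ?_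
    fun b => (measurable_sliceSeq m b i).comp (measurable_shift 1)
  unfold sliceIdx
  split_ifs
  · exact measurable_pickIdx_tape _ _ _
  · exact measurable_const

lemma lintegral_slice {m b : ℕ} (hb : 0 < eul m b) {g : (Fin m → ℝ) → ℝ≥0∞} (hg : Measurable g) :
    ∫⁻ ω, g (fun i => sliceSeq m b (fun q => (ω : Tape) q) i) ∂tapeLaw =
      (m.factorial : ℝ≥0∞) / eul m b * ∫⁻ w in hslice m b, g w := by
  have h := lintegral_sliceVec hb (G := fun y => g fun i => y i.castSucc)
    (hg.comp (measurable_pi_iff.2 fun i => measurable_pi_apply _))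
  refine h.trans ?_
  congr 2
  funext w
  congr 1
  funext i
  simp [homSeq]

/-- The law of the output of the Sum sampler. -/
theorem map_sumVec {m κ mode : ℕ}
    (h : if mode = 0 then m = 0 ∨ 1 ≤ κ else 1 ≤ κ ∧ κ ≤ m) :
    tapeLaw.map (sumVec m κ mode) = cond volume (sumRegion m κ mode) := by
  rcases Nat.eq_zero_or_pos m with rfl | hm
  · have h0 : mode = 0 := by
      by_contra hc
      rw [if_neg hc] at h
      omega
    have h1 : sumRegion 0 κ mode = Set.univ := by
      ext x; simp [sumRegion, h0, posPart]
    -- In dimension `0` there is only one vector, so both sides are the same point mass.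
    have : IsProbabilityMeasure (volume : Measure (Fin 0 → ℝ)) := ⟨volume_univ_fin_zero⟩
    rw [h1, ProbabilityTheory.cond_univ]
    ext s _
    rcases s.eq_empty_or_nonempty with rfl | hs
    · simp
    · rw [Subsingleton.eq_univ_of_nonempty hs, volume_univ_fin_zero,
        Measure.map_apply (measurable_sumVec _ _ _) MeasurableSet.univ]
      simp
  · refine Measure.ext_of_lintegral _ fun g hg => ?_
    rw [lintegral_map hg (measurable_sumVec m κ mode), lintegral_cond, sumRegion]
    have hmeas : ∀ b, Measurable fun ω : Tape => g fun i => sliceSeq m b (fun q => ω q) i :=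
      fun b => hg.comp (measurable_pi_iff.2 fun i => measurable_sliceSeq m b i)
    split_ifs at h ⊢ with h0
    · have hκ : 1 ≤ κ := by omega
      have hT : ∑ q ∈ Finset.range (min κ m + 1), eul m q = eulerianSum m κ := by
        rw [← eulerianSum_eq]
        rcases le_total κ m with h | h
        · rw [min_eq_left h]
        · rw [min_eq_right h, eulerianSum_of_ge le_rfl hm h]
      have hTpos := eulerianSum_pos m hκ
      have e1 : ∀ ω, g (sumVec m κ mode ω) = (fun b ω => g fun i =>
          sliceSeq m b (fun q => (ω : Tape) q) i)
          (pickIdx (eul m) (min κ m + 1) (ω 0)) (shift 1 ω) := by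
        intro ω
        show g (fun i : Fin m => sliceSeq m (sliceIdx m κ mode (ω 0)) (fun q => ω (1 + q)) i) = _
        rw [sliceIdx, if_pos h0]
        rfl
      simp only [e1]
      rw [lintegral_apply_shift (n := 1) (s := Finset.range (min κ m + 1))
        (fun a b hab => by rw [hab 0 (by omega)])
        (measurable_pickIdx_tape _ _ 0) (fun ω => Finset.mem_range.2 (pickIdx_lt _ (by omega) _))
        hmeas, volume_posPart hκ, setLIntegral_posPart hκ]
      -- The slices with index above `m` are empty, so it is enough to choose among the first `min κ
      -- m`.
      have e2 : ∑ b ∈ Finset.range (κ + 1), ∫⁻ x in hslice m b, g x =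
          ∑ b ∈ Finset.range (min κ m + 1), ∫⁻ x in hslice m b, g x := by
        refine (Finset.sum_subset (Finset.range_mono (by omega)) fun b hb hb' => ?_).symm
        rw [hslice_of_lt hm (by simp at hb hb'; omega)]
        simp
      rw [e2, Finset.mul_sum]
      refine Finset.sum_congr rfl fun b hb => ?_
      rw [tapeLaw_pickIdx (Finset.mem_range.1 hb) (by rw [hT]; exact hTpos), hT]
      rcases Nat.eq_zero_or_pos (eul m b) with hb0 | hbpos
      · have hempty : volume (hslice m b) = 0 := by
          rw [volume_hslice, hb0]; simp
        simp [hb0, Measure.restrict_eq_zero.2 hempty]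
      · have hb1 : (eul m b : ℝ≥0∞) ≠ 0 := by exact_mod_cast hbpos.ne'
        rw [lintegral_slice hbpos hg, ← mul_assoc]
        congr 1
        rw [ENNReal.ofReal_div_of_pos (by positivity), ENNReal.ofReal_natCast,
          ENNReal.ofReal_natCast, ENNReal.inv_div (by simp) (by simp [Nat.factorial_ne_zero]),
          div_mul_div_cancel_left_natCast hbpos]
    · have hpos := eul_pos h.1 h.2
      have e1 : ∀ ω, g (sumVec m κ mode ω) = (fun ω => g fun i =>
          sliceSeq m κ (fun q => (ω : Tape) q) i) (shift 1 ω) := by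
        intro ω
        show g (fun i : Fin m => sliceSeq m (sliceIdx m κ mode (ω 0)) (fun q => ω (1 + q)) i) = _
        rw [sliceIdx, if_neg h0, min_eq_left h.2]
        rfl
      -- In slice mode the first real is not used; it is dropped by regarding it as a choice with a
      -- single outcome.
      have e3 := lintegral_apply_shift (n := 1) (f := fun _ : Tape => ()) (s := {()})
        (fun a b hab => rfl) measurable_const (fun ω => by simp) (fun _ => hmeas κ)
      simp only [e1]
      rw [e3, volume_slice hm, ← setLIntegral_congr (openSlice_ae_eq_slice hm κ),
        setLIntegral_congr (openSlice_ae_eq_hslice hm κ)]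
      simp only [Finset.sum_singleton]
      rw [lintegral_slice hpos hg, ENNReal.ofReal_div_of_pos (by positivity),
        ENNReal.ofReal_natCast, ENNReal.ofReal_natCast,
        ENNReal.inv_div (by simp) (by simp [Nat.factorial_ne_zero])]
      simp

/-! ### Reasoning about programs -/

/-- The arrays of naturals that a program may write. -/
def Prog.wN : Prog → List ℕ
  | .setN a _ _ => [a]
  | .seq p q => p.wN ++ q.wN
  | .ite _ p q => p.wN ++ q.wN
  | .loop _ p => p.wN
  | _ => []

/-- The arrays of reals that a program may write. -/
def Prog.wR : Prog → List ℕ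
  | .setR a _ _ => [a]
  | .draw a _ => [a]
  | .seq p q => p.wR ++ q.wR
  | .ite _ p q => p.wR ++ q.wR
  | .loop _ p => p.wR
  | _ => []

/-- Whether a program may use random reals. -/
def Prog.draws : Prog → Bool
  | .draw _ _ => true
  | .seq p q => p.draws || q.draws
  | .ite _ p q => p.draws || q.draws
  | .loop _ p => p.draws
  | _ => false

def Prog.loopFree : Prog → Bool
  | .seq p q => p.loopFree && q.loopFree
  | .ite _ p q => p.loopFree && q.loopFree
  | .loop _ _ => false
  | _ => true

open Classical in
/-- The effect of a program without loops. -/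
def Prog.run (ω : Tape) : Prog → Store → Store
  | .skip, s => s
  | .setN a i x, s => s.setN a (i.eval s) (x.eval s)
  | .setR a i x, s => s.setR a (i.eval s) (x.eval s)
  | .draw a i, s => { s.setR a (i.eval s) (ω s.pos : ℝ) with pos := s.pos + 1 }
  | .seq p q, s => q.run ω (p.run ω s)
  | .ite b p q, s => if b.holds s then p.run ω s else q.run ω s
  | .loop _ _, s => s

/-- A bound on the running time of a program without loops. -/
def Prog.maxCost : Prog → ℕ
  | .skip => 1
  | .setN _ i x => i.cost + x.cost + 1
  | .setR _ i x => i.cost + x.cost + 1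
  | .draw _ i => i.cost + 1
  | .seq p q => p.maxCost + q.maxCost
  | .ite b p q => b.cost + (p.maxCost + q.maxCost)
  | .loop _ _ => 0

/-- The stores `s` and `s'` differ only in what the program `p` may change. -/
structure Frame (p : Prog) (s s' : Store) : Prop where
  N : ∀ a, a ∉ p.wN → s'.N a = s.N a
  R : ∀ a, a ∉ p.wR → s'.R a = s.R a
  pos : p.draws = false → s'.pos = s.pos

lemma Frame.refl (p : Prog) (s : Store) : Frame p s s := ⟨fun _ _ => rfl, fun _ _ => rfl, fun _ => rfl⟩

lemma Frame.trans {p : Prog} {s s' s'' : Store} (h : Frame p s s') (h' : Frame p s' s'') :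
    Frame p s s'' :=
  ⟨fun a ha => (h'.N a ha).trans (h.N a ha), fun a ha => (h'.R a ha).trans (h.R a ha),
    fun hp => (h'.pos hp).trans (h.pos hp)⟩

lemma Frame.mono {p q : Prog} {s s' : Store} (h : Frame p s s') (hN : p.wN ⊆ q.wN)
    (hR : p.wR ⊆ q.wR) (hd : q.draws = false → p.draws = false) : Frame q s s' :=
  ⟨fun a ha => h.N a fun h => ha (hN h), fun a ha => h.R a fun h => ha (hR h),
    fun hq => h.pos (hd hq)⟩

lemma Frame.seq_left {p q : Prog} {s s' : Store} (h : Frame p s s') : Frame (p.seq q) s s' :=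
  h.mono (List.subset_append_left _ _) (List.subset_append_left _ _) fun h =>
    (Bool.or_eq_false_iff.1 h).1

lemma Frame.seq_right {p q : Prog} {s s' : Store} (h : Frame q s s') : Frame (p.seq q) s s' :=
  h.mono (List.subset_append_right _ _) (List.subset_append_right _ _) fun h =>
    (Bool.or_eq_false_iff.1 h).2

lemma Exec.frame {ω : Tape} {p : Prog} {s s' : Store} {n : ℕ} (h : Exec ω p s n s') :
    Frame p s s' := by
  induction h with
  | skip s => exact Frame.refl _ _
  | setN s a i x =>
    refine ⟨fun b hb => ?_, fun _ _ => rfl, fun _ => rfl⟩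
    exact Function.update_of_ne (by simpa [Prog.wN] using hb) _ _
  | setR s a i x =>
    refine ⟨fun _ _ => rfl, fun b hb => ?_, fun _ => rfl⟩
    exact Function.update_of_ne (by simpa [Prog.wR] using hb) _ _
  | draw s a i =>
    refine ⟨fun _ _ => rfl, fun b hb => ?_, fun h => by simp [Prog.draws] at h⟩
    exact Function.update_of_ne (by simpa [Prog.wR] using hb) _ _
  | seq _ _ h1 h2 => exact h1.seq_left.trans h2.seq_right
  | ite_true _ _ h =>
    exact h.mono (List.subset_append_left _ _) (List.subset_append_left _ _) fun h =>
      (Bool.or_eq_false_iff.1 h).1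
  | ite_false _ _ h =>
    exact h.mono (List.subset_append_right _ _) (List.subset_append_right _ _) fun h =>
      (Bool.or_eq_false_iff.1 h).2
  | loop_true _ _ _ h1 h2 => exact (h1.mono (q := .loop _ _) (fun _ h => h) (fun _ h => h) fun h => h).trans h2
  | loop_false _ => exact Frame.refl _ _

/-- The program `p` halts within `T` steps in a store with the property `Q`. -/
def Runs (ω : Tape) (p : Prog) (s : Store) (T : ℕ) (Q : Store → Prop) : Prop :=
  ∃ n s', Exec ω p s n s' ∧ n ≤ T ∧ Q s'

lemma Runs.mono {ω : Tape} {p : Prog} {s : Store} {T T' : ℕ} {Q Q' : Store → Prop}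
    (h : Runs ω p s T Q) (hT : T ≤ T') (hQ : ∀ s', Frame p s s' → Q s' → Q' s') :
    Runs ω p s T' Q' := by
  obtain ⟨n, s', h1, h2, h3⟩ := h
  exact ⟨n, s', h1, h2.trans hT, hQ s' h1.frame h3⟩

lemma Runs.seq {ω : Tape} {p q : Prog} {s : Store} {T T' : ℕ} {Q Q' : Store → Prop}
    (h : Runs ω p s T Q) (h' : ∀ s', Frame p s s' → Q s' → Runs ω q s' T' Q') :
    Runs ω (p.seq q) s (T + T') Q' := by
  obtain ⟨n, s', h1, h2, h3⟩ := h
  obtain ⟨n', s'', h1', h2', h3'⟩ := h' s' h1.frame h3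
  exact ⟨n + n', s'', h1.seq h1', add_le_add h2 h2', h3'⟩

lemma Prog.runs_of_loopFree {p : Prog} (hp : p.loopFree = true) (ω : Tape) (s : Store) :
    Runs ω p s p.maxCost fun s' => s' = p.run ω s := by
  induction p generalizing s with
  | skip => exact ⟨_, _, .skip s, le_rfl, rfl⟩
  | setN a i x => exact ⟨_, _, .setN s a i x, le_rfl, rfl⟩
  | setR a i x => exact ⟨_, _, .setR s a i x, le_rfl, rfl⟩
  | draw a i => exact ⟨_, _, .draw s a i, le_rfl, rfl⟩
  | seq p q ihp ihq =>
    obtain ⟨h1, h2⟩ := (Bool.and_eq_true_iff.1 hp : _ ∧ _)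
    refine (ihp h1 s).seq fun s' _ h => ?_
    subst h
    exact ihq h2 _
  | ite b p q ihp ihq =>
    obtain ⟨h1, h2⟩ := (Bool.and_eq_true_iff.1 hp : _ ∧ _)
    by_cases hb : b.holds s
    · obtain ⟨n, s', h3, h4, rfl⟩ := ihp h1 s
      exact ⟨_, _, .ite_true hb h3, by simp only [Prog.maxCost]; omega, by simp [Prog.run, hb]⟩
    · obtain ⟨n, s', h3, h4, rfl⟩ := ihq h2 s
      exact ⟨_, _, .ite_false hb h3, by simp only [Prog.maxCost]; omega, by simp [Prog.run, hb]⟩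
  | loop b p _ => simp [Prog.loopFree] at hp

lemma Runs.of_run {ω : Tape} {p : Prog} (hp : p.loopFree = true) {s : Store} {Q : Store → Prop}
    (h : Q (p.run ω s)) : Runs ω p s p.maxCost Q :=
  (p.runs_of_loopFree hp ω s).mono le_rfl fun _ _ hs => hs ▸ h

/-- The scalar kept in cell `0` of an array. -/
abbrev nv (a : ℕ) : NExpr := .get a (.lit 0)

/-- The real scalar kept in cell `0` of an array. -/
abbrev rv (a : ℕ) : RExpr := .get a (.lit 0)

/-- The loop `for v = 0, …, e - 1`. -/
def forN (v : ℕ) (e : NExpr) (p : Prog) : Prog :=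
  (Prog.setN v (.lit 0) (.lit 0)).seq
    (.loop (.ltN (nv v) e) (p.seq (.setN v (.lit 0) ((nv v).add (.lit 1)))))

@[simp] lemma mem_wN_forN {v : ℕ} {e : NExpr} {p : Prog} {a : ℕ} :
    a ∈ (forN v e p).wN ↔ a = v ∨ a ∈ p.wN := by
  simp [forN, Prog.wN]
  tauto

@[simp] lemma mem_wR_forN {v : ℕ} {e : NExpr} {p : Prog} {a : ℕ} :
    a ∈ (forN v e p).wR ↔ a ∈ p.wR := by
  simp [forN, Prog.wR]

@[simp] lemma draws_forN {v : ℕ} {e : NExpr} {p : Prog} : (forN v e p).draws = p.draws := by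
  simp [forN, Prog.draws]

lemma Store.setN_N_of_ne {s : Store} {a b i x : ℕ} (h : b ≠ a) : (s.setN a i x).N b = s.N b :=
  Function.update_of_ne h _ _

lemma Store.setN_N_self {s : Store} {a i x : ℕ} : (s.setN a i x).N a i = x := by
  simp [Store.setN]

@[simp] lemma Store.setN_R {s : Store} {a i x : ℕ} : (s.setN a i x).R = s.R := rfl

@[simp] lemma Store.setN_pos {s : Store} {a i x : ℕ} : (s.setN a i x).pos = s.pos := rfl

lemma frame_setN {p : Prog} {s : Store} {v i x : ℕ} (hv : v ∈ p.wN) : Frame p s (s.setN v i x) :=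
  ⟨fun _ ha => Store.setN_N_of_ne fun h => ha (h ▸ hv), fun _ _ => rfl, fun _ => rfl⟩

/-- Induction on the number `l` of remaining rounds. The body must not write the counter, and
nothing that the loop writes may change the bound `e`; the frames express this. The test costs
`e.cost + 3` and the increment `6`, hence the `9` per round. -/
lemma Runs.loop {ω : Tape} {v : ℕ} {e : NExpr} {p : Prog} {s₀ : Store} {m T : ℕ}
    {I : ℕ → Store → Prop} (hv : v ∉ p.wN)
    (he : ∀ s, Frame (forN v e p) s₀ s → e.eval s = m)
    (hstep : ∀ i < m, ∀ s, Frame (forN v e p) s₀ s → s.N v 0 = i → I i s →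
      Runs ω p s T fun s' => I (i + 1) (s'.setN v 0 (i + 1)))
    (l : ℕ) : ∀ i s, i + l = m → Frame (forN v e p) s₀ s → s.N v 0 = i → I i s →
      Runs ω (.loop (.ltN (nv v) e) (p.seq (.setN v (.lit 0) ((nv v).add (.lit 1))))) s
        (l * (T + e.cost + 9) + e.cost + 3) (I m) := by
  induction l with
  | zero =>
    intro i s hi hF h0 hI
    refine ⟨_, s, .loop_false ?_, ?_, ?_⟩
    · simp [Test.holds, NExpr.eval, he s hF, h0]; omega
    · simp [Test.cost, NExpr.cost]; omega
    · simpa [← hi] using hI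
  | succ l ih =>
    intro i s hi hF h0 hI
    obtain ⟨n, s', h1, h2, h3⟩ := hstep i (by omega) s hF h0 hI
    have hv' : s'.N v 0 = i := by rw [h1.frame.N v hv, h0]
    have h4 := Exec.setN (ω := ω) s' v (.lit 0) ((nv v).add (.lit 1))
    simp only [NExpr.eval, hv'] at h4
    have hF' : Frame (forN v e p) s₀ (s'.setN v 0 (i + 1)) :=
      (hF.trans (h1.frame.mono (fun a ha => mem_wN_forN.2 (Or.inr ha))
        (fun a ha => mem_wR_forN.2 ha) fun h => draws_forN ▸ h)).trans
        (frame_setN (mem_wN_forN.2 (Or.inl rfl)))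
    obtain ⟨n', s'', h5, h6, h7⟩ := ih (i + 1) _ (by omega) hF' Store.setN_N_self h3
    refine ⟨_, s'', .loop_true ?_ (h1.seq h4) h5, ?_, h7⟩
    · simp [Test.holds, NExpr.eval, he s hF, h0]; omega
    · simp only [Test.cost, NExpr.cost]
      rw [Nat.succ_mul]
      omega

lemma Runs.forN {ω : Tape} {v : ℕ} {e : NExpr} {p : Prog} {s₀ : Store} {m T : ℕ}
    (I : ℕ → Store → Prop) (hv : v ∉ p.wN)
    (he : ∀ s, Frame (CountBall.forN v e p) s₀ s → e.eval s = m)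
    (h0 : I 0 (s₀.setN v 0 0))
    (hstep : ∀ i < m, ∀ s, Frame (CountBall.forN v e p) s₀ s → s.N v 0 = i → I i s →
      Runs ω p s T fun s' => I (i + 1) (s'.setN v 0 (i + 1))) :
    Runs ω (CountBall.forN v e p) s₀ ((T + e.cost + 9) * (m + 1)) (I m) := by
  have h1 : Runs ω (Prog.setN v (.lit 0) (.lit 0)) s₀ 3 fun s => s = s₀.setN v 0 0 :=
    ⟨_, _, .setN s₀ v _ _, by simp [NExpr.cost], rfl⟩
  refine (h1.seq fun s hF hs => Runs.loop hv he hstep m 0 s (by omega) ?_ ?_ ?_).mono ?_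
    fun _ _ h => h
  · subst hs
    exact frame_setN (mem_wN_forN.2 (Or.inl rfl))
  · subst hs
    exact Store.setN_N_self
  · subst hs
    exact h0
  · ring_nf
    omega

/-! ### Filling arrays -/

lemma Runs.fillN {ω : Tape} {v a : ℕ} {e : NExpr} {p : Prog} {s₀ : Store} {m : ℕ} (f : ℕ → ℕ)
    (hp : p.loopFree = true) (hv : v ∉ p.wN) (hva : v ≠ a)
    (he : ∀ s, Frame (CountBall.forN v e p) s₀ s → e.eval s = m)
    (hf : ∀ i < m, ∀ s, Frame (CountBall.forN v e p) s₀ s → s.N v 0 = i →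
      p.run ω s = s.setN a i (f i)) :
    Runs ω (CountBall.forN v e p) s₀ ((p.maxCost + e.cost + 9) * (m + 1))
      fun s => ∀ i < m, s.N a i = f i := by
  refine Runs.forN (fun i s => ∀ q < i, s.N a q = f q) hv he (fun q hq => absurd hq (by omega))
    fun i hi s hF h0 hI => Runs.of_run hp fun q hq => ?_
  rw [hf i hi s hF h0, Store.setN_N_of_ne hva.symm]
  rcases Nat.lt_or_ge q i with h | h
  · simp [Store.setN, h.ne, hI q h]
  · obtain rfl : q = i := by omega
    exact Store.setN_N_self

lemma Runs.fillR {ω : Tape} {v a : ℕ} {e : NExpr} {p : Prog} {s₀ : Store} {m : ℕ} (f : ℕ → ℝ)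
    (hp : p.loopFree = true) (hv : v ∉ p.wN)
    (he : ∀ s, Frame (CountBall.forN v e p) s₀ s → e.eval s = m)
    (hf : ∀ i < m, ∀ s, Frame (CountBall.forN v e p) s₀ s → s.N v 0 = i →
      p.run ω s = s.setR a i (f i)) :
    Runs ω (CountBall.forN v e p) s₀ ((p.maxCost + e.cost + 9) * (m + 1))
      fun s => ∀ i < m, s.R a i = f i := by
  refine Runs.forN (fun i s => ∀ q < i, s.R a q = f q) hv he (fun q hq => absurd hq (by omega))
    fun i hi s hF h0 hI => Runs.of_run hp fun q hq => ?_
  rw [hf i hi s hF h0, Store.setN_R]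
  rcases Nat.lt_or_ge q i with h | h
  · simp [Store.setR, h.ne, hI q h]
  · obtain rfl : q = i := by omega
    simp [Store.setR]

lemma mul_add_inj {W n b n' b' : ℕ} (hb : b < W) (hb' : b' < W) (h : n * W + b = n' * W + b') :
    n = n' ∧ b = b' := by
  have h1 : (n * W + b) / W = n := by
    rw [mul_comm, Nat.mul_add_div (by omega), Nat.div_eq_of_lt hb, add_zero]
  have h2 : (n' * W + b') / W = n' := by
    rw [mul_comm, Nat.mul_add_div (by omega), Nat.div_eq_of_lt hb', add_zero]
  have : n = n' := by rw [← h1, h, h2]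
  subst this
  exact ⟨rfl, by omega⟩

/-- Filling a table row by row; only the entries with `ok n b` have to be right. -/
lemma Runs.fillTable {ω : Tape} {v v' a : ℕ} {e : NExpr} {p : Prog} {s₀ : Store} {W : ℕ}
    (f : ℕ → ℕ → ℕ) (ok : ℕ → ℕ → Prop)
    (hp : p.loopFree = true) (hv : v ∉ (CountBall.forN v' e p).wN) (hv' : v' ∉ p.wN)
    (hva : a ≠ v) (hva' : a ≠ v')
    (he : ∀ s, Frame (CountBall.forN v e (CountBall.forN v' e p)) s₀ s → e.eval s = W)
    (hf : ∀ n < W, ∀ b < W, ∀ s, Frame (CountBall.forN v e (CountBall.forN v' e p)) s₀ s →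
      s.N v 0 = n → s.N v' 0 = b →
      (∀ n' b', b' < W → (n' < n ∨ n' = n ∧ b' < b) → ok n' b' → s.N a (n' * W + b') = f n' b') →
      ∃ y, p.run ω s = s.setN a (n * W + b) y ∧ (ok n b → y = f n b)) :
    Runs ω (CountBall.forN v e (CountBall.forN v' e p)) s₀
      ((p.maxCost + 2 * e.cost + 18) * (W + 1) ^ 2)
      fun s => ∀ n < W, ∀ b < W, ok n b → s.N a (n * W + b) = f n b := by
  set prog := CountBall.forN v e (CountBall.forN v' e p) with hprog
  have hFr : ∀ {s s'}, Frame (CountBall.forN v' e p) s s' → Frame prog s s' := fun h =>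
    h.mono (fun a ha => mem_wN_forN.2 (Or.inr ha)) (fun a ha => mem_wR_forN.2 ha)
      fun h => draws_forN ▸ h
  have houter := Runs.forN (ω := ω) (v := v) (e := e) (p := CountBall.forN v' e p) (s₀ := s₀)
    (m := W) (T := (p.maxCost + e.cost + 9) * (W + 1))
    (fun n s => ∀ n' b', b' < W → n' < n → ok n' b' → s.N a (n' * W + b') = f n' b') hv he
    (fun _ _ _ h => absurd h (by omega)) fun n hn s hF h0 hI => by
      refine (Runs.forN (m := W) (T := p.maxCost) (fun b s => ∀ n' b', b' < W →
        (n' < n ∨ n' = n ∧ b' < b) → ok n' b' → s.N a (n' * W + b') = f n' b') hv'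
        (fun s' hs' => he s' (hF.trans (hFr hs')))
        (fun n' b' hb' h hok => ?_) fun b hb s' hF' h0' hI' => Runs.of_run hp ?_).mono le_rfl ?_
      · rw [Store.setN_N_of_ne hva']
        exact hI n' b' hb' (by omega) hok
      · have hn0 : s'.N v 0 = n := by rw [hF'.N v hv, h0]
        obtain ⟨y, hy, hok⟩ := hf n hn b hb s' (hF.trans (hFr hF')) hn0 h0' hI'
        rw [hy]
        intro n' b' hb' h hok'
        rw [Store.setN_N_of_ne hva']
        -- Both columns are below `W`, so equal addresses belong to equal entries; every other entry
        -- keeps its earlier value.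
        by_cases hnb : n' * W + b' = n * W + b
        · obtain ⟨rfl, rfl⟩ := mul_add_inj hb' hb hnb
          rw [Store.setN_N_self, hok hok']
        · simp only [Store.setN, Function.update_self, Function.update_of_ne hnb]
          refine hI' n' b' hb' ?_ hok'
          rcases h with h | ⟨rfl, h⟩
          · exact Or.inl h
          · exact Or.inr ⟨rfl, lt_of_le_of_ne (by omega) fun h => hnb (h ▸ rfl)⟩
      · intro s' _ h n' b' hb' hn' hok
        rw [Store.setN_N_of_ne hva]
        exact h n' b' hb' (by omega) hok
  refine houter.mono ?_ fun s' _ h n hn b hb hok => h n b hb hn hok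
  have : ((p.maxCost + e.cost + 9) * (W + 1) + e.cost + 9) * (W + 1) ≤
      ((p.maxCost + e.cost + 9) * (W + 1) + (e.cost + 9) * (W + 1)) * (W + 1) := by
    refine Nat.mul_le_mul_right _ ?_
    rw [add_assoc]
    exact Nat.add_le_add_left (Nat.le_mul_of_pos_right _ (by omega)) _
  refine this.trans (le_of_eq ?_)
  ring

/-! ### Reading the memory -/

attribute [simp] Prog.wN Prog.wR Prog.draws Prog.run NExpr.eval RExpr.eval Test.holds

@[simp] lemma Store.setN_N (s : Store) (a i x b j : ℕ) :
    (s.setN a i x).N b j = if b = a ∧ j = i then x else s.N b j := by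
  by_cases hb : b = a
  · subst hb
    by_cases hj : j = i
    · subst hj; simp [Store.setN]
    · simp [Store.setN, hj]
  · simp [Store.setN, hb]

@[simp] lemma Store.setR_R (s : Store) (a i : ℕ) (x : ℝ) (b j : ℕ) :
    (s.setR a i x).R b j = if b = a ∧ j = i then x else s.R b j := by
  by_cases hb : b = a
  · subst hb
    by_cases hj : j = i
    · subst hj; simp [Store.setR]
    · simp [Store.setR, hj]
  · simp [Store.setR, hb]

@[simp] lemma Store.setR_N (s : Store) (a i : ℕ) (x : ℝ) : (s.setR a i x).N = s.N := rfl

@[simp] lemma Store.setR_pos (s : Store) (a i : ℕ) (x : ℝ) : (s.setR a i x).pos = s.pos := rfl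

/-! ### Time bounds -/

/-- Running times are kept in the form `a * B` for a common `B`. In the program lemmas `apply
Exists.intro` leaves the constant open, and it is put together by unification with these bounds. -/
lemma bound_const (a : ℕ) {B : ℕ} (hB : 1 ≤ B) : a ≤ a * B := Nat.le_mul_of_pos_right _ hB

lemma bound_mul (a : ℕ) {x B : ℕ} (h : x ≤ B) : a * x ≤ a * B := Nat.mul_le_mul_left _ h

lemma bound_add {a b x y B : ℕ} (hx : x ≤ a * B) (hy : y ≤ b * B) : x + y ≤ (a + b) * B := by
  rw [add_mul]; exact add_le_add hx hy

lemma bound_lin (a : ℕ) {b x B : ℕ} (h : x ≤ b * B) : a * x ≤ a * b * B := by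
  rw [mul_assoc]; exact Nat.mul_le_mul_left _ h

lemma one_le_succ_sq (m : ℕ) : 1 ≤ (m + 1) ^ 2 := Nat.one_le_pow _ _ m.succ_pos

lemma bound_loop (a b c m : ℕ) : (a * (m + 1) + b + c) * (m + 1) ≤ (a + b + c) * (m + 1) ^ 2 := by
  nlinarith [Nat.zero_le (b * m * (m + 1)), Nat.zero_le (c * m * (m + 1))]

lemma bound_sq (a m : ℕ) : a * (m + 1) ≤ a * (m + 1) ^ 2 :=
  Nat.mul_le_mul_left _ (by nlinarith)

/-! ### Program fragments -/

/-- Draws an index below `e` with the weights in array `16`; the index is put into `20`. -/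
def pickProg (e : NExpr) : Prog :=
  ((Prog.setN 18 (.lit 0) (.lit 0)).seq <| (Prog.setN 19 (.lit 0) (.lit 0)).seq <|
    (Prog.setN 20 (.lit 0) (.lit 0)).seq <| Prog.draw 5 (.lit 0)).seq <|
  (forN 21 e (.setN 18 (.lit 0) ((nv 18).add (.get 16 (nv 21))))).seq <|
  forN 21 (e.sub (.lit 1)) <|
    (Prog.setN 19 (.lit 0) ((nv 19).add (.get 16 (nv 21)))).seq <|
    .ite (.ltR ((rv 5).mul (.ofNat (nv 18))) (.ofNat (nv 19))) .skip
      (.setN 20 (.lit 0) ((nv 20).add (.lit 1)))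

/-- The first loop adds up the weights and the second evaluates the comparisons of `pickIdx`. The
expression `e` has to be independent of the scratch arrays `18` to `21`. -/
lemma runs_pickProg (e : NExpr) : ∃ C, ∀ (ω : Tape) (s : Store) (n : ℕ),
    (∀ s' : Store, (∀ a, a ∉ [18, 19, 20, 21] → s'.N a = s.N a) → e.eval s' = n) →
    Runs ω (pickProg e) s (C * (n + 1)) fun s' =>
      s'.N 20 0 = pickIdx (s.N 16) n (ω s.pos) ∧ s'.pos = s.pos + 1 := by
  apply Exists.intro
  intro ω s n he
  -- The partial sums get an opaque name, so that simplification does not unfold them.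
  obtain ⟨c, hc⟩ : ∃ c : ℕ → ℕ, ∀ i, c i = ∑ q ∈ Finset.range i, s.N 16 q := ⟨_, fun _ => rfl⟩
  have c0 : c 0 = 0 := by simp [hc]
  have cs : ∀ i, c (i + 1) = c i + s.N 16 i := fun i => by rw [hc, hc, Finset.sum_range_succ]
  refine ((Runs.of_run (Q := fun s' => s'.N 18 0 = 0 ∧ s'.N 19 0 = 0 ∧ s'.N 20 0 = 0 ∧
        s'.R 5 0 = ω s.pos ∧ s'.pos = s.pos + 1) rfl ?_).seq fun s1 f1 h1 =>
      (Runs.forN (m := n) (fun i s' => s'.N 18 0 = c i ∧ s'.pos = s.pos + 1) ?_ ?_ ?_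
        fun i hi s' hf h0 hI => Runs.of_run rfl ?_).seq fun s2 f2 h2 =>
      (Runs.forN (m := n - 1) (fun i s' => s'.N 19 0 = c i ∧ s'.N 20 0 = ∑ q ∈ Finset.range i,
        (if (ω s.pos : ℝ) * (c n : ℕ) < (c (q + 1) : ℕ) then 0 else 1) ∧ s'.pos = s.pos + 1) ?_ ?_ ?_
        fun i hi s' hf h0 hI => Runs.of_run rfl ?_)).mono
      (bound_add (bound_const _ (by omega)) <| bound_add (bound_mul _ le_rfl) <|
        bound_mul _ (by omega)) ?_
  · simp
  · simp
  · intro s' hf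
    refine he s' fun a ha => ?_
    simp at ha
    simp [hf.N, f1.N, ha]
  · simp [h1, c0]
  · simp [hI, h0, hf.N, f1.N, cs]
  · simp
  · intro s' hf
    refine congrArg (· - 1) (he s' fun a ha => ?_)
    simp at ha
    simp [hf.N, f1.N, f2.N, ha]
  · simp [h1, h2, f2.N, c0]
  · have e1 : s'.R 5 0 = ω s.pos := by simp [hf.R, f2.R, h1]
    have e2 : s'.N 16 = s.N 16 := by simp [hf.N, f1.N, f2.N]
    have e3 : s'.N 18 0 = c n := by simp [hf.N, h2]
    have h4 : c i + s.N 16 i = c (i + 1) := (cs i).symm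
    by_cases h : (ω s.pos : ℝ) * (c n : ℕ) < (c (i + 1) : ℕ) <;>
      simp [hI, e1, e2, e3, h0, h4, h, Finset.sum_range_succ]
  · intro s' f h
    exact ⟨by rw [h.2.1]; simp only [pickIdx, hc], h.2.2⟩

/-- The greatest of `e` random reals; it is put into `6`. -/
def maxProg (e : NExpr) : Prog :=
  (Prog.setR 6 (.lit 0) (.ofNat (.lit 0))).seq <|
  forN 21 e <| (Prog.draw 5 (.lit 0)).seq <|
    .ite (.ltR (rv 6) (rv 5)) (.setR 6 (.lit 0) (rv 5)) .skip

lemma runs_maxProg (e : NExpr) : ∃ C, ∀ (ω : Tape) (s : Store) (n : ℕ),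
    (∀ s' : Store, (∀ a, a ≠ 21 → s'.N a = s.N a) → e.eval s' = n) →
    Runs ω (maxProg e) s (C * (n + 1)) fun s' =>
      s'.R 6 0 = runMax (fun q => ω (s.pos + q)) n ∧ s'.pos = s.pos + n := by
  apply Exists.intro
  intro ω s n he
  refine ((Runs.of_run (Q := fun s' => s'.R 6 0 = 0 ∧ s'.pos = s.pos) rfl ?_).seq fun s1 f1 h1 =>
      (Runs.forN (m := n) (fun i s' => s'.R 6 0 = runMax (fun q => ω (s.pos + q)) i ∧
        s'.pos = s.pos + i) ?_ ?_ ?_ fun i hi s' hf h0 hI => Runs.of_run rfl ?_)).mono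
      (bound_add (bound_const _ (by omega)) (bound_mul _ le_rfl)) fun _ _ h => h
  · simp
  · simp
  · intro s' hf
    refine he s' fun a ha => ?_
    simp [hf.N, f1.N, ha]
  · simp [h1, runMax]
  · by_cases h : runMax (fun q => (ω (s.pos + q) : ℝ)) i < ω (s.pos + i) <;>
      simp [runMax, hI, h, add_assoc]

/-! ### The Sum sampler -/

/-- Fills the array `10` with the numbers `eul n b` for `n, b ≤ m`, where `m` is kept in `11`. -/
def eulerTable : Prog :=
  forN 15 ((nv 11).add (.lit 1)) <| forN 17 ((nv 11).add (.lit 1)) <|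
    .ite (.ltN (nv 15) (.lit 1))
      (.setN 10 (nv 17) (((NExpr.lit 1).sub ((nv 17).sub (.lit 1))).sub ((NExpr.lit 1).sub (nv 17))))
      (.setN 10 (((nv 15).mul ((nv 11).add (.lit 1))).add (nv 17))
        (((nv 17).mul
          (.get 10 ((((nv 15).sub (.lit 1)).mul ((nv 11).add (.lit 1))).add (nv 17)))).add
        (((nv 15).sub ((nv 17).sub (.lit 1))).mul
          (.get 10 ((((nv 15).sub (.lit 1)).mul ((nv 11).add (.lit 1))).add
            ((nv 17).sub (.lit 1)))))))

lemma runs_eulerTable : ∃ C, ∀ (ω : Tape) (s : Store) (m : ℕ), s.N 11 0 = m →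
    Runs ω eulerTable s (C * (m + 1) ^ 2) fun s' =>
      ∀ n ≤ m, ∀ b ≤ m, s'.N 10 (n * (m + 1) + b) = eul n b := by
  apply Exists.intro
  intro ω s m hm
  have hle : (m + 1 + 1) ^ 2 ≤ 4 * (m + 1) ^ 2 := by nlinarith
  refine (Runs.fillTable (W := m + 1) (a := 10) eul (fun _ _ => True) rfl ?_ ?_ ?_ ?_ ?_ ?_).mono
    (bound_lin _ hle) fun s' _ h n hn b hb => h n (by omega) b (by omega) trivial
  · simp
  · simp
  · simp
  · simp
  · intro s' hf
    simp [hf.N, hm]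
  · intro n hn b hb s' hf h1 h2 hI
    have h3 : s'.N 11 0 = m := by simp [hf.N, hm]
    rcases n with _ | n
    -- With truncated subtraction this is `1` for `b = 1` and `0` otherwise, the row of dimension
    -- `0`.
    · refine ⟨1 - (b - 1) - (1 - b), by simp [h1, h2], fun _ => ?_⟩
      rw [eul_zero_left]
      split_ifs <;> omega
    · have hb1 := hI n b hb (Or.inl (by omega)) trivial
      have hb2 := hI n (b - 1) (by omega) (Or.inl (by omega)) trivial
      refine ⟨b * eul n b + (n + 1 - (b - 1)) * eul n (b - 1), ?_, fun _ => ?_⟩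
      · simp [h1, h2, h3, hb1, hb2]
      -- In column `0` the truncated `b - 1` is again `0`, and both products vanish.
      · rcases b with _ | b
        · simp
        · simp [eul_succ]

/-- Reads the arguments of the Sum sampler and computes the table. -/
def sumInit : Prog :=
  ((Prog.setN 11 (.lit 0) (.get 0 (.lit 0))).seq <|
    (Prog.setN 12 (.lit 0) ((NExpr.get 0 (.lit 1)).sub
      ((NExpr.get 0 (.lit 1)).sub (.get 0 (.lit 0))))).seq <|
    Prog.setN 13 (.lit 0) (.get 0 (.lit 2))).seq
  eulerTable

/-- The value of `sliceIdx`; it is put into `14`. -/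
def slicePick : Prog :=
  (forN 17 ((nv 12).add (.lit 1)) <| .setN 16 (nv 17)
    (.get 10 (((nv 11).mul ((nv 11).add (.lit 1))).add (nv 17)))).seq <|
  (pickProg ((nv 12).add (.lit 1))).seq <|
  .ite (.ltN (.lit 0) (nv 13)) (.setN 14 (.lit 0) (nv 12)) (.setN 14 (.lit 0) (nv 20))

/-- What is known after `sumInit`. -/
structure SumState (m κ mode : ℕ) (s : Store) : Prop where
  dim : s.N 11 0 = m
  bound : s.N 12 0 = min κ m
  mode : s.N 13 0 = mode
  table : ∀ n ≤ m, ∀ b ≤ m, s.N 10 (n * (m + 1) + b) = eul n b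

lemma SumState.congr {m κ mode : ℕ} {s s' : Store} (h : SumState m κ mode s)
    (h10 : s'.N 10 = s.N 10) (h11 : s'.N 11 = s.N 11) (h12 : s'.N 12 = s.N 12)
    (h13 : s'.N 13 = s.N 13) : SumState m κ mode s' :=
  ⟨by rw [h11, h.dim], by rw [h12, h.bound], by rw [h13, h.mode], by rw [h10]; exact h.table⟩

lemma runs_sumInit : ∃ C, ∀ (ω : Tape) (s : Store) (m κ mode : ℕ), HasArgs s m κ mode →
    Runs ω sumInit s (C * (m + 1) ^ 2) fun s' => SumState m κ mode s' := by
  obtain ⟨C, hC⟩ := runs_eulerTable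
  apply Exists.intro
  intro ω s m κ mode h
  refine ((Runs.of_run (Q := fun s' => s'.N 11 0 = m ∧ s'.N 12 0 = min κ m ∧ s'.N 13 0 = mode)
    rfl ?_).seq fun s1 f1 h1 =>
    (hC ω s1 m h1.1).mono le_rfl fun s' f h2 => ?_).mono
    (bound_add (bound_const _ (one_le_succ_sq m)) le_rfl) fun _ _ h => h
  -- The truncated difference `κ - (κ - m)` is the minimum of `κ` and `m`.
  · obtain ⟨e1, e2, e3⟩ := h
    simp [e1, e2, e3]
    omega
  · exact ⟨by simp [f.N, eulerTable, h1], by simp [f.N, eulerTable, h1],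
      by simp [f.N, eulerTable, h1], h2⟩

/-- An index is drawn in both modes and ignored in slice mode, so the number of random reals that
are used does not depend on the mode. -/
lemma runs_slicePick : ∃ C, ∀ (ω : Tape) (s : Store) (m κ mode : ℕ), SumState m κ mode s →
    Runs ω slicePick s (C * (m + 1) ^ 2) fun s' =>
      SumState m κ mode s' ∧ s'.N 14 0 = sliceIdx m κ mode (ω s.pos) ∧ s'.pos = s.pos + 1 := by
  obtain ⟨C, hC⟩ := runs_pickProg ((nv 12).add (.lit 1))
  apply Exists.intro
  intro ω s m κ mode h
  have hle : min κ m + 1 + 1 ≤ 2 * (m + 1) ^ 2 := by nlinarith [min_le_right κ m]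
  refine ((Runs.fillN (a := 16) (m := min κ m + 1) (eul m) rfl ?_ ?_ ?_ ?_).seq fun s1 f1 h1 =>
    (hC ω s1 (min κ m + 1) ?_).seq fun s2 f2 h2 =>
    (Runs.of_run (Q := fun s' => s'.N 14 0 = sliceIdx m κ mode (ω s.pos) ∧ s'.pos = s.pos + 1)
      rfl ?_)).mono
    (bound_add (bound_lin _ hle) <|
      bound_add (bound_lin _ hle) <|
      bound_const _ (one_le_succ_sq m)) fun s' f h2 => ⟨?_, h2⟩
  · simp
  · simp
  · intro s' hf
    simp [hf.N, h.bound]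
  · intro i hi s' hf h0
    simp [hf.N, h.dim, h0, h.table m le_rfl i (by omega)]
  · intro s' hs'
    simp [hs', f1.N, h.bound]
  · have e1 : s1.pos = s.pos := f1.pos rfl
    have e2 : s2.N 12 0 = min κ m := by simp [f2.N, f1.N, pickProg, h.bound]
    have e3 : s2.N 13 0 = mode := by simp [f2.N, f1.N, pickProg, h.mode]
    have e4 : pickIdx (s1.N 16) (min κ m + 1) (ω s.pos) = pickIdx (eul m) (min κ m + 1) (ω s.pos) :=
      pickIdx_congr h1 _
    rcases Nat.eq_zero_or_pos mode with h0 | h0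
    · simp [e3, h0, h2, e1, e4, sliceIdx]
    · simp [e3, h0, h2, e1, e2, sliceIdx, h0.ne']
  · exact h.congr (f.N _ (by simp [pickProg])) (f.N _ (by simp [pickProg]))
      (f.N _ (by simp [pickProg])) (f.N _ (by simp [pickProg]))

/-- The slices of the recursion in `sliceSeq`, from the dimension `m` down. -/
def facetIdx (m k : ℕ) (x : ℕ → ℝ) (i : ℕ) : ℕ :=
  pickIdx (fun q => eul (m - 1 - i) (k - facetBit k q)) (m - 1 - i + 2) (x i)

/-- See `facetIdx`. -/
def curSeq (m c : ℕ) (x : ℕ → ℝ) : ℕ → ℕ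
  | 0 => c
  | i + 1 => curSeq m c x i - facetBit (curSeq m c x i) (facetIdx m (curSeq m c x i) x i)

lemma curSeq_le (m c : ℕ) (x : ℕ → ℝ) (i : ℕ) : curSeq m c x i ≤ c := by
  induction i with
  | zero => exact le_rfl
  | succ i ih => exact (Nat.sub_le _ _).trans ih

/-- One step of the unrolled recursion. All facets are picked first, from the top dimension down,
with the reals `0, …, m - 1`; the reals for the maxima follow, from dimension `1` up. So two loops
can replace the recursion. -/
lemma sliceSeq_step {m n i : ℕ} (c : ℕ) (x : ℕ → ℝ) (h : i + n + 1 = m) :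
    sliceSeq (n + 1) (curSeq m c x i) (fun r => x (i + r)) =
      coneSeq (curSeq m c x i) (facetIdx m (curSeq m c x i) x i)
        (runMax (fun q => x (i + 1 + numDraws n + q)) (n + 1))
        (sliceSeq n (curSeq m c x (i + 1)) fun r => x (i + 1 + r)) := by
  have h1 : m - 1 - i = n := by omega
  simp only [sliceSeq, curSeq, facetIdx, h1, add_zero, ← add_assoc]

/-- Chooses the facets, from the dimension `m` down. -/
def facetPicks : Prog :=
  forN 15 (nv 11) <|
    (Prog.setN 24 (.lit 0) (((nv 11).sub (.lit 1)).sub (nv 15))).seq <|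
    (forN 17 ((nv 24).add (.lit 2)) <| .setN 16 (nv 17)
      (.get 10 (((nv 24).mul ((nv 11).add (.lit 1))).add
        ((nv 14).sub ((NExpr.lit 1).sub ((nv 14).sub (nv 17))))))).seq <|
    (pickProg ((nv 24).add (.lit 2))).seq <|
    (Prog.setN 22 (nv 15) (nv 20)).seq <|
    (Prog.setN 23 (nv 15) (nv 14)).seq <|
    Prog.setN 14 (.lit 0) ((nv 14).sub ((NExpr.lit 1).sub ((nv 14).sub (nv 20))))

lemma facetBit_eq (k i : ℕ) : facetBit k i = 1 - (k - i) := by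
  unfold facetBit; split_ifs <;> omega

/-- The slice index never exceeds `c ≤ m`, which keeps every lookup inside the table. The facets and
slices are stored because the points are built in the opposite order. -/
lemma runs_facetPicks : ∃ C, ∀ (ω : Tape) (s : Store) (m κ mode c : ℕ) (x : ℕ → ℝ),
    SumState m κ mode s → s.N 14 0 = c → c ≤ m → (∀ q, x q = ω (s.pos + q)) →
    Runs ω facetPicks s (C * (m + 1) ^ 2) fun s' =>
      (∀ i < m, s'.N 22 i = facetIdx m (curSeq m c x i) x i ∧ s'.N 23 i = curSeq m c x i) ∧
        s'.pos = s.pos + m := by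
  obtain ⟨C, hC⟩ := runs_pickProg ((nv 24).add (.lit 2))
  apply Exists.intro
  intro ω s m κ mode c x h hc hcm hx
  have hle : m + 1 + 1 ≤ 2 * (m + 1) := by omega
  refine (Runs.forN (m := m) (T := _ * (m + 1)) (fun i s' => s'.N 14 0 = curSeq m c x i ∧
    s'.pos = s.pos + i ∧
    ∀ q < i, s'.N 22 q = facetIdx m (curSeq m c x q) x q ∧ s'.N 23 q = curSeq m c x q) ?_ ?_ ?_
    fun i hi s' hf h0 hI => ((Runs.of_run (Q := fun s' => s'.N 24 0 = m - 1 - i) rfl ?_).seq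
      fun s1 f1 h1 => (Runs.fillN (a := 16) (m := m - 1 - i + 2)
        (fun q => eul (m - 1 - i) (curSeq m c x i - facetBit (curSeq m c x i) q)) rfl ?_ ?_ ?_
        ?_).seq fun s2 f2 h2 => (hC ω s2 (m - 1 - i + 2) ?_).seq fun s3 f3 h3 =>
      Runs.of_run rfl ?_).mono (bound_add (bound_const _ (by omega)) <|
        bound_add (bound_lin _ (hle.trans' (by omega))) <|
        bound_add (bound_lin _ (hle.trans' (by omega))) <|
        bound_const _ (by omega)) fun _ _ h => h).mono (bound_loop _ _ _ m)
    fun s' f h => ⟨h.2.2, h.2.1⟩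
  · simp [pickProg]
  · intro s' hf
    simp [hf.N, pickProg, h.dim]
  · simp [hc, curSeq]
  · simp [hf.N, pickProg, h.dim, h0]
  · simp
  · simp
  · intro s' hf'
    simp [hf'.N, h1]
  · intro q hq s' hf' h0'
    have e1 : s'.N 11 0 = m := by simp [hf'.N, f1.N, hf.N, pickProg, h.dim]
    have e2 : s'.N 24 0 = m - 1 - i := by simp [hf'.N, h1]
    have e3 : s'.N 14 0 = curSeq m c x i := by simp [hf'.N, f1.N, hI]
    have e4 : s'.N 10 = s.N 10 := by simp [hf'.N, f1.N, hf.N, pickProg]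
    have e5 := curSeq_le m c x i
    simp [e1, e2, e3, e4, h0', ← facetBit_eq,
      h.table (m - 1 - i) (by omega) (curSeq m c x i - facetBit (curSeq m c x i) q) (by omega)]
  · intro s' hs'
    simp [hs', f2.N, h1]
  · have e1 : s2.pos = s.pos + i := by rw [f2.pos rfl, f1.pos rfl, hI.2.1]
    have e2 : s3.N 20 0 = facetIdx m (curSeq m c x i) x i := by
      rw [h3.1, e1, ← hx, facetIdx]
      exact pickIdx_congr h2 _
    have e3 : s3.N 14 0 = curSeq m c x i := by simp [f3.N, f2.N, f1.N, pickProg, hI]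
    have e4 : s3.N 15 0 = i := by simp [f3.N, f2.N, f1.N, pickProg, h0]
    have e5 : s3.N 22 = s'.N 22 := by simp [f3.N, f2.N, f1.N, pickProg]
    have e6 : s3.N 23 = s'.N 23 := by simp [f3.N, f2.N, f1.N, pickProg]
    refine ⟨by simp [e2, e3, curSeq, facetBit_eq], by simp [h3.2, e1, add_assoc], fun q hq => ?_⟩
    rcases Nat.lt_or_ge q i with h4 | h4
    · simp [e4, e5, e6, h4.ne, hI.2.2 q h4]
    · obtain rfl : q = i := by omega
      simp [e2, e3, e4]

/-- A coordinate of a point of a cone over a facet, see `coneSeq`. -/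
def coneExpr (y : RExpr) : RExpr :=
  (RExpr.ofNat ((NExpr.lit 1).sub ((NExpr.lit 1).sub ((nv 26).sub (nv 17))))).add
    ((rv 6).mul (y.sub (.ofNat ((NExpr.lit 1).sub ((NExpr.lit 1).sub ((nv 26).sub (nv 17)))))))

/-- Computes the point of the slice, from the dimension `0` up, in the real array `7`. -/
def conePoints : Prog :=
  (Prog.setR 7 (.lit 0) (.ofNat (.lit 1))).seq <|
  forN 15 (nv 11) <|
    (maxProg ((nv 15).add (.lit 1))).seq <|
    ((Prog.setN 24 (.lit 0) (((nv 11).sub (.lit 1)).sub (nv 15))).seq <|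
      (Prog.setN 25 (.lit 0) (.get 22 (nv 24))).seq <| .setN 26 (.lit 0) (.get 23 (nv 24))).seq <|
    (forN 17 ((nv 15).add (.lit 2)) <|
      .ite (.ltN (nv 17) (nv 25)) (.setR 8 (nv 17) (coneExpr (.get 7 (nv 17)))) <|
      .ite (.ltN (nv 25) (nv 17)) (.setR 8 (nv 17) (coneExpr (.get 7 ((nv 17).sub (.lit 1))))) <|
      .setR 8 (nv 17) (coneExpr (.ofNat ((NExpr.lit 1).sub ((nv 26).sub (nv 25)))))).seq <|
    forN 17 ((nv 15).add (.lit 2)) <| .setR 7 (nv 17) (.get 8 (nv 17))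

lemma apex_eq (k q : ℕ) : apex k q = ((1 - (1 - (k - q)) : ℕ) : ℝ) := by
  unfold apex
  split_ifs with h
  · rw [show 1 - (1 - (k - q)) = 1 by omega, Nat.cast_one]
  · rw [show 1 - (1 - (k - q)) = 0 by omega, Nat.cast_zero]

lemma le_numDraws (n : ℕ) : n ≤ numDraws n := by
  induction n with
  | zero => exact le_rfl
  | succ n ih => rw [numDraws]; omega

/-- After `n` rounds array `7` holds the point of dimension `n` of the recursion. Of its `numDraws
n` reals, `n` are facet picks drawn earlier, so `numDraws n - n` have been consumed here. The new
point needs the old entries at `q` and `q - 1`, so it is built in array `8` and copied back. -/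
lemma runs_conePoints : ∃ C, ∀ (ω : Tape) (s : Store) (m c : ℕ) (x : ℕ → ℝ), s.N 11 0 = m →
    (∀ i < m, s.N 22 i = facetIdx m (curSeq m c x i) x i ∧ s.N 23 i = curSeq m c x i) →
    (∀ q, x (m + q) = ω (s.pos + q)) →
    Runs ω conePoints s (C * (m + 1) ^ 2) fun s' =>
      (∀ q ≤ m, s'.R 7 q = sliceSeq m c x q) ∧ s'.pos = s.pos + (numDraws m - m) := by
  obtain ⟨C, hC⟩ := runs_maxProg ((nv 15).add (.lit 1))
  apply Exists.intro
  intro ω s m c x hm hs hx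
  refine ((Runs.of_run (Q := fun s' => s'.R 7 0 = 1) rfl ?_).seq fun s0 f0 h0 =>
    (Runs.forN (m := m) (T := _ * (m + 1)) (fun n s' => s'.pos = s.pos + (numDraws n - n) ∧
      ∀ q ≤ n, s'.R 7 q = sliceSeq n (curSeq m c x (m - n)) (fun r => x (m - n + r)) q) ?_ ?_ ?_
      fun n hn s' hf h15 hI => ((hC ω s' (n + 1) ?_).seq fun s1 f1 h1 =>
        (Runs.of_run (Q := fun s' => s'.N 25 0 = facetIdx m (curSeq m c x (m - 1 - n)) x (m - 1 - n) ∧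
          s'.N 26 0 = curSeq m c x (m - 1 - n)) rfl ?_).seq fun s2 f2 h2 =>
        (Runs.fillR (a := 8) (m := n + 2) (sliceSeq (n + 1) (curSeq m c x (m - 1 - n))
          (fun r => x (m - 1 - n + r))) rfl ?_ ?_ ?_).seq fun s3 f3 h3 =>
        (Runs.fillR (a := 7) (m := n + 2) (sliceSeq (n + 1) (curSeq m c x (m - 1 - n))
          (fun r => x (m - 1 - n + r))) rfl ?_ ?_ ?_).mono le_rfl fun s4 f4 h4 => ?_).mono
        (bound_add (bound_lin _ (b := 2) (by omega)) <| bound_add (bound_const _ (by omega)) <|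
          bound_add (bound_lin _ (b := 2) (by omega)) <| bound_lin _ (b := 2) (by omega))
          fun _ _ h => h)).mono
    (bound_add (bound_const _ (one_le_succ_sq m)) (bound_loop _ _ _ m)) fun s' f h => ⟨fun q hq => ?_, h.1⟩
  · simp
  · simp [maxProg]
  · intro s' hf
    simp [hf.N, f0.N, maxProg, hm]
  · refine ⟨by simp [f0.pos rfl, numDraws], fun q hq => ?_⟩
    obtain rfl : q = 0 := by omega
    simp [h0, sliceSeq]
  · intro s1 hs1
    simp [hs1, h15]
  · have e1 : s1.N 11 0 = m := by simp [f1.N, hf.N, f0.N, maxProg, hm]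
    have e2 : s1.N 15 0 = n := by simp [f1.N, maxProg, h15]
    have e3 : s1.N 22 = s.N 22 := by simp [f1.N, hf.N, f0.N, maxProg]
    have e4 : s1.N 23 = s.N 23 := by simp [f1.N, hf.N, f0.N, maxProg]
    simp [e1, e2, e3, e4, hs (m - 1 - n) (by omega)]
  · simp
  · intro s3 hf3
    simp [hf3.N, f2.N, f1.N, maxProg, h15]
  · intro q hq s3 hf3 h17
    have e0 : m - 1 - n + 1 = m - n := by omega
    have e1 : s3.N 25 0 = facetIdx m (curSeq m c x (m - 1 - n)) x (m - 1 - n) := by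
      simp [hf3.N, h2]
    have e2 : s3.N 26 0 = curSeq m c x (m - 1 - n) := by simp [hf3.N, h2]
    have e3 : s3.R 7 = s'.R 7 := by simp [hf3.R, f2.R, f1.R, maxProg]
    have e4 : s3.R 6 0 = runMax (fun q => x (m - 1 - n + 1 + numDraws n + q)) (n + 1) := by
      have h6 : s3.R 6 0 = s1.R 6 0 := by simp [hf3.R, f2.R]
      rw [h6, h1.1]
      refine runMax_congr fun q _ => ?_
      have := le_numDraws n
      rw [show m - 1 - n + 1 + numDraws n + q = m + (numDraws n - n + q) by omega, hx, hI.1,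
        add_assoc]
    rw [sliceSeq_step c x (by omega), e0, ← e0, ← e4, ← e1, ← e2, coneSeq, facetSeq, insSeq, e0,
      apex_eq, facetBit_eq]
    have hlt : facetIdx m (curSeq m c x (m - 1 - n)) x (m - 1 - n) < n + 2 := by
      rw [facetIdx, show m - 1 - (m - 1 - n) = n by omega]
      exact pickIdx_lt _ (by omega) _
    rw [← e1] at hlt
    rcases lt_trichotomy q (s3.N 25 0) with h | h | h
    · simp [h17, h, e3, ← hI.2 q (by omega), coneExpr]
    · simp [h17, ← h, coneExpr]
    · simp [h17, h, h.not_gt, h.ne', e3, ← hI.2 (q - 1) (by omega), coneExpr]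
  · simp
  · intro s4 hf4
    simp [hf4.N, f3.N, f2.N, f1.N, maxProg, h15]
  · intro q hq s4 hf4 h17
    simp [h17, hf4.R, h3 q hq]
  · have := le_numDraws n
    refine ⟨?_, fun q hq => ?_⟩
    · rw [Store.setN_pos, f4.pos rfl, f3.pos rfl, f2.pos rfl, h1.2, hI.1, numDraws]
      omega
    · rw [Store.setN_R, h4 q (by omega), show m - (n + 1) = m - 1 - n by omega]
  · have := h.2 q hq
    simp only [Nat.sub_self, zero_add, curSeq] at this
    exact this

/-- The Sum sampler. -/
def sumProg : Prog :=
  sumInit.seq <| slicePick.seq <| facetPicks.seq <| conePoints.seq <|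
    forN 17 (nv 11) <| .setR 0 (nv 17) (.get 7 (nv 17))

/-- This holds for every tape and for all arguments. Only the law of the output needs admissible
ones, so the Count sampler also halts when it meets a face of probability zero. -/
theorem runs_sumProg : ∃ C, ∀ (ω : Tape) (s : Store) (m κ mode : ℕ), HasArgs s m κ mode →
    Runs ω sumProg s (C * (m + 1) ^ 2) fun s' =>
      (∀ q < m, s'.R 0 q = sumSeq m κ mode (fun q => ω (s.pos + q)) q) ∧
        s'.pos = s.pos + (1 + numDraws m) := by
  obtain ⟨C1, h1⟩ := runs_sumInit
  obtain ⟨C2, h2⟩ := runs_slicePick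
  obtain ⟨C3, h3⟩ := runs_facetPicks
  obtain ⟨C4, h4⟩ := runs_conePoints
  apply Exists.intro
  intro ω s m κ mode h
  refine ((h1 ω s m κ mode h).seq fun s1 f1 i1 => (h2 ω s1 m κ mode i1).seq fun s2 f2 i2 =>
    (h3 ω s2 m κ mode (sliceIdx m κ mode (ω s1.pos)) (fun q => ω (s2.pos + q)) i2.1 i2.2.1 ?_
      fun _ => rfl).seq fun s3 f3 i3 =>
    (h4 ω s3 m _ (fun q => ω (s2.pos + q)) ?_ i3.1 ?_).seq fun s4 f4 i4 =>
    (Runs.fillR (a := 0) (m := m) (sliceSeq m (sliceIdx m κ mode (ω s1.pos))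
      fun q => ω (s2.pos + q)) rfl ?_ ?_ ?_).mono le_rfl fun s' f i =>
        ⟨fun q hq => ?_, ?_⟩).mono
    (bound_add le_rfl <| bound_add le_rfl <| bound_add le_rfl <| bound_add le_rfl <|
      bound_sq _ m) fun _ _ h => h
  · rw [sliceIdx]
    split_ifs
    · have := pickIdx_lt (eul m) (n := min κ m + 1) (by omega) (ω s1.pos)
      omega
    · exact min_le_right _ _
  · have : s3.N 11 = s2.N 11 := f3.N _ (by simp [facetPicks, pickProg])
    rw [this, i2.1.dim]
  · intro q
    rw [i3.2, add_assoc]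
  · simp
  · intro s5 f5
    have e1 : s4.N 11 = s3.N 11 := f4.N _ (by simp [conePoints, maxProg])
    have e2 : s3.N 11 = s2.N 11 := f3.N _ (by simp [facetPicks, pickProg])
    simp [f5.N, e1, e2, i2.1.dim]
  · intro q hq s5 f5 h17
    simp [f5.R, h17, i4.1 q hq.le]
  · have e1 : s1.pos = s.pos := f1.pos rfl
    rw [i q hq, sumSeq, i2.2.2, e1]
    simp only [add_assoc, add_zero]
  · have := le_numDraws m
    rw [f.pos rfl, i4.2, i3.2, i2.2.2, f1.pos rfl]
    omega

lemma runs_sumProg_output {ω : Tape} {s s' : Store} {m κ mode : ℕ}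
    (h : ∀ q < m, s'.R 0 q = sumSeq m κ mode (fun q => ω (s.pos + q)) q) :
    output m s' = sumVec m κ mode (shift s.pos ω) := by
  funext i
  exact h i i.2

lemma measurePreserving_shift (n : ℕ) : MeasurePreserving (shift n) tapeLaw tapeLaw := by
  refine ⟨measurable_shift n, ?_⟩
  conv_lhs => rw [← (measurePreserving_splice n).map_eq]
  rw [Measure.map_map (measurable_shift n) (measurable_splice n)]
  have h : (shift n ∘ fun p : Tape × Tape => splice n p.1 p.2) = Prod.snd :=
    funext fun p => shift_splice n p.1 p.2
  rw [h, Measure.map_snd_prod, measure_univ, one_smul]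

/-- The Sum sampler meets its specification. -/
theorem isSumSampler_sumProg {C : ℕ}
    (hC : ∀ (ω : Tape) (s : Store) (m κ mode : ℕ), HasArgs s m κ mode →
      Runs ω sumProg s (C * (m + 1) ^ 2) fun s' =>
        (∀ q < m, s'.R 0 q = sumSeq m κ mode (fun q => ω (s.pos + q)) q) ∧
          s'.pos = s.pos + (1 + numDraws m)) {C' : ℕ} (hCC : C ≤ C') :
    IsSumSampler sumProg C' := by
  intro m κ mode s hs hm
  choose n s' h1 h2 h3 using fun ω => hC ω s m κ mode hs
  refine ⟨n, s', fun ω => ⟨h1 ω, (h2 ω).trans (Nat.mul_le_mul_right _ hCC)⟩, ?_⟩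
  -- The sampler reads the tape from the position recorded in the initial store; dropping a fixed
  -- number of reals preserves the law of the tape.
  have h4 : (fun ω => output m (s' ω)) = sumVec m κ mode ∘ shift s.pos :=
    funext fun ω => runs_sumProg_output (h3 ω).1
  have h5 := (measurable_sumVec m κ mode).comp (measurable_shift s.pos)
  rw [h4]
  refine ⟨h5.aemeasurable, ?_⟩
  rw [← Measure.map_map (measurable_sumVec m κ mode) (measurable_shift s.pos),
    (measurePreserving_shift s.pos).map_eq, map_sumVec hm]

/-! ### The random choices of the Count sampler -/

/-- Reads the input and computes the table of Eulerian numbers. -/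
def countInit : Prog :=
  ((Prog.setN 30 (.lit 0) (.get 0 (.lit 0))).seq <|
    (Prog.setN 31 (.lit 0) (.get 0 (.lit 1))).seq <|
    (Prog.setN 11 (.lit 0) (.get 0 (.lit 0))).seq <|
    (Prog.setN 37 (.lit 0) ((nv 31).sub ((nv 31).sub (nv 30)))).seq <|
    Prog.setN 38 (.lit 0) (((nv 31).sub (.lit 1)).sub (((nv 31).sub (.lit 1)).sub (nv 30)))).seq
  eulerTable

/-- The sums of Eulerian numbers. -/
def sumTable : Prog :=
  forN 15 ((nv 30).add (.lit 1)) <| forN 17 ((nv 30).add (.lit 1)) <|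
    .ite (.ltN (nv 17) (.lit 1))
      (.setN 32 (((nv 15).mul ((nv 30).add (.lit 1))).add (nv 17)) (.lit 0))
      (.setN 32 (((nv 15).mul ((nv 30).add (.lit 1))).add (nv 17))
        ((NExpr.get 32 (((nv 15).mul ((nv 30).add (.lit 1))).add ((nv 17).sub (.lit 1)))).add
          (.get 10 (((nv 15).mul ((nv 30).add (.lit 1))).add (nv 17)))))

/-- The numbers `pathWeight` for the orthant weights. -/
def pathTable : Prog :=
  forN 15 ((nv 30).add (.lit 1)) <| forN 17 ((nv 30).add (.lit 1)) <|
    .ite (.ltN (nv 15) (.lit 1))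
      (.setN 33 (nv 17)
        ((NExpr.get 32 (((nv 17).mul ((nv 30).add (.lit 1))).add (nv 37))).mul
          (.get 32 ((((nv 30).sub (nv 17)).mul ((nv 30).add (.lit 1))).add (nv 37)))))
      (.setN 33 (((nv 15).mul ((nv 30).add (.lit 1))).add (nv 17))
        ((NExpr.get 33 ((((nv 15).sub (.lit 1)).mul ((nv 30).add (.lit 1))).add (nv 17))).add
          (.get 33 ((((nv 15).sub (.lit 1)).mul ((nv 30).add (.lit 1))).add
            ((nv 17).add (.lit 1))))))

/-- Draws the signs into array `1`; the number of positive ones is put into `34`. -/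
def signDraws : Prog :=
  (Prog.setN 34 (.lit 0) (.lit 0)).seq <|
  forN 35 (nv 30) <|
    (Prog.draw 5 (.lit 0)).seq <|
    .ite (.ltR
        ((rv 5).mul (.ofNat (.get 33 ((((nv 30).sub (nv 35)).mul ((nv 30).add (.lit 1))).add
          (nv 34)))))
        (.ofNat (.get 33 (((((nv 30).sub (nv 35)).sub (.lit 1)).mul ((nv 30).add (.lit 1))).add
          ((nv 34).add (.lit 1))))))
      ((Prog.setN 1 (nv 35) (.lit 1)).seq <| .setN 34 (.lit 0) ((nv 34).add (.lit 1)))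
      (.setN 1 (nv 35) (.lit 0))

/-- Draws the cross-section index. -/
def crossDraw : Prog :=
  (forN 35 (nv 30) <| .draw 3 (nv 35)).seq <|
  (Prog.setR 1 (.lit 0) (.ofNat (.lit 0))).seq <|
  forN 35 (nv 30) <|
    (Prog.setN 39 (.lit 0) (.lit 0)).seq <|
    (forN 21 (nv 30) <|
      .ite (.ltR (.get 3 (nv 21)) (.get 3 (nv 35))) (.setN 39 (.lit 0) ((nv 39).add (.lit 1)))
        .skip).seq <|
    .ite (.ltN ((nv 39).add (.lit 1)) (nv 34)) .skip <|
    .ite (.ltN (nv 34) ((nv 39).add (.lit 1))) .skip <|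
    .setR 1 (.lit 0) (.get 3 (nv 35))

/-- Draws the face index. -/
def faceDraw : Prog :=
  (forN 17 ((nv 34).add (.lit 1)) <|
    .ite (.ltN (nv 34) (.lit 2)) (.setN 16 (nv 17) ((NExpr.lit 1).sub (nv 17))) <|
    .ite (.ltN (nv 17) (nv 34)) (.setN 16 (nv 17)
      (.get 32 ((((nv 34).sub (.lit 1)).mul ((nv 30).add (.lit 1))).add (nv 38)))) <|
    .ite (.ltN (nv 31) (nv 34)) (.setN 16 (nv 17) ((nv 31).mul
      (.get 10 ((((nv 34).sub (.lit 1)).mul ((nv 30).add (.lit 1))).add (nv 31))))) <|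
    .setN 16 (nv 17) (.lit 0)).seq <|
  (pickProg ((nv 34).add (.lit 1))).seq <|
  (Prog.setN 2 (.lit 0) (nv 20)).seq <|
  (Prog.setN 0 (.lit 0) ((nv 34).sub (.lit 1))).seq <|
  .ite (.ltN (nv 2) (nv 34))
    ((Prog.setN 0 (.lit 1) ((nv 31).sub (.lit 1))).seq <| .setN 0 (.lit 2) (.lit 0)) <|
  .ite (.ltN (nv 31) (nv 34))
    ((Prog.setN 0 (.lit 1) (nv 31)).seq <| .setN 0 (.lit 2) (.lit 1))
    ((Prog.setN 0 (.lit 1) ((nv 31).sub (.lit 1))).seq <| .setN 0 (.lit 2) (.lit 0))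

/-- The tables have columns up to `d` only, so the bound `k` is cut off at `d`. -/
lemma eulerianSum_min {d n : ℕ} (hd : 1 ≤ d) (hn : n ≤ d) (k : ℕ) :
    eulerianSum n (min k d) = eulerianSum n k := by
  rcases le_total k d with h | h
  · rw [min_eq_left h]
  · rw [min_eq_right h, eulerianSum_of_ge hn hd h]

/-- What is known after `countInit`. -/
structure CountState (d k : ℕ) (s : Store) : Prop where
  dim : s.N 30 0 = d
  bound : s.N 31 0 = k
  min_bound : s.N 37 0 = min k d
  min_pred : s.N 38 0 = min (k - 1) d
  table : ∀ n ≤ d, ∀ b ≤ d, s.N 10 (n * (d + 1) + b) = eul n b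

lemma CountState.congr {d k : ℕ} {s s' : Store} (h : CountState d k s)
    (h30 : s'.N 30 = s.N 30) (h31 : s'.N 31 = s.N 31) (h37 : s'.N 37 = s.N 37)
    (h38 : s'.N 38 = s.N 38) (h10 : s'.N 10 = s.N 10) : CountState d k s' :=
  ⟨by rw [h30, h.dim], by rw [h31, h.bound], by rw [h37, h.min_bound], by rw [h38, h.min_pred],
    by rw [h10]; exact h.table⟩

lemma runs_countInit : ∃ C, ∀ (ω : Tape) (d k : ℕ),
    Runs ω countInit (initStore d k) (C * (d + 1) ^ 2) fun s' => CountState d k s' := by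
  obtain ⟨C, hC⟩ := runs_eulerTable
  apply Exists.intro
  intro ω d k
  refine ((Runs.of_run (Q := fun s' => s'.N 11 0 = d ∧ s'.N 30 0 = d ∧ s'.N 31 0 = k ∧
      s'.N 37 0 = min k d ∧ s'.N 38 0 = min (k - 1) d) rfl ?_).seq fun s1 f1 h1 =>
    (hC ω s1 d h1.1).mono le_rfl fun s' f h2 => ?_).mono
    (bound_add (bound_const _ (one_le_succ_sq d)) le_rfl) fun _ _ h => h
  · simp [initStore]
    omega
  · exact ⟨by simp [f.N, eulerTable, h1], by simp [f.N, eulerTable, h1],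
      by simp [f.N, eulerTable, h1], by simp [f.N, eulerTable, h1], h2⟩

lemma succ_succ_sq_le (m : ℕ) : (m + 1 + 1) ^ 2 ≤ 4 * (m + 1) ^ 2 := by
  nlinarith [Nat.zero_le (m * m), Nat.zero_le m]

lemma runs_sumTable : ∃ C, ∀ (ω : Tape) (s : Store) (d k : ℕ), CountState d k s →
    Runs ω sumTable s (C * (d + 1) ^ 2) fun s' =>
      CountState d k s' ∧ ∀ n ≤ d, ∀ b ≤ d, s'.N 32 (n * (d + 1) + b) = eulerianSum n b := by
  apply Exists.intro
  intro ω s d k h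
  refine (Runs.fillTable (W := d + 1) (a := 32) eulerianSum (fun _ _ => True) rfl ?_ ?_ ?_ ?_ ?_
    ?_).mono (bound_lin _ (succ_succ_sq_le d)) fun s' f h2 => ⟨?_, fun n hn b hb =>
      h2 n (by omega) b (by omega) trivial⟩
  · simp
  · simp
  · simp
  · simp
  · intro s' hf
    simp [hf.N, h.dim]
  · intro n hn b hb s' hf h1 h2 hI
    have h3 : s'.N 30 0 = d := by simp [hf.N, h.dim]
    have h4 : s'.N 10 = s.N 10 := by simp [hf.N]
    refine ⟨eulerianSum n b, ?_, fun _ => rfl⟩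
    rcases b with _ | b
    · simp [h1, h2, h3, eulerianSum]
    · have h5 := hI n b (by omega) (Or.inr ⟨rfl, by omega⟩) trivial
      have h6 := h.table n (by omega) (b + 1) (by omega)
      have h7 : eulerianSum n (b + 1) = eulerianSum n b + eul n (b + 1) := by
        rw [eulerianSum, Finset.sum_range_succ]; rfl
      simp [h1, h2, h3, h4, h5, h6, h7]
  · exact h.congr (by simp [f.N]) (by simp [f.N]) (by simp [f.N]) (by simp [f.N]) (by simp [f.N])

/-- What is known after the tables have been computed. -/
structure TableState (d k : ℕ) (s : Store) : Prop extends CountState d k s where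
  sums : ∀ n ≤ d, ∀ b ≤ d, s.N 32 (n * (d + 1) + b) = eulerianSum n b
  paths : ∀ l ≤ d, ∀ p ≤ d, l + p ≤ d →
    s.N 33 (l * (d + 1) + p) = pathWeight (orthantWeight d k) l p

lemma TableState.congr {d k : ℕ} {s s' : Store} (h : TableState d k s)
    (h' : ∀ a ∈ [10, 30, 31, 32, 33, 37, 38], s'.N a = s.N a) : TableState d k s' where
  toCountState := h.toCountState.congr (h' 30 (by simp)) (h' 31 (by simp)) (h' 37 (by simp))
    (h' 38 (by simp)) (h' 10 (by simp))
  sums := by rw [h' 32 (by simp)]; exact h.sums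
  paths := by rw [h' 33 (by simp)]; exact h.paths

/-- Row `l` needs the entry `p + 1` of the row before, which leaves the table at the right edge.
Only the triangle `l + p ≤ d` is correct, and only that is used. -/
lemma runs_pathTable : ∃ C, ∀ (ω : Tape) (s : Store) (d k : ℕ), 1 ≤ d → CountState d k s →
    (∀ n ≤ d, ∀ b ≤ d, s.N 32 (n * (d + 1) + b) = eulerianSum n b) →
    Runs ω pathTable s (C * (d + 1) ^ 2) fun s' => TableState d k s' := by
  apply Exists.intro
  intro ω s d k hd h hsum
  refine (Runs.fillTable (W := d + 1) (a := 33) (pathWeight (orthantWeight d k))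
    (fun l p => l + p ≤ d) rfl ?_ ?_ ?_ ?_ ?_
    ?_).mono (bound_lin _ (succ_succ_sq_le d)) fun s' f h2 => ⟨?_, ?_, fun n hn b hb hok =>
      h2 n (by omega) b (by omega) hok⟩
  · simp
  · simp
  · simp
  · simp
  · intro s' hf
    simp [hf.N, h.dim]
  · intro l hl p hp s' hf h1 h2 hI
    have h3 : s'.N 30 0 = d := by simp [hf.N, h.dim]
    have h4 : s'.N 32 = s.N 32 := by simp [hf.N]
    have h5 : s'.N 37 0 = min k d := by simp [hf.N, h.min_bound]
    rcases l with _ | l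
    · refine ⟨orthantWeight d k p, ?_, fun _ => rfl⟩
      have h6 := hsum p (by omega) (min k d) (by omega)
      have h7 := hsum (d - p) (by omega) (min k d) (by omega)
      rw [eulerianSum_min hd (by omega)] at h6 h7
      simp [h1, h2, h3, h4, h5, h6, h7, orthantWeight]
    · refine ⟨s'.N 33 (l * (d + 1) + p) + s'.N 33 (l * (d + 1) + (p + 1)), ?_, fun hok => ?_⟩
      · simp [h1, h2, h3]
      · rw [hI l p hp (Or.inl (by omega)) (by omega),
          hI l (p + 1) (by omega) (Or.inl (by omega)) (by omega), pathWeight]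
  · exact h.congr (by simp [f.N]) (by simp [f.N]) (by simp [f.N]) (by simp [f.N]) (by simp [f.N])
  · have h4 : s'.N 32 = s.N 32 := by simp [f.N]
    rw [h4]
    exact hsum

lemma posCount_le (W : ℕ → ℕ) (d : ℕ) (x : ℕ → ℝ) (i : ℕ) : posCount W d x i ≤ i := by
  induction i with
  | zero => exact le_rfl
  | succ i ih => rw [posCount]; split_ifs <;> omega

/-- At position `i` the count is at most `i`, so the two lookups in rows `d - i` and `d - i - 1`
stay in the correct triangle. -/
lemma runs_signDraws : ∃ C, ∀ (ω : Tape) (s : Store) (d k : ℕ), TableState d k s →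
    Runs ω signDraws s (C * (d + 1) ^ 2) fun s' => TableState d k s' ∧
      s'.N 34 0 = numPos (orthantOf d s') ∧
      orthantOf d s' = randSigns (orthantWeight d k) d (fun q => ω (s.pos + q)) ∧
      s'.pos = s.pos + d := by
  apply Exists.intro
  intro ω s d k h
  obtain ⟨x, hx⟩ : ∃ x : ℕ → ℝ, ∀ q, x q = ω (s.pos + q) := ⟨_, fun _ => rfl⟩
  set W := orthantWeight d k with hW
  refine ((Runs.of_run (Q := fun s' => s'.N 34 0 = 0 ∧ s'.pos = s.pos) rfl ?_).seq fun s1 f1 h1 =>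
    Runs.forN (m := d) (fun i s' => s'.N 34 0 = posCount W d x i ∧ s'.pos = s.pos + i ∧
      ∀ q < i, s'.N 1 q ≠ 0 ↔ SignTest W d x q (posCount W d x q)) ?_ ?_ ?_
      fun i hi s' hf h0 hI => Runs.of_run rfl ?_).mono
    (bound_add (bound_const _ (one_le_succ_sq d)) (bound_sq _ d)) fun s' f h2 => ?_
  · simp
  · simp
  · intro s' hf
    simp [hf.N, f1.N, h.dim]
  · simp [h1, posCount]
  · have e1 : s'.N 30 0 = d := by simp [hf.N, f1.N, h.dim]
    have e2 : s'.N 33 = s.N 33 := by simp [hf.N, f1.N]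
    have e3 := posCount_le W d x i
    have e4 := h.paths (d - i) (by omega) (posCount W d x i) (by omega) (by omega)
    have e5 := h.paths (d - i - 1) (by omega) (posCount W d x i + 1) (by omega) (by omega)
    have key : ∀ q < i, q ≠ i := fun q hq => hq.ne
    by_cases ht : SignTest W d x i (posCount W d x i)
    · have ht' := ht
      rw [SignTest, hx] at ht'
      refine ⟨?_, ?_, fun q hq => ?_⟩
      · simp [hI, h0, e1, e2, e4, e5, ← hW, ht', posCount, ht]
      · simp [hI, h0, e1, e2, e4, e5, ← hW, ht', add_assoc]
      · rcases Nat.lt_or_ge q i with hq' | hq'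
        · simpa [hI, h0, e1, e2, e4, e5, ← hW, ht', hq'.ne] using hI.2.2 q hq'
        · obtain rfl : q = i := by omega
          simp [hI, h0, e1, e2, e4, e5, ← hW, ht', ht]
    · have ht' := ht
      rw [SignTest, hx] at ht'
      refine ⟨?_, ?_, fun q hq => ?_⟩
      · simp [hI, h0, e1, e2, e4, e5, ← hW, ht', posCount, ht]
      · simp [hI, h0, e1, e2, e4, e5, ← hW, ht', add_assoc]
      · rcases Nat.lt_or_ge q i with hq' | hq'
        · simpa [hI, h0, e1, e2, e4, e5, ← hW, ht', hq'.ne] using hI.2.2 q hq'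
        · obtain rfl : q = i := by omega
          simp [hI, h0, e1, e2, e4, e5, ← hW, ht', ht]
  · have e1 : orthantOf d s' = randSigns W d (fun q => ω (s.pos + q)) := by
      have : (fun q => (ω (s.pos + q) : ℝ)) = x := funext fun q => (hx q).symm
      rw [this]
      funext i
      exact decide_eq_decide.2 (h2.2.2 i i.2)
    refine ⟨h.congr (by simp [f.N]), ?_, e1, h2.2.1⟩
    rw [e1, numPos_randSigns, h2.1]
    congr 1
    exact funext hx

lemma countLt_congr {x y : ℕ → ℝ} {d : ℕ} (h : ∀ q < d, x q = y q) (v : ℝ) :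
    countLt x d v = countLt y d v :=
  Finset.sum_congr rfl fun q hq => by rw [h q (Finset.mem_range.1 hq)]

/-- The rank of every entry is counted in an inner loop, so quadratic time suffices without sorting.
Equality of ranks is tested by two strict comparisons. -/
lemma runs_crossDraw : ∃ C, ∀ (ω : Tape) (s : Store) (d j : ℕ), s.N 30 0 = d → s.N 34 0 = j →
    Runs ω crossDraw s (C * (d + 1) ^ 2) fun s' =>
      s'.R 1 0 = orderStat (fun q => ω (s.pos + q)) d j d ∧ s'.pos = s.pos + d := by
  apply Exists.intro
  intro ω s d j hd hj
  obtain ⟨x, hx⟩ : ∃ x : ℕ → ℝ, ∀ q, x q = ω (s.pos + q) := ⟨_, fun _ => rfl⟩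
  have hxf : (fun q => (ω (s.pos + q) : ℝ)) = x := funext fun q => (hx q).symm
  rw [hxf]
  refine ((Runs.forN (m := d) (fun i s' => s'.pos = s.pos + i ∧ ∀ q < i, s'.R 3 q = x q)
      ?_ ?_ ?_ fun i hi s' hf h0 hI => Runs.of_run rfl ?_).seq fun s1 f1 h1 =>
    (Runs.of_run (Q := fun s' => s'.R 1 0 = 0) rfl ?_).seq fun s2 f2 h2 =>
    (Runs.forN (m := d) (T := _ * (d + 1)) (fun i s' => s'.R 1 0 = orderStat x d j i)
      ?_ ?_ ?_ fun i hi s' hf h0 hI =>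
      ((Runs.of_run (Q := fun s' => s'.N 39 0 = 0) rfl ?_).seq fun s3 f3 h3 =>
        (Runs.forN (m := d) (fun q s' => s'.N 39 0 = countLt x q (x i)) ?_ ?_ ?_
          fun q hq s'' hf' h0' hI' => Runs.of_run rfl ?_).seq fun s4 f4 h4 =>
        (Runs.of_run (Q := fun s' => s'.R 1 0 = orderStat x d j (i + 1)) rfl ?_).mono le_rfl
          fun s5 f5 h5 => ?_).mono
        (bound_add (bound_const _ (by omega)) <| bound_add (bound_mul _ le_rfl) <|
          bound_const _ (by omega)) fun _ _ h => h).mono le_rfl fun s' f h => ⟨h, ?_⟩).mono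
    (bound_add (bound_sq _ d) <| bound_add (bound_const _ (one_le_succ_sq d)) <|
      bound_loop _ _ _ d) fun _ _ h => h
  · simp
  · intro s' hf
    simp [hf.N, hd]
  · simp
  · refine ⟨by simp [hI, add_assoc], fun q hq => ?_⟩
    rcases Nat.lt_or_ge q i with h | h
    · simp [h0, h.ne, hI.2 q h]
    · obtain rfl : q = i := by omega
      simp [h0, hI, hx]
  · simp
  · simp
  · intro s' hf
    simp [hf.N, f2.N, f1.N, hd]
  · simp [h2, orderStat]
  · simp
  · simp
  · intro s'' hf'
    simp [hf'.N, f3.N, hf.N, f2.N, f1.N, hd]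
  · simp [h3, countLt]
  · have e1 : s''.R 3 = s1.R 3 := by simp [hf'.R, f3.R, hf.R, f2.R]
    have e2 : s''.N 35 0 = i := by simp [hf'.N, f3.N, h0]
    have e3 : countLt x (q + 1) (x i) = countLt x q (x i) + if x q < x i then 1 else 0 := by
      rw [countLt, Finset.sum_range_succ, countLt]
    by_cases h : x q < x i <;> simp [h0', e1, e2, h1.2 q hq, h1.2 i hi, hI', e3, h]
  · have e1 : s4.R 3 i = x i := by
      simp [f4.R, f3.R, hf.R, f2.R, h1.2 i hi]
    have e2 : s4.N 35 0 = i := by simp [f4.N, f3.N, h0]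
    have e3 : s4.N 34 0 = j := by simp [f4.N, f3.N, hf.N, f2.N, f1.N, hj]
    have e4 : s4.R 1 0 = orderStat x d j i := by simp [f4.R, f3.R, hI]
    rcases lt_trichotomy (countLt x d (x i) + 1) j with h | h | h
    · simp [h4, e3, e4, h, h.ne, orderStat]
    · simp [h4, e1, e2, e3, h, orderStat]
    · simp [h4, e3, e4, h, h.ne', h.not_gt, orderStat]
  · simpa using h5
  · rw [f.pos rfl, f2.pos rfl, h1.1]

/-- The case `f = j` without a cut face has weight zero unless `j = 0`; in that case too the
arguments are set as `firstBound` and `firstMode` prescribe. -/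
lemma runs_faceDraw : ∃ C, ∀ (ω : Tape) (s : Store) (d k j : ℕ), 1 ≤ d → 1 ≤ k → j ≤ d →
    TableState d k s → s.N 34 0 = j →
    Runs ω faceDraw s (C * (d + 1) ^ 2) fun s' =>
      s'.N 2 0 = pickIdx (faceWeight k j) (j + 1) (ω s.pos) ∧
      HasArgs s' (j - 1) (firstBound k j (s'.N 2 0)) (firstMode k j (s'.N 2 0)) ∧
      s'.pos = s.pos + 1 := by
  obtain ⟨C, hC⟩ := runs_pickProg ((nv 34).add (.lit 1))
  apply Exists.intro
  intro ω s d k j hd hk hjd h hj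
  have hle : j + 1 + 1 ≤ 2 * (d + 1) ^ 2 := by nlinarith
  refine ((Runs.fillN (a := 16) (m := j + 1) (faceWeight k j) rfl ?_ ?_ ?_ ?_).seq fun s1 f1 h1 =>
    (hC ω s1 (j + 1) ?_).seq fun s2 f2 h2 => Runs.of_run rfl ?_).mono
    (bound_add (bound_lin _ hle) <| bound_add (bound_lin _ hle) <|
      bound_const _ (one_le_succ_sq d)) fun _ _ h => h
  · simp
  · simp
  · intro s' hf
    simp [hf.N, hj]
  · intro i hi s' hf h0
    have e1 : s'.N 34 0 = j := by simp [hf.N, hj]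
    have e2 : s'.N 30 0 = d := by simp [hf.N, h.dim]
    have e3 : s'.N 31 0 = k := by simp [hf.N, h.bound]
    have e4 : s'.N 38 0 = min (k - 1) d := by simp [hf.N, h.min_pred]
    have e5 : s'.N 32 = s.N 32 := by simp [hf.N]
    have e6 : s'.N 10 = s.N 10 := by simp [hf.N]
    have e7 := h.sums (j - 1) (by omega) (min (k - 1) d) (by omega)
    rw [eulerianSum_min hd (by omega)] at e7
    by_cases hj2 : j < 2
    -- For `j ≤ 1` the only face with a weight is `0`, and the truncated `1 - i` is its indicator.
    · have : 1 - i = faceWeight k j i := by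
        unfold faceWeight
        split_ifs <;> omega
      simp [e1, h0, hj2, this]
    · by_cases hij : i < j
      · have : eulerianSum (j - 1) (k - 1) = faceWeight k j i := by
          rw [faceWeight, if_neg (by omega), if_pos hij]
        simp [e1, e2, e4, e5, e7, h0, hj2, hij, this]
      · obtain rfl : i = j := by omega
        by_cases hkj : k < i
        · have : k * eul (i - 1) k = faceWeight k i i := by
            rw [faceWeight, if_neg (by omega), if_neg hij, if_pos ⟨rfl, hkj⟩, eul, if_neg (by omega)]
          simp [e1, e2, e3, e6, h0, hj2, hkj, h.table (i - 1) (by omega) k (by omega), this]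
        · have : faceWeight k i i = 0 := by
            rw [faceWeight, if_neg (by omega), if_neg hij, if_neg fun h => hkj h.2]
          simp [e1, e3, h0, hj2, hkj, this]
  · intro s' hs'
    simp [hs', f1.N, hj]
  · have e1 : s2.N 34 0 = j := by simp [f2.N, f1.N, pickProg, hj]
    have e3 : s2.N 31 0 = k := by simp [f2.N, f1.N, pickProg, h.bound]
    obtain ⟨f, hf⟩ : ∃ f, f = pickIdx (faceWeight k j) (j + 1) (ω s.pos) := ⟨_, rfl⟩
    have hlt : f < j + 1 := by rw [hf]; exact pickIdx_lt _ (by omega) _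
    have e4 : s2.N 20 0 = f := by rw [h2.1, f1.pos rfl, hf]; exact pickIdx_congr h1 _
    have e5 : s2.pos = s.pos + 1 := by rw [h2.2, f1.pos rfl]
    rw [← hf]
    by_cases h1 : f < j
    · have : ¬ IsCut k j f := fun h => h1.ne h.1
      simp [e1, e3, e4, e5, h1, HasArgs, firstBound, firstMode, this]
    · by_cases h2 : k < j
      · have : IsCut k j f := ⟨by omega, h2⟩
        simp [e1, e3, e4, e5, h1, h2, HasArgs, firstBound, firstMode, this]
      · have : ¬ IsCut k j f := fun h => h2 h.2
        simp [e1, e3, e4, e5, h1, h2, HasArgs, firstBound, firstMode, this]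

/-- The part of the Count sampler before the first call of the Sum sampler. -/
def choiceProg : Prog :=
  countInit.seq <| sumTable.seq <| pathTable.seq <| signDraws.seq <| crossDraw.seq faceDraw

/-- What is known after `choiceProg`. -/
structure ChoiceState (d k : ℕ) (ω : Tape) (s : Store) : Prop where
  dim : s.N 30 0 = d
  bound : s.N 31 0 = k
  signs : orthantOf d s = randSigns (orthantWeight d k) d fun q => ω q
  num : s.N 34 0 = numPos (orthantOf d s)
  cross : s.R 1 0 = orderStat (fun q => ω (d + q)) d (numPos (orthantOf d s)) d
  face : s.N 2 0 = pickIdx (faceWeight k (numPos (orthantOf d s))) (numPos (orthantOf d s) + 1)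
    (ω (2 * d))
  args : HasArgs s (numPos (orthantOf d s) - 1) (firstBound k (numPos (orthantOf d s)) (s.N 2 0))
    (firstMode k (numPos (orthantOf d s)) (s.N 2 0))
  pos : s.pos = 2 * d + 1

/-- The first `d` reals of the tape go to the signs, the next `d` to the cross-section index, and
the one at position `2 * d` to the face. -/
lemma runs_choiceProg : ∃ C, ∀ (ω : Tape) (d k : ℕ), 1 ≤ d → 1 ≤ k →
    Runs ω choiceProg (initStore d k) (C * (d + 1) ^ 2) (ChoiceState d k ω) := by
  obtain ⟨C1, h1⟩ := runs_countInit
  obtain ⟨C2, h2⟩ := runs_sumTable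
  obtain ⟨C3, h3⟩ := runs_pathTable
  obtain ⟨C4, h4⟩ := runs_signDraws
  obtain ⟨C5, h5⟩ := runs_crossDraw
  obtain ⟨C6, h6⟩ := runs_faceDraw
  apply Exists.intro
  intro ω d k hd hk
  refine ((h1 ω d k).seq fun s1 f1 i1 => (h2 ω s1 d k i1).seq fun s2 f2 i2 =>
    (h3 ω s2 d k hd i2.1 i2.2).seq fun s3 f3 i3 => (h4 ω s3 d k i3).seq fun s4 f4 i4 =>
    (h5 ω s4 d (numPos (orthantOf d s4)) i4.1.dim i4.2.1).seq fun s5 f5 i5 =>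
    (h6 ω s5 d k (numPos (orthantOf d s4)) hd hk (numPos_le _) (i4.1.congr ?_) ?_).mono le_rfl
      fun s6 f6 i6 => ?_).mono
    (bound_add le_rfl <| bound_add le_rfl <| bound_add le_rfl <| bound_add le_rfl <|
      bound_add le_rfl le_rfl) fun _ _ h => h
  · intro a ha
    refine f5.N a ?_
    simp only [List.mem_cons, List.not_mem_nil, or_false] at ha
    rcases ha with rfl | rfl | rfl | rfl | rfl | rfl | rfl <;> simp [crossDraw]
  · simp [f5.N, crossDraw, i4]
  · have p3 : s3.pos = 0 := by rw [f3.pos rfl, f2.pos rfl, f1.pos rfl]; rfl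
    have e : orthantOf d s6 = orthantOf d s4 := by
      funext i
      simp [orthantOf, f6.N, f5.N, crossDraw, faceDraw, pickProg]
    refine ⟨?_, ?_, ?_, ?_, ?_, ?_, ?_, ?_⟩
    · simp [f6.N, f5.N, crossDraw, faceDraw, pickProg, i4.1.dim]
    · simp [f6.N, f5.N, crossDraw, faceDraw, pickProg, i4.1.bound]
    · simp [e, i4.2.2.1, p3]
    · simp [f6.N, f5.N, crossDraw, faceDraw, pickProg, e, i4]
    · simp [f6.R, faceDraw, pickProg, e, i5.1, i4.2.2.2, p3]
    · rw [e, i6.1, i5.2, i4.2.2.2, p3]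
      ring_nf
    · rw [e]
      exact i6.2.1
    · rw [i6.2.2, i5.2, i4.2.2.2, p3]
      ring

/-! ### The coordinates of the output -/

lemma rank_eq_sum {d : ℕ} (J : Fin d → Bool) (i : Fin d) :
    rank J i = ∑ q ∈ Finset.range i, if signSeq J q = J i then 1 else 0 := by
  have h := Fin.sum_univ_eq_sum_range (fun q => if q < (i : ℕ) ∧ signSeq J q = J i then 1 else 0) d
  simp only [signSeq_val] at h
  rw [rank, Finset.card_filter]
  refine h.trans ?_
  rw [← Finset.sum_subset (Finset.range_mono i.2.le) fun q _ hq => by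
    simp only [Finset.mem_range] at hq; simp [hq]]
  refine Finset.sum_congr rfl fun q hq => ?_
  simp [Finset.mem_range.1 hq]

lemma rank_of_pos {d : ℕ} {J : Fin d → Bool} {i : Fin d} (h : J i = true) :
    rank J i = prefixCount (signSeq J) i := by
  rw [rank_eq_sum, prefixCount, h]

/-- The positive and the negative ones among the first `i` signs add up to `i`, so a single counter
serves both ranks. -/
lemma rank_of_neg {d : ℕ} {J : Fin d → Bool} {i : Fin d} (h : ¬ J i = true) :
    rank J i = i - prefixCount (signSeq J) i := by
  have h1 : rank J i + prefixCount (signSeq J) i = i := by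
    rw [rank_eq_sum, prefixCount, ← Finset.sum_add_distrib]
    conv_rhs => rw [← Finset.card_range (i : ℕ), Finset.card_eq_sum_ones]
    refine Finset.sum_congr rfl fun q _ => ?_
    rw [Bool.eq_false_of_not_eq_true h]
    cases signSeq J q <;> rfl
  omega

/-- The part of the Count sampler between the two calls of the Sum sampler. -/
def betweenProg : Prog :=
  (Prog.setN 40 (.lit 0) (.get 0 (.lit 2))).seq <|
  (forN 17 ((nv 34).sub (.lit 1)) <| .setR 2 (nv 17) (.get 0 (nv 17))).seq <|
  (Prog.setR 2 ((nv 34).sub (.lit 1)) (.ofNat (.lit 0))).seq <|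
  (Prog.setN 0 (.lit 0) ((nv 30).sub (nv 34))).seq <|
  (Prog.setN 0 (.lit 1) (nv 31)).seq <| .setN 0 (.lit 2) (.lit 0)

/-- The first output is saved in array `2` and the mode in array `40`, because the second call
reuses array `0`. The extra zero in cell `j - 1` makes the array agree with `pad` at the one further
index that can be read. -/
lemma runs_betweenProg : ∃ C, ∀ (ω : Tape) (s : Store) (d k j : ℕ), j ≤ d → s.N 30 0 = d →
    s.N 31 0 = k → s.N 34 0 = j → Runs ω betweenProg s (C * (d + 1) ^ 2) fun s' =>
      s'.N 40 0 = s.N 0 2 ∧ (∀ q ≤ j - 1, s'.R 2 q = pad (output (j - 1) s) q) ∧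
        HasArgs s' (d - j) k 0 := by
  apply Exists.intro
  intro ω s d k j hjd hd hk hj
  have hle : j - 1 + 1 ≤ 2 * (d + 1) ^ 2 := by nlinarith [Nat.sub_le j 1]
  refine ((Runs.of_run (Q := fun s' => s'.N 40 0 = s.N 0 2) rfl ?_).seq fun s1 f1 h1 =>
    (Runs.fillR (a := 2) (m := j - 1) (s.R 0) rfl ?_ ?_ ?_).seq fun s2 f2 h2 =>
    Runs.of_run rfl ?_).mono (bound_add (bound_const _ (one_le_succ_sq d)) <|
      bound_add (bound_lin _ hle) <| bound_const _ (one_le_succ_sq d)) fun _ _ h => h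
  · simp
  · simp
  · intro s' hf
    simp [hf.N, f1.N, hj]
  · intro i hi s' hf h0
    simp [hf.R, f1.R, h0]
  · have e1 : s2.N 40 0 = s.N 0 2 := by simp [f2.N, h1]
    have e2 : s2.N 30 0 = d := by simp [f2.N, f1.N, hd]
    have e3 : s2.N 31 0 = k := by simp [f2.N, f1.N, hk]
    have e4 : s2.N 34 0 = j := by simp [f2.N, f1.N, hj]
    refine ⟨by simp [e1], fun q hq => ?_, by simp [e2, e3, e4, HasArgs]⟩
    rcases hq.lt_or_eq with h | rfl
    · simp [e4, h.ne, h2 q h, pad, h, output]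
    · simp [e4, pad]

/-- The part of the Count sampler after the calls of the Sum sampler. -/
def outputProg : Prog :=
  (forN 17 ((nv 30).sub (nv 34)) <| .setR 4 (nv 17) (.get 0 (nv 17))).seq <|
  (Prog.setR 3 (.lit 0) (.ofNat (.lit 0))).seq <|
  (forN 17 ((nv 34).sub (.lit 1)) <| .setR 3 (.lit 0) ((rv 3).add (.get 2 (nv 17)))).seq <|
  (Prog.setN 41 (.lit 0) (.lit 0)).seq <|
  forN 35 (nv 30) <|
    .ite (.ltN (.lit 0) (.get 1 (nv 35)))
      ((Prog.ite (.ltN (.lit 0) (nv 40))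
        (.ite (.ltN ((nv 41).add (.lit 1)) (nv 34))
          (.setR 0 (nv 35) ((rv 1).mul (.get 2 (nv 41))))
          (.setR 0 (nv 35) ((rv 1).mul ((RExpr.ofNat (nv 31)).sub (rv 3))))) <|
        .ite (.ltN (nv 41) (nv 2)) (.setR 0 (nv 35) ((rv 1).mul (.get 2 (nv 41)))) <|
        .ite (.ltN (nv 2) (nv 41))
          (.setR 0 (nv 35) ((rv 1).mul (.get 2 ((nv 41).sub (.lit 1)))))
          (.setR 0 (nv 35) ((rv 1).mul (.ofNat (.lit 1))))).seq <|
        .setN 41 (.lit 0) ((nv 41).add (.lit 1)))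
      (.setR 0 (nv 35) (((RExpr.ofNat (.lit 0)).sub ((RExpr.ofNat (.lit 1)).sub (rv 1))).mul
        (.get 4 ((nv 35).sub (nv 41)))))

/-- The second draw is moved to array `4` before array `0` is filled with the result. Counter `41`
gives the rank in positive positions, and `i` minus it the rank in negative ones. -/
lemma runs_outputProg : ∃ C, ∀ (ω : Tape) (s : Store) (d k f : ℕ) (J : Fin d → Bool) (t : ℝ)
    (u v : ℕ → ℝ), s.N 30 0 = d → s.N 31 0 = k → s.N 34 0 = numPos J → orthantOf d s = J →
    s.N 2 0 = f → s.N 40 0 = firstMode k (numPos J) f → s.R 1 0 = t →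
    (∀ q ≤ numPos J - 1, s.R 2 q = u q) → (∀ q < d - numPos J, s.R 0 q = v q) →
    Runs ω outputProg s (C * (d + 1) ^ 2) fun s' => output d s' = assemble k (J, t, f, u, v) := by
  apply Exists.intro
  intro ω s d k f J t u v hd hk hj hJ hf0 hm ht hu hv
  have hjd := numPos_le J
  have hle1 : numPos J - 1 + 1 ≤ 2 * (d + 1) ^ 2 := by nlinarith [Nat.sub_le (numPos J) 1]
  have hle2 : d - numPos J + 1 ≤ 1 * (d + 1) ^ 2 := by nlinarith [Nat.sub_le d (numPos J)]
  refine ((Runs.fillR (a := 4) (m := d - numPos J) v rfl ?_ ?_ ?_).seq fun s1 f1 h1 =>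
    (Runs.of_run (Q := fun s' => s'.R 3 0 = 0) rfl ?_).seq fun s2 f2 h2 =>
    (Runs.forN (m := numPos J - 1) (fun i s' => s'.R 3 0 = ∑ q ∈ Finset.range i, u q) ?_ ?_ ?_
      fun i hi s' hf h0 hI => Runs.of_run rfl ?_).seq fun s3 f3 h3 =>
    (Runs.of_run (Q := fun s' => s'.N 41 0 = 0) rfl ?_).seq fun s4 f4 h4 =>
    (Runs.forN (m := d) (fun i s' => s'.N 41 0 = prefixCount (signSeq J) i ∧
      ∀ q : Fin d, (q : ℕ) < i → s'.R 0 q = assemble k (J, t, f, u, v) q) ?_ ?_ ?_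
      fun i hi s' hf h0 hI => Runs.of_run rfl ?_).mono le_rfl
      fun s5 f5 h5 => funext fun q => h5.2 q q.2).mono
    (bound_add (bound_lin _ hle2) <| bound_add (bound_const _ (one_le_succ_sq d)) <|
      bound_add (bound_lin _ hle1) <| bound_add (bound_const _ (one_le_succ_sq d)) <|
      bound_sq _ d) fun _ _ h => h
  · simp
  · intro s' hf
    simp [hf.N, hd, hj]
  · intro i hi s' hf h0
    simp [hf.R, h0, hv i hi]
  · simp
  · simp
  · intro s' hf
    simp [hf.N, f2.N, f1.N, hj]
  · simp [h2]
  · have e : s'.R 2 = s.R 2 := by simp [hf.R, f2.R, f1.R]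
    simp [h0, hI, e, hu i hi.le, Finset.sum_range_succ]
  · simp
  · simp
  · intro s' hf
    simp [hf.N, f4.N, f3.N, f2.N, f1.N, hd]
  · simp [h4, prefixCount]
  · have e1 : s'.N 1 = s.N 1 := by simp [hf.N, f4.N, f3.N, f2.N, f1.N]
    have e2 : s'.N 2 0 = f := by simp [hf.N, f4.N, f3.N, f2.N, f1.N, hf0]
    have e3 : s'.N 31 0 = k := by simp [hf.N, f4.N, f3.N, f2.N, f1.N, hk]
    have e4 : s'.N 34 0 = numPos J := by simp [hf.N, f4.N, f3.N, f2.N, f1.N, hj]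
    have e5 : s'.N 40 0 = firstMode k (numPos J) f := by
      simp [hf.N, f4.N, f3.N, f2.N, f1.N, hm]
    have e6 : s'.R 1 0 = t := by simp [hf.R, f4.R, f3.R, f2.R, f1.R, ht]
    have e7 : s'.R 2 = s.R 2 := by simp [hf.R, f4.R, f3.R, f2.R, f1.R]
    have e8 : s'.R 3 0 = ∑ q ∈ Finset.range (numPos J - 1), u q := by simp [hf.R, f4.R, h3]
    have e9 : s'.R 4 = s1.R 4 := by simp [hf.R, f4.R, f3.R, f2.R]
    have hc : prefixCount (signSeq J) (i + 1) =
        prefixCount (signSeq J) i + if J ⟨i, hi⟩ then 1 else 0 := by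
      rw [prefixCount, Finset.sum_range_succ, ← prefixCount, ← signSeq_val J ⟨i, hi⟩]
    have hs : J ⟨i, hi⟩ = true ↔ 0 < s.N 1 i := by
      rw [← hJ, orthantOf, decide_eq_true_iff, Nat.pos_iff_ne_zero]
    have hset : ∀ q : Fin d, (q : ℕ) < i + 1 → (s'.setR 0 i (assemble k (J, t, f, u, v) ⟨i, hi⟩)).R
        0 q = assemble k (J, t, f, u, v) q := fun q hq => by
      rcases Nat.lt_or_ge q i with h | h
      · simp [h.ne, hI.2 q h]
      · obtain rfl : q = ⟨i, hi⟩ := Fin.ext (show (q : ℕ) = i by omega)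
        simp
    by_cases hJi : J ⟨i, hi⟩ = true
    · have hr := rank_of_pos hJi
      have hlt := rank_lt_of_pos hJi
      have hs' := hs.1 hJi
      rw [if_pos hJi] at hc
      rw [← hr] at hc
      have hr' : s'.N 41 0 = rank J ⟨i, hi⟩ := by rw [hI.1, hr]
      have hvr := hu (rank J ⟨i, hi⟩) (by omega)
      have hvr' := hu (rank J ⟨i, hi⟩ - 1) (by omega)
      have key : s'.setR 0 i (assemble k (J, t, f, u, v) ⟨i, hi⟩) =
          s'.setR 0 i (t * facePoint k (numPos J) f u (rank J ⟨i, hi⟩)) := by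
        simp [assemble, hJi]
      rw [key] at hset
      by_cases hcut : IsCut k (numPos J) f
      · have e10 : firstMode k (numPos J) f = 1 := if_pos hcut
        by_cases hlast : rank J ⟨i, hi⟩ + 1 < numPos J
        · rw [facePoint, if_pos hcut, if_neg hlast.ne] at hset
          simpa [h0, e1, e2, e3, e4, e5, e6, e7, hr', hvr, hs', hc, e10, hlast] using hset
        · rw [facePoint, if_pos hcut,
            if_pos (show rank J ⟨i, hi⟩ + 1 = numPos J from
            le_antisymm hlt (not_lt.1 hlast))] at hset
          simpa [h0, e1, e2, e3, e4, e5, e6, e7, e8, hr', hs', hc, e10, hlast] using hset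
      · have e10 : firstMode k (numPos J) f = 0 := if_neg hcut
        rcases lt_trichotomy (rank J ⟨i, hi⟩) f with h | h | h
        · rw [facePoint, if_neg hcut, if_pos h] at hset
          simpa [h0, e1, e2, e3, e4, e5, e6, e7, hr', hvr, hs', hc, e10, h] using hset
        · rw [facePoint, if_neg hcut, if_neg h.not_lt, if_pos h] at hset
          simpa [h0, e1, e2, e3, e4, e5, e6, e7, hr', hs', hc, e10, h] using hset
        · rw [facePoint, if_neg hcut, if_neg h.not_gt, if_neg h.ne'] at hset
          simpa [h0, e1, e2, e3, e4, e5, e6, e7, hr', hvr', hs', hc, e10, h, h.not_gt] using hset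
    · have hr := rank_of_neg hJi
      have hlt := rank_lt_of_neg hJi
      have hz : s.N 1 i = 0 := Nat.eq_zero_of_not_pos fun h => hJi (hs.2 h)
      rw [if_neg hJi, add_zero] at hc
      have key : s'.setR 0 i (assemble k (J, t, f, u, v) ⟨i, hi⟩) =
          s'.setR 0 i (-(1 - t) * v (rank J ⟨i, hi⟩)) := by
        simp [assemble, hJi]
      rw [key, hr, ← h1 _ (hr ▸ hlt)] at hset
      simpa [h0, e1, e6, e9, hI.1, hz, hc] using hset

/-! ### The law of the random choices -/

lemma orderStat_congr {x y : ℕ → ℝ} {d j m : ℕ} (h : ∀ q < d, x q = y q) (hm : m ≤ d) :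
    orderStat x d j m = orderStat y d j m := by
  induction m with
  | zero => rfl
  | succ m ih => rw [orderStat, orderStat, ih (by omega), h m (by omega), countLt_congr h]

lemma dependsOnFirst_sumVec (m κ mode : ℕ) : DependsOnFirst (1 + numDraws m) (sumVec m κ mode) := by
  intro a b h
  funext i
  rw [sumVec, sumVec, sumSeq, sumSeq, h 0 (by omega),
    sliceSeq_congr (y := fun q => (b (1 + q) : ℝ)) fun q hq => by rw [h (1 + q) (by omega)]]

lemma shift_add (m n : ℕ) (ω : Tape) : shift (m + n) ω = shift n (shift m ω) := by
  funext i
  simp only [shift, add_assoc]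

/-- The two outputs of the Sum sampler. -/
def sumChoice (d k j f : ℕ) (ω : Tape) : (ℕ → ℝ) × (ℕ → ℝ) :=
  (pad (sumVec (j - 1) (firstBound k j f) (firstMode k j f) ω),
    pad (sumVec (d - j) k 0 (shift (1 + numDraws (j - 1)) ω)))

/-- The face index and the two outputs of the Sum sampler. -/
def faceChoice (d k j : ℕ) (ω : Tape) : ℕ × (ℕ → ℝ) × (ℕ → ℝ) :=
  (pickIdx (faceWeight k j) (j + 1) (ω 0),
    sumChoice d k j (pickIdx (faceWeight k j) (j + 1) (ω 0)) (shift 1 ω))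

/-- All random choices but the signs. -/
def crossChoice (d k j : ℕ) (ω : Tape) : ℝ × ℕ × (ℕ → ℝ) × (ℕ → ℝ) :=
  (orderStat (fun q => ω q) d j d, faceChoice d k j (shift d ω))

/-- The random choices as a function of the random reals. -/
def choiceFun (d k : ℕ) (ω : Tape) : (Fin d → Bool) × ℝ × ℕ × (ℕ → ℝ) × (ℕ → ℝ) :=
  (randSigns (orthantWeight d k) d fun q => ω q,
    crossChoice d k (numPos (randSigns (orthantWeight d k) d fun q => ω q)) (shift d ω))

lemma measurable_sumChoice (d k j f : ℕ) : Measurable (sumChoice d k j f) :=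
  ((measurable_pad _).comp (measurable_sumVec _ _ _)).prodMk
    ((measurable_pad _).comp ((measurable_sumVec _ _ _).comp (measurable_shift _)))

lemma measurable_faceChoice (d k j : ℕ) : Measurable (faceChoice d k j) :=
  measurable_apply_countable (f := fun ω : Tape => pickIdx (faceWeight k j) (j + 1) (ω 0))
    (h := fun f (ω : Tape) => (f, sumChoice d k j f (shift 1 ω))) (measurable_pickIdx_tape _ _ 0)
    fun f => measurable_const.prodMk ((measurable_sumChoice d k j f).comp (measurable_shift 1))

lemma measurable_crossChoice (d k j : ℕ) : Measurable (crossChoice d k j) :=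
  (measurable_orderStat _ (by fun_prop) _ _ _).prodMk
    ((measurable_faceChoice d k j).comp (measurable_shift d))

lemma measurable_choiceFun (d k : ℕ) : Measurable (choiceFun d k) :=
  measurable_apply_countable (f := fun ω : Tape => randSigns (orthantWeight d k) d fun q => ω q)
    (h := fun J (ω : Tape) => (J, crossChoice d k (numPos J) (shift d ω)))
    (measurable_randSigns _ _)
    fun _ => measurable_const.prodMk ((measurable_crossChoice d k _).comp (measurable_shift d))

/-- The only inadmissible call would have bound `k - 1 = 0` in positive dimension. This means `k =
1` and a face with weight `eulerianSum (j - 1) 0 = 0`, or no cut face and again weight zero. -/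
lemma firstArgs_valid {k j f : ℕ} (hk : 1 ≤ k) (hw : faceWeight k j f ≠ 0) :
    if firstMode k j f = 0 then j - 1 = 0 ∨ 1 ≤ firstBound k j f
      else 1 ≤ firstBound k j f ∧ firstBound k j f ≤ j - 1 := by
  by_cases hc : IsCut k j f
  · have := hc.2
    simp only [firstMode, firstBound, if_pos hc]
    exact ⟨hk, by omega⟩
  · simp only [firstMode, firstBound, if_neg hc, if_true]
    by_contra h
    have hk1 : k = 1 := by omega
    refine hw ?_
    subst hk1
    rw [faceWeight, if_neg (by omega), if_neg hc]
    simp [eulerianSum]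

/-- The first call uses a number of reals that is fixed by its dimension, and the second call starts
behind them; hence the outputs are independent. -/
lemma lintegral_sumChoice {d k j f : ℕ} (hk : 1 ≤ k) (hw : faceWeight k j f ≠ 0)
    {g : (ℕ → ℝ) × (ℕ → ℝ) → ℝ≥0∞} (hg : Measurable g) :
    ∫⁻ ω, g (sumChoice d k j f ω) ∂tapeLaw =
      ∫⁻ w, ∫⁻ v, g (pad w, pad v) ∂cond volume (sumRegion (d - j) k 0)
        ∂cond volume (sumRegion (j - 1) (firstBound k j f) (firstMode k j f)) := by
  have h1 := map_sumVec (firstArgs_valid hk hw)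
  have h2 := map_sumVec (m := d - j) (κ := k) (mode := 0) (by simp [hk])
  rw [← h1, ← h2]
  have hg' : Measurable fun p : (Fin (j - 1) → ℝ) × (Fin (d - j) → ℝ) => g (pad p.1, pad p.2) :=
    hg.comp (((measurable_pad _).comp measurable_fst).prodMk ((measurable_pad _).comp measurable_snd))
  have hp := map_pair_shift (dependsOnFirst_sumVec (j - 1) (firstBound k j f) (firstMode k j f))
    (measurable_sumVec _ _ _) (measurable_sumVec (d - j) k 0)
  rw [← lintegral_prod _ hg'.aemeasurable, ← hp]
  exact (lintegral_map hg' ((measurable_sumVec _ _ _).prodMk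
    ((measurable_sumVec _ _ _).comp (measurable_shift _)))).symm

lemma sum_faceWeight_pos {k : ℕ} (hk : 1 ≤ k) (j : ℕ) :
    0 < ∑ f ∈ Finset.range (j + 1), faceWeight k j f := by
  rcases j with _ | n
  · simp [faceWeight]
  · rw [sum_faceWeight hk]
    exact eulerianSum_pos _ hk

lemma lintegral_faceChoice {d k j : ℕ} (hk : 1 ≤ k)
    {g : ℕ × (ℕ → ℝ) × (ℕ → ℝ) → ℝ≥0∞} (hg : Measurable g) :
    ∫⁻ ω, g (faceChoice d k j ω) ∂tapeLaw = ∑ f ∈ Finset.range (j + 1), faceProb k j f *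
      ∫⁻ w, ∫⁻ v, g (f, pad w, pad v) ∂cond volume (sumRegion (d - j) k 0)
        ∂cond volume (sumRegion (j - 1) (firstBound k j f) (firstMode k j f)) := by
  have h := lintegral_apply_shift (n := 1)
    (f := fun ω : Tape => pickIdx (faceWeight k j) (j + 1) (ω 0))
    (fun a b h => by simp only [h 0 one_pos]) (measurable_pickIdx_tape _ _ 0)
    (s := Finset.range (j + 1)) (fun ω => Finset.mem_range.2 (pickIdx_lt _ (by omega) _))
    (h := fun f ω => g (f, sumChoice d k j f ω))
    fun f => hg.comp (measurable_const.prodMk (measurable_sumChoice d k j f))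
  refine h.trans (Finset.sum_congr rfl fun f hf => ?_)
  rw [tapeLaw_pickIdx (Finset.mem_range.1 hf) (sum_faceWeight_pos hk j), faceProb]
  -- A face of weight zero is drawn with probability zero, so the law of the call does not matter
  -- there.
  by_cases hw : faceWeight k j f = 0
  · simp [hw]
  · rw [lintegral_sumChoice hk hw (g := fun p => g (f, p)) (hg.comp (by fun_prop))]

lemma lintegral_crossChoice {d k j : ℕ} (hk : 1 ≤ k) (hj : j ≤ d)
    {g : ℝ × ℕ × (ℕ → ℝ) × (ℕ → ℝ) → ℝ≥0∞} (hg : Measurable g) :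
    ∫⁻ ω, g (crossChoice d k j ω) ∂tapeLaw = ∑ f ∈ Finset.range (j + 1), faceProb k j f *
      ∫⁻ t, ∫⁻ w, ∫⁻ v, g (t, f, pad w, pad v) ∂cond volume (sumRegion (d - j) k 0)
        ∂cond volume (sumRegion (j - 1) (firstBound k j f) (firstMode k j f))
        ∂crossSectionLaw d j := by
  have ho : Measurable fun ω : Tape => orderStat (fun q => ω q) d j d :=
    measurable_orderStat _ (by fun_prop) _ _ _
  have hp := map_pair_shift (n := d) (f := fun ω : Tape => orderStat (fun q => ω q) d j d)
    (fun a b h => orderStat_congr (fun q hq => by rw [h q hq]) le_rfl) ho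
    (measurable_faceChoice d k j)
  have h1 : ∫⁻ ω, g (crossChoice d k j ω) ∂tapeLaw =
      ∫⁻ t, ∫⁻ ω, g (t, faceChoice d k j ω) ∂tapeLaw ∂crossSectionLaw d j := by
    rw [← lintegral_map hg (measurable_crossChoice d k j)]
    refine (congrArg (fun μ => ∫⁻ x, g x ∂μ) hp).trans ?_
    rw [map_orderStat hj, lintegral_prod _ hg.aemeasurable]
    exact lintegral_congr fun t => lintegral_map (hg.comp (by fun_prop)) (measurable_faceChoice d k j)
  have hm : ∀ f, Measurable fun t => ∫⁻ w, ∫⁻ v, g (t, f, pad w, pad v)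
      ∂cond volume (sumRegion (d - j) k 0)
      ∂cond volume (sumRegion (j - 1) (firstBound k j f) (firstMode k j f)) := by
    intro f
    have hpad := measurable_pad (j - 1)
    have hpad' := measurable_pad (d - j)
    refine Measurable.lintegral_prod_right' (f := fun p : ℝ × (Fin (j - 1) → ℝ) =>
      ∫⁻ v, g (p.1, f, pad p.2, pad v) ∂cond volume (sumRegion (d - j) k 0)) ?_
    refine Measurable.lintegral_prod_right' (f := fun p : (ℝ × (Fin (j - 1) → ℝ)) × (Fin (d - j) → ℝ) =>
      g (p.1.1, f, pad p.1.2, pad p.2)) ?_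
    exact hg.comp (by fun_prop)
  rw [h1, lintegral_congr fun t => lintegral_faceChoice hk (g := fun p => g (t, p))
    (hg.comp (by fun_prop)), lintegral_finsetSum _ fun f _ => (hm f).const_mul _]
  exact Finset.sum_congr rfl fun f _ => lintegral_const_mul _ (hm f)

/-- The tape is read in stages: signs, cross-section index, face, and the two calls. Each stage
depends on the earlier ones only through a discrete value, so the joint law is the stated mixture of
products. -/
theorem map_choiceFun {d k : ℕ} (hk : 1 ≤ k) : tapeLaw.map (choiceFun d k) = choiceLaw d k := by
  refine Measure.ext_of_lintegral _ fun g hg => ?_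
  have h := lintegral_apply_shift (n := d)
    (f := fun ω : Tape => randSigns (orthantWeight d k) d fun q => ω q)
    (fun a b h => randSigns_congr fun q hq => by rw [h q hq]) (measurable_randSigns _ _)
    (s := Finset.univ) (fun ω => Finset.mem_univ _)
    (h := fun J ω => g (J, crossChoice d k (numPos J) ω))
    fun J => hg.comp (measurable_const.prodMk (measurable_crossChoice d k _))
  rw [lintegral_map hg (measurable_choiceFun d k)]
  refine h.trans ?_
  rw [choiceLaw, lintegral_finsetSum_measure]
  refine Finset.sum_congr rfl fun J _ => ?_
  rw [lintegral_finsetSum_measure, tapeLaw_randSigns (orthantWeight_pos d hk) J,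
    lintegral_crossChoice hk (numPos_le J) (g := fun p => g (J, p)) (hg.comp (by fun_prop)),
    Finset.mul_sum]
  refine Finset.sum_congr rfl fun f _ => ?_
  rw [lintegral_smul_measure, lintegral_choice _ _ _ _ _ hg, smul_eq_mul, mul_assoc, orthantProb]

/-! ### The Count sampler -/

/-- These arrays hold what the Count sampler has to remember across a call. -/
lemma Frame.sumProg {s s' : Store} (h : Frame sumProg s s') :
    (∀ a ∈ [0, 1, 2, 30, 31, 34, 40], s'.N a = s.N a) ∧ ∀ a ∈ [1, 2], s'.R a = s.R a := by
  refine ⟨fun a ha => h.N a ?_, fun a ha => h.R a ?_⟩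
  · simp only [List.mem_cons, List.not_mem_nil, or_false] at ha
    rcases ha with rfl | rfl | rfl | rfl | rfl | rfl | rfl <;>
      simp [CountBall.sumProg, sumInit, eulerTable, slicePick, pickProg, facetPicks, conePoints,
        maxProg]
  · simp only [List.mem_cons, List.not_mem_nil, or_false] at ha
    rcases ha with rfl | rfl <;>
      simp [CountBall.sumProg, sumInit, eulerTable, slicePick, pickProg, facetPicks, conePoints,
        maxProg]

/-- This matches the absolute positions on the tape with the nested shifts in `choiceFun`. -/
lemma choices_eq_choiceFun {d k : ℕ} {ω : Tape} {s₁ s₂ s₄ : Store} (h : ChoiceState d k ω s₁)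
    (h₂ : output (numPos (orthantOf d s₁) - 1) s₂ = sumVec (numPos (orthantOf d s₁) - 1)
      (firstBound k (numPos (orthantOf d s₁)) (s₁.N 2 0))
      (firstMode k (numPos (orthantOf d s₁)) (s₁.N 2 0)) (shift (2 * d + 1) ω))
    (h₄ : output (d - numPos (orthantOf d s₁)) s₄ = sumVec (d - numPos (orthantOf d s₁)) k 0
      (shift (2 * d + 1 + (1 + numDraws (numPos (orthantOf d s₁) - 1))) ω)) :
    choices d s₁ s₂ s₄ = choiceFun d k ω := by
  rw [choiceFun, ← h.signs, choices, h₂, h₄]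
  have h1 : shift d (shift d ω) 0 = ω (2 * d) := by simp only [shift]; congr 1; omega
  rw [crossChoice, faceChoice, h1, ← h.face, sumChoice]
  simp only [← shift_add]
  rw [show d + d + 1 = 2 * d + 1 by ring, h.cross]
  rfl

/-- What a run of the Count sampler does. -/
structure CountRun (d k C : ℕ) (ω : Tape) (n₁ n₂ n₃ n₄ n₅ : ℕ) (s₁ s₂ s₃ s₄ s₅ : Store) :
    Prop where
  exec₁ : Exec ω choiceProg (initStore d k) n₁ s₁
  exec₂ : Exec ω sumProg s₁ n₂ s₂
  exec₃ : Exec ω betweenProg s₂ n₃ s₃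
  exec₄ : Exec ω sumProg s₃ n₄ s₄
  exec₅ : Exec ω outputProg s₄ n₅ s₅
  time : n₁ + (n₂ + (n₃ + (n₄ + n₅))) ≤ C * (d + 1) ^ 2
  args₁ : HasArgs s₁ (numPos (orthantOf d s₁) - 1)
    (firstBound k (numPos (orthantOf d s₁)) (s₁.N 2 0))
    (firstMode k (numPos (orthantOf d s₁)) (s₁.N 2 0))
  args₃ : HasArgs s₃ (d - numPos (orthantOf d s₁)) k 0
  choices_eq : choices d s₁ s₂ s₄ = choiceFun d k ω
  output_eq : output d s₅ = assemble k (choices d s₁ s₂ s₄)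

/-- A statement about each single tape. The calls have dimensions `j - 1` and `d - j`, both at most
`d`, so each of them fits into the quadratic budget. -/
lemma exists_countRun {Cs : ℕ}
    (hCs : ∀ (ω : Tape) (s : Store) (m κ mode : ℕ), HasArgs s m κ mode →
      Runs ω sumProg s (Cs * (m + 1) ^ 2) fun s' =>
        (∀ q < m, s'.R 0 q = sumSeq m κ mode (fun q => ω (s.pos + q)) q) ∧
          s'.pos = s.pos + (1 + numDraws m)) :
    ∃ C, ∀ (d k : ℕ), 1 ≤ d → 1 ≤ k → ∀ ω, ∃ n₁ n₂ n₃ n₄ n₅ s₁ s₂ s₃ s₄ s₅,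
      CountRun d k C ω n₁ n₂ n₃ n₄ n₅ s₁ s₂ s₃ s₄ s₅ := by
  obtain ⟨CA, hA⟩ := runs_choiceProg
  obtain ⟨CB, hB⟩ := runs_betweenProg
  obtain ⟨CD, hD⟩ := runs_outputProg
  refine ⟨CA + (Cs + (CB + (Cs + CD))), fun d k hd hk ω => ?_⟩
  obtain ⟨n₁, s₁, x1, t1, i1⟩ := hA ω d k hd hk
  obtain ⟨J, hJ⟩ : ∃ J, J = orthantOf d s₁ := ⟨_, rfl⟩
  obtain ⟨f, hf⟩ : ∃ f, f = s₁.N 2 0 := ⟨_, rfl⟩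
  have hjd := numPos_le J
  have a1 := i1.args
  rw [← hJ, ← hf] at a1
  obtain ⟨n₂, s₂, x2, t2, i2⟩ := hCs ω s₁ _ _ _ a1
  obtain ⟨fN2, fR2⟩ := x2.frame.sumProg
  obtain ⟨n₃, s₃, x3, t3, i3⟩ := hB ω s₂ d k (numPos J) hjd
    (by rw [fN2 30 (by simp), i1.dim]) (by rw [fN2 31 (by simp), i1.bound])
    (by rw [fN2 34 (by simp), i1.num, hJ])
  have f3 := x3.frame
  obtain ⟨n₄, s₄, x4, t4, i4⟩ := hCs ω s₃ _ _ _ i3.2.2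
  obtain ⟨fN4, fR4⟩ := x4.frame.sumProg
  have e1 : s₄.N 1 = s₁.N 1 := by
    rw [fN4 1 (by simp), f3.N 1 (by simp [betweenProg]), fN2 1 (by simp)]
  have e2 : s₄.N 2 0 = f := by
    rw [fN4 2 (by simp), f3.N 2 (by simp [betweenProg]), fN2 2 (by simp), hf]
  have e30 : s₄.N 30 0 = d := by
    rw [fN4 30 (by simp), f3.N 30 (by simp [betweenProg]), fN2 30 (by simp), i1.dim]
  have e31 : s₄.N 31 0 = k := by
    rw [fN4 31 (by simp), f3.N 31 (by simp [betweenProg]), fN2 31 (by simp), i1.bound]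
  have e34 : s₄.N 34 0 = numPos J := by
    rw [fN4 34 (by simp), f3.N 34 (by simp [betweenProg]), fN2 34 (by simp), i1.num, hJ]
  have e40 : s₄.N 40 0 = firstMode k (numPos J) f := by
    rw [fN4 40 (by simp), i3.1, fN2 0 (by simp), a1.2.2]
  have r1 : s₄.R 1 0 = s₁.R 1 0 := by
    rw [fR4 1 (by simp), f3.R 1 (by simp [betweenProg]), fR2 1 (by simp)]
  have hJ4 : orthantOf d s₄ = J := by
    rw [hJ]
    funext i
    simp only [orthantOf, e1]
  obtain ⟨n₅, s₅, x5, t5, i5⟩ := hD ω s₄ d k f J (s₁.R 1 0) (pad (output (numPos J - 1) s₂))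
    (pad (output (d - numPos J) s₄)) e30 e31 e34 hJ4 e2 e40 r1
    (fun q hq => by rw [fR4 2 (by simp), i3.2.1 q hq]) (fun q hq => by simp [pad, hq, output])
  have p2 : s₂.pos = 2 * d + 1 + (1 + numDraws (numPos J - 1)) := by rw [i2.2, i1.pos]
  have p3 : s₃.pos = 2 * d + 1 + (1 + numDraws (numPos J - 1)) := by rw [f3.pos rfl, p2]
  have o2 := runs_sumProg_output i2.1
  have o4 := runs_sumProg_output i4.1
  rw [i1.pos] at o2
  rw [p3] at o4
  have hsq1 : (numPos J - 1 + 1) ^ 2 ≤ (d + 1) ^ 2 := Nat.pow_le_pow_left (by omega) 2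
  have hsq2 : (d - numPos J + 1) ^ 2 ≤ (d + 1) ^ 2 := Nat.pow_le_pow_left (by omega) 2
  subst hJ hf
  exact ⟨n₁, n₂, n₃, n₄, n₅, s₁, s₂, s₃, s₄, s₅, x1, x2, x3, x4, x5,
    bound_add t1 <| bound_add (t2.trans (Nat.mul_le_mul_left _ hsq1)) <| bound_add t3 <|
      bound_add (t4.trans (Nat.mul_le_mul_left _ hsq2)) t5,
    a1, i3.2.2, choices_eq_choiceFun i1 o2 o4, i5⟩

end CountBall

end

theorem mainTheorem3 :
    -- the orthant volume formula
    (∀ (d k : ℕ), 1 ≤ d → 1 ≤ k → ∀ J : Fin d → Bool,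
      volume (CountBall.countBall d k ∩ CountBall.orthant J) =
        ENNReal.ofReal ((CountBall.orthantWeight d k (CountBall.numPos J) : ℝ) / d.factorial)) ∧
    -- one program `A; S; B; S; D` for all inputs, which calls the Sum sampler `S` twice
    ∃ (S A B D : CountBall.Prog) (C : ℕ), CountBall.IsSumSampler S C ∧
      ∀ (d k : ℕ), 1 ≤ d → 1 ≤ k →
        ∃ (n : CountBall.Tape → ℕ) (n₁ n₂ n₃ n₄ n₅ : CountBall.Tape → ℕ)
          (s₁ s₂ s₃ s₄ s₅ : CountBall.Tape → CountBall.Store),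
          -- the run, its length, and the arguments of the two calls
          (∀ ω,
            CountBall.Exec ω (A.seq (S.seq (B.seq (S.seq D)))) (CountBall.initStore d k)
              (n ω) (s₅ ω) ∧
            n ω ≤ C * d ^ 2 ∧
            CountBall.Exec ω A (CountBall.initStore d k) (n₁ ω) (s₁ ω) ∧
            CountBall.Exec ω S (s₁ ω) (n₂ ω) (s₂ ω) ∧
            CountBall.Exec ω B (s₂ ω) (n₃ ω) (s₃ ω) ∧
            CountBall.Exec ω S (s₃ ω) (n₄ ω) (s₄ ω) ∧
            CountBall.Exec ω D (s₄ ω) (n₅ ω) (s₅ ω) ∧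
            (let j := CountBall.numPos (CountBall.orthantOf d (s₁ ω))
             let f := (s₁ ω).N 2 0
             CountBall.HasArgs (s₁ ω) (j - 1) (CountBall.firstBound k j f)
                (CountBall.firstMode k j f) ∧
              CountBall.HasArgs (s₃ ω) (d - j) k 0) ∧
            CountBall.output d (s₅ ω) =
              CountBall.assemble k (CountBall.choices d (s₁ ω) (s₂ ω) (s₄ ω))) ∧
          -- the law of the random choices
          HasLaw (fun ω => CountBall.choices d (s₁ ω) (s₂ ω) (s₄ ω))
            (CountBall.choiceLaw d k) CountBall.tapeLaw ∧
          -- the law of the output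
          HasLaw (fun ω => CountBall.output d (s₅ ω))
            (cond volume (CountBall.countBall d k)) CountBall.tapeLaw := by
  obtain ⟨Cs, hCs⟩ := CountBall.runs_sumProg
  obtain ⟨C, hC⟩ := CountBall.exists_countRun hCs
  refine ⟨fun d k _ hk J => CountBall.volume_countBall_inter_orthant hk J, CountBall.sumProg,
    CountBall.choiceProg, CountBall.betweenProg, CountBall.outputProg, Cs + 4 * C,
    CountBall.isSumSampler_sumProg hCs (by omega), fun d k hd hk => ?_⟩
  choose n₁ n₂ n₃ n₄ n₅ s₁ s₂ s₃ s₄ s₅ h using hC d k hd hk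
  have hlaw : HasLaw (fun ω => CountBall.choices d (s₁ ω) (s₂ ω) (s₄ ω))
      (CountBall.choiceLaw d k) CountBall.tapeLaw := by
    -- The stores themselves are picked by choice, with no measurability known; the recorded choices
    -- equal an explicit measurable function of the tape.
    rw [funext fun ω => (h ω).choices_eq]
    exact ⟨(CountBall.measurable_choiceFun d k).aemeasurable, CountBall.map_choiceFun hk⟩
  refine ⟨fun ω => n₁ ω + (n₂ ω + (n₃ ω + (n₄ ω + n₅ ω))), n₁, n₂, n₃, n₄, n₅, s₁, s₂, s₃, s₄, s₅,
    fun ω => ⟨?_, ?_, (h ω).exec₁, (h ω).exec₂, (h ω).exec₃, (h ω).exec₄, (h ω).exec₅,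
      ⟨(h ω).args₁, (h ω).args₃⟩, (h ω).output_eq⟩, hlaw, ?_⟩
  · exact (h ω).exec₁.seq ((h ω).exec₂.seq ((h ω).exec₃.seq ((h ω).exec₄.seq (h ω).exec₅)))
  -- As `d ≥ 1`, `d + 1 ≤ 2 * d`; this is the origin of the factor `4` in the constant.
  · have hsq : C * (d + 1) ^ 2 ≤ C * (4 * d ^ 2) := Nat.mul_le_mul_left _ (by nlinarith)
    calc _ ≤ C * (d + 1) ^ 2 := (h ω).time
      _ ≤ C * (4 * d ^ 2) := hsq
      _ = 4 * C * d ^ 2 := by ring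
      _ ≤ (Cs + 4 * C) * d ^ 2 := Nat.mul_le_mul_right _ (Nat.le_add_left _ _)
  · rw [funext fun ω => (h ω).output_eq]
    refine ⟨(CountBall.measurable_assemble d k).comp_aemeasurable hlaw.aemeasurable, ?_⟩
    rw [← CountBall.map_assemble_choiceLaw hk, ← hlaw.map_eq]
    exact (AEMeasurable.map_map_of_aemeasurable
      (CountBall.measurable_assemble d k).aemeasurable hlaw.aemeasurable).symm
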